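/- **Setting.** Let $P\ge 1$ and let $$u_0(x)=\sum_{p=1}^P\frac{c_p}{x-z_p}+\mathrm{c.c.}\in L^1(\mathbb R),\qquad c_p\ne0,\quad \operatorname{Im}z_p>0,\quad \operatorname{Re}z_1<\dots<\operatorname{Re}z_P,$$ be a positive rational Klaus–Shaw potential: $u_0>0$ on $\mathbb R$, and $u_0$ is strictly monotone on $(-\infty,x_{\mathrm c})$ and on $(x_{\mathrm c},\infty)$ for some $x_{\mathrm c}\in\mathbb R$. Write $u_0$ also for the rational function on $\mathbb C$. The bulk is $\mathcal B=(-\sup u_0,-\inf u_0)=(-\max u_0,0)$. Put $h(x;\lambda)=\lambda x+f(x)$ with $$f(x)=\sum_p c_p\big(\operatorname{Log}(i(x-z_p))+\tfrac{\pi i}{2}\big)+\mathrm{c.c.},$$ meaning $\sum_p c_p(\operatorname{Log}(i(x-z_p))+\tfrac{\pi i}2)+c_p^*(\operatorname{Log}(-i(x-z_p^*))-\tfrac{\pi i}2)$ for complex $x$. For $\lambda<0$ and $\epsilon>0$ let $\mathbf A(\lambda)$ be the $P\times P$ matrix $$A_{mp}(\lambda)=\int_{C_m}\frac{e^{-ih(z;\lambda)/\epsilon}}{z-z_p}\,dz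 .$$ Here $C_m$ runs, in the domain of analyticity of $f$, from $i\infty$ to the left of $\operatorname{Re}z=\operatorname{Re}z_1$ to $i\infty$ to the right of $\operatorname{Re}z=\operatorname{Re}z_m$ and (if $m<P$) to the left of $\operatorname{Re}z=\operatorname{Re}z_{m+1}$; if $ic_m/\epsilon$ is a negative integer, $C_m$ ends at $z_m$ instead. **Suitable modifications.** Let $J$ be a subset of $(-\infty,0)\setminus\overline{\mathcal B}$ or of $\mathcal B$ (for instance one point, or an interval). A suitable modification on $J$ consists of matrices $\mathbf N=\mathbf N(\epsilon,\lambda)$ and of contours $W_m=W_m(\lambda)$, $m=1,\dots,P$, which do not depend on $\epsilon$ and depend continuously on $\lambda\in J$ (together with their tangents). Each contour avoids the points $z_p,z_p^*$ and carries a branch of $h$ obtained by analytic continuation along it, also continuous in $\lambda$. The level $\operatorname{Re}(-ih)$ tends to $-\infty$ at both ends of $W_m$, and the integrals below converge absolutely for small $\epsilon$; both hold locally uniformly in $\lambda\in J$. Moreover: * for small $\epsilon$, locally uniformly in $\lambda\in J$, $\mathbf N$ is invertible and $\tilde{\mathbf A}=\mathbf N\mathbf A$ has the entries $\tilde A_{mp}(\lambda)=\int_{W_m}\frac{e^{-ih(z;\lambda)/\epsilon}}{z-z_p}dz$;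 * outside the bulk: every $W_m$ passes, in a direction $e^{i\theta_m}$ of steepest descent, over a critical point $x_m=x_m(\lambda)$ of $h(\cdot;\lambda)$ with $\operatorname{Im}x_m>0$, where $\operatorname{Re}(-ih)$ is strictly maximal along $W_m$, and $x_1,\dots,x_P$ are distinct; * in the bulk: the same holds for all rows $m\neq Q$ for one index $Q$, while $W_Q$ passes over the two real critical points $x_-(\lambda)<x_+(\lambda)$ (the two solutions of $u_0(x)=-\lambda$) in the directions $e^{-i\pi/4}$ and $e^{i\pi/4}$, with the principal branch of $h$ at these points, and $\operatorname{Re}(-ih)<0$ elsewhere on $W_Q$. Write $h_m(\lambda)$ for the value of $h$ at $x_m$ on $W_m$, $h_\pm(\lambda)=h(x_\pm(\lambda);\lambda)$, $h''=u_0'$, and $\tilde D(\lambda)=\det\tilde{\mathbf A}(\lambda)$. In the bulk relabel the points $x_m$, $m\ne Q$, and the corresponding $\theta_m,h_m$ in the order of their rows as $m=1,\dots,P-1$, and let $$\Psi^-(x)=(x-x_-)\frac{\prod_{p=1}^{P-1}(x-x_p)}{\prod_{p=1}^P(x-z_p)},\qquad \Psi^+(x)=(x-x_+)\frac{\prod_{p=1}^{P-1}(x-x_p^*)}{\prod_{p=1}^P(x-z_p^*)},$$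 where $x_1,\dots,x_{P-1}$ are all the critical points of $h(\cdot;\lambda)$ in the upper half-plane. Let $\psi_\pm(\lambda)\in\mathbb R$ be any angles with $e^{\mp i\psi_\pm-i\pi/4}=\Psi^\mp(x_\pm)/|\Psi^\mp(x_\pm)|$, and let $$T_\epsilon(\lambda)=\frac1{2\pi\epsilon}\int_{-\max u_0}^{\lambda}(x_+(\eta)-x_-(\eta))\,d\eta+\frac1{2\pi}(\psi_+(\lambda)-\psi_-(\lambda)).$$ **Proposition.** Let a suitable modification on $J$ be given. 1. If $J\subset(-\infty,0)\setminus\overline{\mathcal B}$, then $\tilde D(\lambda)=U_\epsilon(\lambda)(1+O(\epsilon))$ as $\epsilon\downarrow0$, where $$U_\epsilon(\lambda)=(2\pi\epsilon)^{P/2}\Big(\prod_{m=1}^P\frac{e^{i\theta_m}e^{-ih_m(\lambda)/\epsilon}}{\sqrt{|h''(x_m;\lambda)|}}\Big)\det\Big(\frac1{x_m-z_p}\Big)_{m,p=1}^P\neq0 .$$ 2. If $J\subset\mathcal B$, then $\tilde D(\lambda)=V_\epsilon(\lambda)\big(\sin(\pi T_\epsilon(\lambda))+O(\epsilon)\big)$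 as $\epsilon\downarrow0$, where $$V_\epsilon(\lambda)=\frac{-2i(-1)^{P-Q}(2\pi\epsilon)^{P/2}P(\lambda)}{\sqrt{-\lambda(x_+-x_-)}}\Big(\prod_{m=1}^{P-1}\frac{e^{i\theta_m}e^{-ih_m(\lambda)/\epsilon}}{\sqrt{|h''(x_m;\lambda)|}}\Big)e^{-i(h_++h_-)/(2\epsilon)}e^{-i(\psi_++\psi_-)/2}\ne0,$$ $$P(\lambda)=\frac{\prod_{1\le i<j\le P-1}(x_j-x_i)\prod_{1\le i<j\le P}(z_i-z_j)}{\prod_{m=1}^{P-1}\prod_{p=1}^P(x_m-z_p)} .$$ In both cases the error is uniform on compact subsets of $J$: for each compact $K\subset J$ there are $C$ and $\epsilon_0>0$ such that the $O(\epsilon)$ term is at most $C\epsilon$ in modulus for all $\lambda\in K$ and $0<\epsilon<\epsilon_0$. -/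

import Mathlib

open Complex MeasureTheory Set Filter Topology ComplexConjugate

noncomputable section

namespace BenjaminOno

/-- Data of a rational potential
`u₀(x) = ∑ₚ c_p / (x - z_p) + c.c.` with `P = n + 1` poles in the upper half-plane. -/
structure RationalPotential (n : ℕ) where
  c : Fin (n + 1) → ℂ
  z : Fin (n + 1) → ℂ
  c_ne_zero : ∀ p, c p ≠ 0
  z_im_pos : ∀ p, 0 < (z p).im
  z_re_strictMono : StrictMono fun p => (z p).re
  integrable : Integrable fun x : ℝ =>
    (∑ p, (c p / ((x : ℂ) - z p) + conj (c p) / ((x : ℂ) - conj (z p)))).re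

namespace RationalPotential

variable {n : ℕ} (V : RationalPotential n)

/-- The rational function `u₀` of a complex variable. -/
def u (x : ℂ) : ℂ :=
  ∑ p, (V.c p / (x - V.z p) + conj (V.c p) / (x - conj (V.z p)))

/-- The potential `u₀ : ℝ → ℝ`. -/
def u0 (x : ℝ) : ℝ := (V.u x).re

/-- On the real axis `u` is real, so that `u0` is its restriction. -/
theorem u_ofReal (x : ℝ) : V.u x = (V.u0 x : ℂ) := by
  have h : conj (V.u x) = V.u x := by
    simp only [u, map_sum, map_add, map_div₀, map_sub, conj_conj, conj_ofReal]
    exact Finset.sum_congr rfl fun p _ => add_comm _ _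
  exact (conj_eq_iff_re.mp h).symm

/-- Klaus–Shaw condition: strict monotonicity on each side of some `x_c`. -/
def IsKlausShaw : Prop :=
  ∃ xc : ℝ, (StrictMonoOn V.u0 (Iio xc) ∨ StrictAntiOn V.u0 (Iio xc)) ∧
    (StrictMonoOn V.u0 (Ioi xc) ∨ StrictAntiOn V.u0 (Ioi xc))

/-- A positive rational Klaus–Shaw potential. -/
def IsPositiveKlausShaw : Prop := V.IsKlausShaw ∧ ∀ x, 0 < V.u0 x

/-- The bulk `{l : -sup u₀ < l < -inf u₀}`. -/
def bulk : Set ℝ := {l | -(⨆ x, V.u0 x) < l ∧ l < -(⨅ x, V.u0 x)}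

/-- The antiderivative `f` of `u₀`, in terms of principal logarithms. Its branch cuts are the
vertical rays from the poles away from the real axis. -/
def f (x : ℂ) : ℂ :=
  ∑ p, (V.c p * (log (I * (x - V.z p)) + Real.pi * I / 2) +
    conj (V.c p) * (log (-I * (x - conj (V.z p))) - Real.pi * I / 2))

/-- `h(x; l) = l x + f(x)`. Hence `h' = l + u` and `h'' = u'`. -/
def h (l : ℝ) (x : ℂ) : ℂ := l * x + V.f x

/-- The integrand `e^{-i h(x; l)/ε} / (x - z_p)`. -/
def integrand (ε l : ℝ) (p : Fin (n + 1)) (x : ℂ) : ℂ :=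
  exp (-I * V.h l x / ε) / (x - V.z p)

/-- Abscissa of the initial vertical ray of the contours `C_m`. -/
def leftAbscissa : ℝ := (V.z 0).re - 1

/-- Abscissa, strictly between those of `z_m` and of the next pole, of the final vertical ray of
the U-shaped contour around the first poles up to `z_m`. -/
def rightAbscissa (m : Fin (n + 1)) : ℝ :=
  if hm : (m : ℕ) + 1 < n + 1 then ((V.z m).re + (V.z ⟨m + 1, hm⟩).re) / 2 else (V.z m).re + 1

open Classical in
/-- The matrix `A(l)`, for `l < 0`: `A_mp = ∫_{C_m} e^{-i h(z; l)/ε} / (z - z_p) dz`.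
The contour `C_m` descends vertically from `i∞` to the real axis left of all the poles, follows
the real axis, and rises vertically: to `i∞` just after `z_m` in general, and to the point `z_m`
if `i c_m / ε` is a negative integer. -/
def A (ε l : ℝ) : Matrix (Fin (n + 1)) (Fin (n + 1)) ℂ := fun m p =>
  if ∃ k : ℕ, 0 < k ∧ I * V.c m / ε = -(k : ℂ) then
    -(∫ y in Ioi (0 : ℝ), V.integrand ε l p (V.leftAbscissa + y * I) * I) +
      (∫ x in V.leftAbscissa..(V.z m).re, V.integrand ε l p x) +
      ∫ y in (0 : ℝ)..(V.z m).im, V.integrand ε l p ((V.z m).re + y * I) * I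
  else
    -(∫ y in Ioi (0 : ℝ), V.integrand ε l p (V.leftAbscissa + y * I) * I) +
      (∫ x in V.leftAbscissa..V.rightAbscissa m, V.integrand ε l p x) +
      ∫ y in Ioi (0 : ℝ), V.integrand ε l p (V.rightAbscissa m + y * I) * I

/-- The smaller real critical point `x₋(l)` of `h(·; l)`, for `l` in the bulk. -/
def xMinus (l : ℝ) : ℝ := sInf {x : ℝ | V.u0 x = -l}

/-- The larger real critical point `x₊(l)` of `h(·; l)`, for `l` in the bulk. -/
def xPlus (l : ℝ) : ℝ := sSup {x : ℝ | V.u0 x = -l}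

/-- The critical points of `h(·; l)` in the upper half-plane. -/
def upperCritical (l : ℝ) : Set ℂ :=
  {x | 0 < x.im ∧ (∀ p, x ≠ V.z p) ∧ (l : ℂ) + V.u x = 0}

/-- `Ψ⁻(x; l)`, for `l` in the bulk. -/
def PsiMinus (l : ℝ) (x : ℂ) : ℂ :=
  (x - V.xMinus l) * (∏ᶠ y ∈ V.upperCritical l, (x - y)) / ∏ p, (x - V.z p)

/-- `Ψ⁺(x; l)`, for `l` in the bulk. -/
def PsiPlus (l : ℝ) (x : ℂ) : ℂ :=
  (x - V.xPlus l) * (∏ᶠ y ∈ V.upperCritical l, (x - conj y)) / ∏ p, (x - conj (V.z p))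

/-- `psi` is a choice of the angle `ψ₊(l)`, which is determined modulo `2π`. -/
def IsPsiPlus (l psi : ℝ) : Prop :=
  exp (-I * psi - I * Real.pi / 4) = V.PsiMinus l (V.xPlus l) / ‖V.PsiMinus l (V.xPlus l)‖

/-- `psi` is a choice of the angle `ψ₋(l)`, which is determined modulo `2π`. -/
def IsPsiMinus (l psi : ℝ) : Prop :=
  exp (I * psi - I * Real.pi / 4) = V.PsiPlus l (V.xMinus l) / ‖V.PsiPlus l (V.xMinus l)‖

/-- The phase `T_ε(l)`, for given values of `ψ₊(l)` and `ψ₋(l)`. -/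
def T (ε l psiP psiM : ℝ) : ℝ :=
  1 / (2 * Real.pi * ε) * (∫ s in (-(⨆ x, V.u0 x))..l, (V.xPlus s - V.xMinus s)) +
    1 / (2 * Real.pi) * (psiP - psiM)

end RationalPotential

/-- A contour `W(l)` depending continuously on `l ∈ J` (no condition if `J` is a point), with an
analytic branch of `h(·; l)` along it. The contour is parametrized by the real line; piecewise
smooth contours are included since the speed may vanish. It avoids the poles `z_p`, `z_p*` and may
end at infinity or at a pole. The branch of `h` is given by continuous logarithms of
`i (z - z_p)` and `-i (z - z_p*)` along the contour. -/
structure Contour {n : ℕ} (V : RationalPotential n) (J : Set ℝ) where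
  γ : ℝ → ℝ → ℂ
  logZ : Fin (n + 1) → ℝ → ℝ → ℂ
  logZc : Fin (n + 1) → ℝ → ℝ → ℂ
  differentiable : ∀ l ∈ J, Differentiable ℝ (γ l)
  continuousOn : ContinuousOn (fun q : ℝ × ℝ => γ q.1 q.2) (J ×ˢ univ)
  continuousOn_deriv : ContinuousOn (fun q : ℝ × ℝ => deriv (γ q.1) q.2) (J ×ˢ univ)
  continuousOn_logZ : ∀ p, ContinuousOn (fun q : ℝ × ℝ => logZ p q.1 q.2) (J ×ˢ univ)
  continuousOn_logZc : ∀ p, ContinuousOn (fun q : ℝ × ℝ => logZc p q.1 q.2) (J ×ˢ univ)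
  exp_logZ : ∀ p, ∀ l ∈ J, ∀ t, exp (logZ p l t) = I * (γ l t - V.z p)
  exp_logZc : ∀ p, ∀ l ∈ J, ∀ t, exp (logZc p l t) = -I * (γ l t - conj (V.z p))

namespace Contour

variable {n : ℕ} {V : RationalPotential n} {J : Set ℝ} (W : Contour V J)

/-- The branch of `h(·; l)` along the contour, as a function of the parameter. -/
def H (l t : ℝ) : ℂ :=
  l * W.γ l t + ∑ p, (V.c p * (W.logZ p l t + Real.pi * I / 2) +
    conj (V.c p) * (W.logZc p l t - Real.pi * I / 2))

/-- The level `Re (-i h)` along the contour. -/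
def R (l t : ℝ) : ℝ := (-I * W.H l t).re

/-- `e^{-i h/ε} / (z - z_p) · dz/dt` along the contour. -/
def integrand (ε l : ℝ) (p : Fin (n + 1)) (t : ℝ) : ℂ :=
  exp (-I * W.H l t / ε) / (W.γ l t - V.z p) * deriv (W.γ l) t

/-- `∫_W e^{-i h/ε} / (z - z_p) dz`. -/
def integral (ε l : ℝ) (p : Fin (n + 1)) : ℂ := ∫ t, W.integrand ε l p t

/-- The level `Re (-i h)` tends to `-∞` at both ends of the contour, and the integrals converge
absolutely for small `ε`, both locally uniformly in `l`. -/
def EndsInValleys : Prop :=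
  ∀ K ⊆ J, IsCompact K →
    (∀ B : ℝ, ∃ T : ℝ, ∀ l ∈ K, ∀ t : ℝ, T ≤ |t| → W.R l t ≤ B) ∧
    ∃ ε₁ > 0, ∃ g : ℝ → ℝ, Integrable g ∧
      ∀ l ∈ K, ∀ p, ∀ t, ‖W.integrand ε₁ l p t‖ ≤ g t

/-- At parameter `0` the contour passes, in a direction of steepest descent, over a critical point
of `h` in the upper half-plane, at which `Re (-i h)` is strictly maximal along the contour. -/
def OverComplexPoint : Prop :=
  ∀ l ∈ J, W.γ l 0 ∈ V.upperCritical l ∧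
    (-I * deriv V.u (W.γ l 0) * deriv (W.γ l) 0 ^ 2).re < 0 ∧
    (-I * deriv V.u (W.γ l 0) * deriv (W.γ l) 0 ^ 2).im = 0 ∧
    ∀ t ≠ 0, W.R l t < W.R l 0

/-- At the parameters `-1` and `1` the contour passes over the real critical points `x₋`, `x₊` on
the zero level of `Re (-i h)`, with its branch of `h` equal to the principal one at these points,
in the directions `e^{-iπ/4}` and `e^{iπ/4}`, and elsewhere `Re (-i h)` is negative. -/
def OverRealPoints : Prop :=
  ∀ l ∈ J,
    (W.γ l (-1) = V.xMinus l ∧ W.H l (-1) = V.h l (V.xMinus l) ∧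
      ∃ r : ℝ, 0 < r ∧ deriv (W.γ l) (-1) = r * exp (-I * Real.pi / 4)) ∧
    (W.γ l 1 = V.xPlus l ∧ W.H l 1 = V.h l (V.xPlus l) ∧
      ∃ r : ℝ, 0 < r ∧ deriv (W.γ l) 1 = r * exp (I * Real.pi / 4)) ∧
    ∀ t, t ≠ -1 → t ≠ 1 → W.R l t < 0

/-- The direction `e^{iθ}` with which the contour traverses its critical point. -/
def direction (l : ℝ) : ℂ := deriv (W.γ l) 0 / ‖deriv (W.γ l) 0‖

/-- The factor `e^{iθ} e^{-i h(x; l)/ε} / √|h''(x; l)|` at the critical point `x` traversed at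
parameter `0`. -/
def saddleFactor (ε l : ℝ) : ℂ :=
  W.direction l * exp (-I * W.H l 0 / ε) / √‖deriv V.u (W.γ l 0)‖

end Contour

section Suitable

variable {n : ℕ} {V : RationalPotential n} {J : Set ℝ}

/-- The modified matrix `N A` with `N` invertible has the same form as `A`, with the contours
`W_m` in place of `C_m`, for all small `ε` (locally uniformly in `l`). -/
def IsModification (N : ℝ → ℝ → Matrix (Fin (n + 1)) (Fin (n + 1)) ℂ)
    (W : Fin (n + 1) → Contour V J) : Prop :=
  ∀ K ⊆ J, IsCompact K → ∃ ε₁ > 0, ∀ l ∈ K, ∀ ε, 0 < ε → ε ≤ ε₁ →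
    IsUnit (N ε l) ∧ ∀ m p, (N ε l * V.A ε l) m p = (W m).integral ε l p

/-- Suitability outside the bulk: the rows are associated one-to-one with complex critical points,
each of which dominates on the contour of its row. -/
structure IsSuitableOutside (N : ℝ → ℝ → Matrix (Fin (n + 1)) (Fin (n + 1)) ℂ)
    (W : Fin (n + 1) → Contour V J) : Prop where
  modification : IsModification N W
  ends : ∀ m, (W m).EndsInValleys
  overPoint : ∀ m, (W m).OverComplexPoint
  injective : ∀ l ∈ J, Function.Injective fun m => (W m).γ l 0

/-- Suitability in the bulk: as outside the bulk, except that the contour of the row `Q` passes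
over the two real critical points. -/
structure IsSuitableBulk (N : ℝ → ℝ → Matrix (Fin (n + 1)) (Fin (n + 1)) ℂ)
    (W : Fin (n + 1) → Contour V J) (Q : Fin (n + 1)) : Prop where
  modification : IsModification N W
  ends : ∀ m, (W m).EndsInValleys
  overPoint : ∀ m, m ≠ Q → (W m).OverComplexPoint
  overReal : (W Q).OverRealPoints
  injective : ∀ l ∈ J, Function.Injective fun j : Fin n => (W (Q.succAbove j)).γ l 0

/-- The modified Evans function `det (N A)`. -/
def evans (V : RationalPotential n) (N : ℝ → ℝ → Matrix (Fin (n + 1)) (Fin (n + 1)) ℂ)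
    (ε l : ℝ) : ℂ := (N ε l * V.A ε l).det

/-- The leading factor `U_ε(l)` outside the bulk. -/
def leadingU (W : Fin (n + 1) → Contour V J) (ε l : ℝ) : ℂ :=
  (((2 * Real.pi * ε) ^ (((n : ℝ) + 1) / 2) : ℝ) : ℂ) * (∏ m, (W m).saddleFactor ε l) *
    (Matrix.of fun m p => 1 / ((W m).γ l 0 - V.z p)).det

/-- The Cauchy-determinant factor `P(l)` in the bulk; the complex critical points are numbered
in the order of the rows other than `Q`. -/
def cauchyFactor (W : Fin (n + 1) → Contour V J) (Q : Fin (n + 1)) (l : ℝ) : ℂ :=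
  (∏ j : Fin n, ∏ i ∈ Finset.Iio j, ((W (Q.succAbove j)).γ l 0 - (W (Q.succAbove i)).γ l 0)) *
    (∏ j : Fin (n + 1), ∏ i ∈ Finset.Iio j, (V.z i - V.z j)) /
    ∏ j : Fin n, ∏ p, ((W (Q.succAbove j)).γ l 0 - V.z p)

/-- The leading factor `V_ε(l)` in the bulk, for given values of `ψ₊(l)` and `ψ₋(l)`. The rows are
numbered from `0` to `n` here, so that `n - Q` is the usual `P - Q`. -/
def leadingV (W : Fin (n + 1) → Contour V J) (Q : Fin (n + 1)) (ε l psiP psiM : ℝ) : ℂ :=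
  -2 * I * (-1) ^ (n - (Q : ℕ)) * (((2 * Real.pi * ε) ^ (((n : ℝ) + 1) / 2) : ℝ) : ℂ) *
    cauchyFactor W Q l / √(-l * (V.xPlus l - V.xMinus l)) *
    (∏ j : Fin n, (W (Q.succAbove j)).saddleFactor ε l) *
    exp (-I * (V.h l (V.xPlus l) + V.h l (V.xMinus l)) / (2 * ε)) *
    exp (-I * (psiP + psiM) / 2)

end Suitable

end BenjaminOno

end

/-! After the modification every matrix entry is a Laplace integral over a contour that lies below
its top level except at prescribed saddle points, so steepest descent applies row by row. A row over
one complex saddle x_m is, up to O(ε) in each entry, the scalar √(2πε) e^{iθ_m} e^{-ih_m/ε} /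
√|h''(x_m)| times the Cauchy row 1/(x_m - z_p). Once these scalars are pulled out, the matrix is
within O(ε) of a bounded one, and the determinant is Lipschitz on bounded sets
(`exists_det_sub_bound`). Outside the bulk the limit is a Cauchy matrix with distinct nodes, whose
determinant is bounded away from zero on compact sets.

In the bulk, row Q tends to a combination of two Cauchy rows at x_±, both at level zero because h is
real on the real axis. The determinant is linear in that row, and Cauchy's formula
(`det_cauchy_row`) gives P(λ) times a sum over ± of the saddle coefficient times r(x_±), where r(x)
= ∏(x - x_j)/∏(x - z_p). Counting degrees closes the computation: the x_j, their conjugates and x_±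
are 2P distinct zeros of λ + u₀, whose numerator has degree 2P, so they give its full factorization
(`IsFullCritical.add_u_eq`). It follows that |u₀'(x_±)| = -λ(x_+ - x_-)|r(x_±)|². The moduli
therefore cancel, and two phases remain, made of h_± and ψ_±. Their difference is a sine, and h_+ -
h_- is the integral of x_+ - x_- by the layer cake formula (`IsPositiveKlausShaw.h_sub_h`), so its
argument is πT_ε (`IsFullCritical.interference`). As the sine can vanish, the error is measured
against the prefactor.

Uniformity comes from constants that depend only on bounds for the data. `exists_laplace_bound` does
this for the model integral, `exists_saddle_bound` for a short curved arc, and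
`Contour.exists_tail_bound` for the exponentially small rest of the contour. Compactness of K
supplies the bounds. -/

noncomputable section

namespace BenjaminOno

/-! ### Laplace's method on a real interval -/

/-- A polynomial in `y` is absorbed by an exponential. -/
theorem poly_mul_exp_neg_le {a y : ℝ} (ha : 0 < a) (hy : 0 ≤ y) :
    (y + y ^ 2 + y ^ 3) * Real.exp (-(a * y)) ≤ a⁻¹ + 2 * a⁻¹ ^ 2 + 6 * a⁻¹ ^ 3 := by
  have hay : 0 ≤ a * y := by positivity
  have key : ∀ k : ℕ, y ^ k * Real.exp (-(a * y)) ≤ k.factorial * a⁻¹ ^ k := by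
    intro k
    have h := Real.pow_div_factorial_le_exp (a * y) hay k
    rw [div_le_iff₀ (by positivity), mul_pow] at h
    rw [Real.exp_neg, ← div_eq_mul_inv, div_le_iff₀ (Real.exp_pos _), inv_pow, mul_right_comm,
      ← div_eq_mul_inv, le_div_iff₀ (by positivity)]
    linarith
  have h1 := key 1
  have h2 := key 2
  have h3 := key 3
  norm_num [Nat.factorial] at h1 h2 h3 ⊢
  linarith

theorem norm_exp_sub_one_sub_le (v : ℂ) :
    ‖exp v - 1 - v‖ ≤ ‖v‖ ^ 2 * Real.exp ‖v‖ := by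
  have h := Complex.norm_exp_sub_sum_le_norm_mul_exp v 2
  simpa [Finset.sum_range_succ, sub_sub] using h

/-- Pointwise form of the expansion of a Laplace integrand around its saddle, after the rescaled
cubic term has been split off. -/
theorem norm_exp_mul_sub_expansion_le {M r e d s : ℝ} {b g₀ g₁ v G : ℂ}
    (hM : 0 ≤ M) (hr : 0 ≤ r) (he : 0 < e) (hs : |s| ≤ r)
    (hb : ‖b‖ ≤ M) (hg₀ : ‖g₀‖ ≤ M) (hg₁ : ‖g₁‖ ≤ M)
    (hv : ‖v - b * s ^ 3 / e‖ ≤ M * s ^ 4 / e) (hG : ‖G - g₀ - g₁ * s‖ ≤ M * s ^ 2)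
    (hvd : ‖v‖ ≤ d) :
    ‖exp v * G - g₀ - (g₁ * s + g₀ * b * s ^ 3 / e)‖ ≤
      (M ^ 2 * (1 + r) ^ 2 * (M * (1 + r + r ^ 2)) + M ^ 2 * (1 + r) ^ 2 + M ^ 2 + M) *
        (s ^ 2 + s ^ 4 / e + s ^ 6 / e ^ 2) * Real.exp d := by
  have hs0 := abs_nonneg s
  have hsq : |s| ^ 2 = s ^ 2 := sq_abs s
  have hs4 : |s| ^ 4 = s ^ 4 := by rw [show (4 : ℕ) = 2 * 2 from rfl, pow_mul, pow_mul, hsq]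
  have hd : 0 ≤ d := (norm_nonneg v).trans hvd
  have hE : 1 ≤ Real.exp d := Real.one_le_exp hd
  have hv1 : ‖v‖ ≤ M * (1 + r) * |s| ^ 3 / e := by
    have h1 : ‖v‖ ≤ ‖v - b * s ^ 3 / e‖ + ‖b * s ^ 3 / e‖ := norm_le_norm_sub_add _ _
    have h2 : ‖b * (s : ℂ) ^ 3 / e‖ ≤ M * |s| ^ 3 / e := by
      simp only [norm_div, norm_mul, norm_pow, Complex.norm_real, Real.norm_eq_abs, abs_of_pos he]
      gcongr
    have h3 : M * s ^ 4 / e ≤ M * r * |s| ^ 3 / e := by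
      rw [← hs4]
      have : M * |s| ^ 4 ≤ M * r * |s| ^ 3 := by
        have : |s| ^ 4 ≤ r * |s| ^ 3 := by
          rw [pow_succ, mul_comm]; gcongr
        nlinarith
      gcongr
    calc ‖v‖ ≤ M * r * |s| ^ 3 / e + M * |s| ^ 3 / e := by linarith
      _ = _ := by ring
  have hGg : ‖G - g₀‖ ≤ M * (1 + r) * |s| := by
    have h1 : ‖G - g₀‖ ≤ ‖G - g₀ - g₁ * s‖ + ‖g₁ * s‖ := norm_le_norm_sub_add _ _
    have h2 : ‖g₁ * (s : ℂ)‖ ≤ M * |s| := by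
      simp only [norm_mul, Complex.norm_real, Real.norm_eq_abs]
      gcongr
    have h3 : M * s ^ 2 ≤ M * r * |s| := by
      rw [← hsq, sq, ← mul_assoc]; gcongr
    linarith
  have hGn : ‖G‖ ≤ M * (1 + r + r ^ 2) := by
    have h1 : ‖G‖ ≤ ‖G - g₀‖ + ‖g₀‖ := norm_le_norm_sub_add _ _
    have h2 : M * (1 + r) * |s| ≤ M * (1 + r) * r := by gcongr
    nlinarith
  have e1 : ‖(exp v - 1 - v) * G‖ ≤
      (M * (1 + r) * |s| ^ 3 / e) ^ 2 * Real.exp d * (M * (1 + r + r ^ 2)) := by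
    rw [norm_mul]
    refine mul_le_mul ((norm_exp_sub_one_sub_le v).trans ?_) hGn (norm_nonneg _) (by positivity)
    gcongr
  have e2 : ‖v * (G - g₀)‖ ≤ (M * (1 + r) * |s| ^ 3 / e) * (M * (1 + r) * |s|) := by
    rw [norm_mul]; gcongr
  have e3 : ‖(v - b * s ^ 3 / e) * g₀‖ ≤ M * s ^ 4 / e * M := by
    rw [norm_mul]; gcongr
  -- The four pieces have orders s⁶/e², s⁴/e, s⁴/e and s². On the Gaussian scale s² ~ e each of them
  -- is O(e), while the subtracted odd terms are of order √e.
  have hsum : exp v * G - g₀ - (g₁ * s + g₀ * b * s ^ 3 / e) =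
      (exp v - 1 - v) * G + v * (G - g₀) + (v - b * s ^ 3 / e) * g₀ + (G - g₀ - g₁ * s) := by
    ring
  have hp1 : 0 ≤ M ^ 2 * (1 + r) ^ 2 * (M * (1 + r + r ^ 2)) := by positivity
  have hp2 : 0 ≤ M ^ 2 * (1 + r) ^ 2 := by positivity
  have q2 : 0 ≤ s ^ 2 := by positivity
  have q4 : 0 ≤ s ^ 4 / e := by positivity
  have q6 : 0 ≤ s ^ 6 / e ^ 2 := by positivity
  have f1 : (M * (1 + r) * |s| ^ 3 / e) ^ 2 * Real.exp d * (M * (1 + r + r ^ 2)) =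
      M ^ 2 * (1 + r) ^ 2 * (M * (1 + r + r ^ 2)) * (s ^ 6 / e ^ 2) * Real.exp d := by
    have : |s| ^ 6 = s ^ 6 := by rw [show (6 : ℕ) = 2 * 3 from rfl, pow_mul, pow_mul, hsq]
    rw [← this]; ring
  have f2 : (M * (1 + r) * |s| ^ 3 / e) * (M * (1 + r) * |s|) =
      M ^ 2 * (1 + r) ^ 2 * (s ^ 4 / e) := by
    rw [← hs4]; ring
  have f3 : M * s ^ 4 / e * M = M ^ 2 * (s ^ 4 / e) := by ring
  rw [hsum]
  calc _ ≤ ‖(exp v - 1 - v) * G‖ + ‖v * (G - g₀)‖ + ‖(v - b * s ^ 3 / e) * g₀‖ +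
        ‖G - g₀ - g₁ * s‖ := norm_add₄_le
    _ ≤ M ^ 2 * (1 + r) ^ 2 * (M * (1 + r + r ^ 2)) * (s ^ 6 / e ^ 2) * Real.exp d +
        M ^ 2 * (1 + r) ^ 2 * (s ^ 4 / e) * Real.exp d + M ^ 2 * (s ^ 4 / e) * Real.exp d +
        M * s ^ 2 * Real.exp d := by
      have k2 := le_mul_of_one_le_right (mul_nonneg hp2 q4) hE
      have k3 := le_mul_of_one_le_right (mul_nonneg (sq_nonneg M) q4) hE
      have k4 := le_mul_of_one_le_right (mul_nonneg hM q2) hE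
      linarith
    _ = (M ^ 2 * (1 + r) ^ 2 * (M * (1 + r + r ^ 2)) * (s ^ 6 / e ^ 2) +
        M ^ 2 * (1 + r) ^ 2 * (s ^ 4 / e) + M ^ 2 * (s ^ 4 / e) + M * s ^ 2) * Real.exp d := by
      ring
    _ ≤ _ := by
      gcongr
      generalize M ^ 2 * (1 + r) ^ 2 * (M * (1 + r + r ^ 2)) = A at *
      generalize M ^ 2 * (1 + r) ^ 2 = B at *
      have : 0 ≤ M ^ 2 := by positivity
      generalize M ^ 2 = D at *
      nlinarith [mul_nonneg hp1 q2, mul_nonneg hp1 q4, mul_nonneg hp2 q2, mul_nonneg hp2 q6,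
        mul_nonneg this q2, mul_nonneg this q6, mul_nonneg hM q4, mul_nonneg hM q6]

/-- Outside the window |s| ≥ r, so missing powers of s can be bought with powers of 1/r. The
Gaussian terms subtracted there thus obey the same weight as the error inside the window. -/
theorem tail_coeff_le {M r ε s : ℝ} (hM : 0 ≤ M) (hr : 0 < r) (hε : 0 < ε) (hs' : r ≤ |s|) :
    M + M * |s| + M ^ 2 * |s| ^ 3 / ε ≤
      (M / r ^ 2 + M / r + M ^ 2 / r) * (s ^ 2 + s ^ 4 / ε + s ^ 6 / ε ^ 2) := by
  have hsq : |s| ^ 2 = s ^ 2 := sq_abs s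
  have hs4 : |s| ^ 4 = s ^ 4 := by rw [show (4 : ℕ) = 2 * 2 from rfl, pow_mul, pow_mul, hsq]
  have j1 : M ≤ M / r ^ 2 * s ^ 2 := by
    rw [← hsq, div_mul_eq_mul_div, le_div_iff₀ (by positivity)]
    gcongr
  have j2 : M * |s| ≤ M / r * s ^ 2 := by
    rw [← hsq, div_mul_eq_mul_div, le_div_iff₀ (by positivity), sq, ← mul_assoc]
    gcongr
  have j3 : M ^ 2 * |s| ^ 3 / ε ≤ M ^ 2 / r * (s ^ 4 / ε) := by
    rw [← hs4, div_mul_div_comm, div_le_div_iff₀ (by positivity) (by positivity)]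
    have : r * |s| ^ 3 ≤ |s| ^ 4 := by rw [pow_succ _ 3, mul_comm]; gcongr
    calc M ^ 2 * |s| ^ 3 * (r * ε) = M ^ 2 * (r * |s| ^ 3) * ε := by ring
      _ ≤ M ^ 2 * |s| ^ 4 * ε := by gcongr
  have q2 : 0 ≤ s ^ 2 := by positivity
  have q4 : 0 ≤ s ^ 4 / ε := by positivity
  have q6 : 0 ≤ s ^ 6 / ε ^ 2 := by positivity
  have p1 : 0 ≤ M / r ^ 2 := by positivity
  have p2 : 0 ≤ M / r := by positivity
  have p3 : 0 ≤ M ^ 2 / r := by positivity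
  generalize M / r ^ 2 = A at *
  generalize M / r = B at *
  generalize M ^ 2 / r = D at *
  nlinarith [mul_nonneg p1 q4, mul_nonneg p1 q6, mul_nonneg p2 q4, mul_nonneg p2 q6,
    mul_nonneg p3 q2, mul_nonneg p3 q6]

/-- Laplace's method with a remainder of relative order `ε`, uniformly in the data. -/
theorem exists_laplace_bound {a₀ M r : ℝ} (ha₀ : 0 < a₀) (hM : 0 ≤ M) (hr : 0 < r)
    (hsmall : M * r + M * r ^ 2 ≤ a₀ / 4) :
    ∃ C : ℝ, ∀ a : ℝ, a₀ ≤ a → ∀ (b g₀ g₁ : ℂ) (q G : ℝ → ℂ), ‖b‖ ≤ M → ‖g₀‖ ≤ M → ‖g₁‖ ≤ M →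
      ContinuousOn q (Icc (-r) r) → ContinuousOn G (Icc (-r) r) →
      (∀ s : ℝ, |s| ≤ r → ‖q s + a / 2 * s ^ 2 - b * s ^ 3‖ ≤ M * s ^ 4) →
      (∀ s : ℝ, |s| ≤ r → ‖G s - g₀ - g₁ * s‖ ≤ M * s ^ 2) →
      ∀ ε : ℝ, 0 < ε →
        ‖(∫ s in (-r)..r, exp (q s / ε) * G s) - g₀ * (√(2 * Real.pi * ε / a) : ℝ)‖ ≤
          C * (ε * √ε) := by
  set C₁ := M ^ 2 * (1 + r) ^ 2 * (M * (1 + r + r ^ 2)) + M ^ 2 * (1 + r) ^ 2 + M ^ 2 + M with hC₁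
  set C₂ := M / r ^ 2 + M / r + M ^ 2 / r with hC₂
  set K := (a₀ / 8)⁻¹ + 2 * (a₀ / 8)⁻¹ ^ 2 + 6 * (a₀ / 8)⁻¹ ^ 3 with hK
  have hC₁0 : 0 ≤ C₁ := by positivity
  have hC₂0 : 0 ≤ C₂ := by positivity
  have hK0 : 0 ≤ K := by positivity
  clear_value C₁ C₂ K
  refine ⟨(C₁ + C₂) * K * √(8 * Real.pi / a₀), ?_⟩
  intro a ha b g₀ g₁ q G hb hg₀ hg₁ hq hG hqe hGe ε hε
  have ha' : 0 < a := ha₀.trans_le ha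
  -- F₁ is the integrand cut off to the window, F₂ its Gaussian leading term, and F₃ the odd
  -- correction of relative order √ε.
  let F₁ : ℝ → ℂ := indicator (Ioc (-r) r) fun s => exp (q s / ε) * G s
  let F₂ : ℝ → ℂ := fun s => g₀ * (Real.exp (-(a / (2 * ε)) * s ^ 2) : ℝ)
  let F₃ : ℝ → ℂ := fun s => (g₁ * s + g₀ * b * s ^ 3 / ε) * (Real.exp (-(a / (2 * ε)) * s ^ 2) : ℝ)
  have hF₁ : Integrable F₁ := by
    have : ContinuousOn (fun s => exp (q s / ε) * G s) (Icc (-r) r) := by fun_prop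
    exact (this.integrableOn_Icc.mono_set Ioc_subset_Icc_self).integrable_indicator
      measurableSet_Ioc
  have hF₂ : Integrable F₂ :=
    ((integrable_exp_neg_mul_sq (b := a / (2 * ε)) (by positivity)).ofReal).const_mul g₀
  -- Half of the decay a₀/4 pays for the polynomial weight, with a gain of ε. The other half remains
  -- as an integrable Gaussian.
  have hpoly : ∀ s : ℝ, (s ^ 2 + s ^ 4 / ε + s ^ 6 / ε ^ 2) * Real.exp (-(a₀ / 4 * (s ^ 2 / ε))) ≤
      K * ε * Real.exp (-(a₀ / (8 * ε)) * s ^ 2) := by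
    intro s
    have h := poly_mul_exp_neg_le (a := a₀ / 8) (y := s ^ 2 / ε) (by positivity) (by positivity)
    rw [← hK] at h
    have e1 : Real.exp (-(a₀ / 4 * (s ^ 2 / ε))) =
        Real.exp (-(a₀ / 8 * (s ^ 2 / ε))) * Real.exp (-(a₀ / (8 * ε)) * s ^ 2) := by
      rw [← Real.exp_add]; congr 1; field_simp; ring
    have e2 : s ^ 2 + s ^ 4 / ε + s ^ 6 / ε ^ 2 =
        ε * (s ^ 2 / ε + (s ^ 2 / ε) ^ 2 + (s ^ 2 / ε) ^ 3) := by
      field_simp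
    rw [e1, e2, ← mul_assoc]
    refine mul_le_mul_of_nonneg_right ?_ (Real.exp_pos _).le
    rw [mul_assoc, mul_comm K]
    exact mul_le_mul_of_nonneg_left h hε.le
  have hpt : ∀ s, ‖F₁ s - F₂ s - F₃ s‖ ≤
      (C₁ + C₂) * (K * ε * Real.exp (-(a₀ / (8 * ε)) * s ^ 2)) := by
    intro s
    refine le_trans ?_ (mul_le_mul_of_nonneg_left (hpoly s) (by positivity))
    have hexp : Real.exp (-(a / (2 * ε)) * s ^ 2) ≤ Real.exp (-(a₀ / 2 * (s ^ 2 / ε))) := by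
      apply Real.exp_le_exp.mpr
      have : a₀ / 2 * (s ^ 2 / ε) ≤ a / 2 * (s ^ 2 / ε) := by gcongr
      calc -(a / (2 * ε)) * s ^ 2 = -(a / 2 * (s ^ 2 / ε)) := by ring
        _ ≤ _ := by linarith
    have hq0 : 0 ≤ s ^ 2 + s ^ 4 / ε + s ^ 6 / ε ^ 2 := by positivity
    by_cases hs : s ∈ Ioc (-r) r
    · have hs' : |s| ≤ r := abs_le.mpr ⟨hs.1.le, hs.2⟩
      set v : ℂ := (q s + a / 2 * s ^ 2) / ε with hv
      have hsplit : exp (q s / ε) = exp v * (Real.exp (-(a / (2 * ε)) * s ^ 2) : ℝ) := by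
        rw [ofReal_exp, ← Complex.exp_add, hv]
        congr 1
        push_cast
        field_simp
        ring
      have h1 : ‖v - b * s ^ 3 / ε‖ ≤ M * s ^ 4 / ε := by
        rw [hv, ← sub_div, norm_div, Complex.norm_real, Real.norm_eq_abs, abs_of_pos hε]
        exact div_le_div_of_nonneg_right (hqe s hs') hε.le
      -- `hsmall` lets the cubic and quartic terms consume at most half of the quadratic decay a₀/2.
      have h2 : ‖v‖ ≤ a₀ / 4 * (s ^ 2 / ε) := by
        have k1 : ‖v‖ ≤ ‖v - b * s ^ 3 / ε‖ + ‖b * s ^ 3 / ε‖ := norm_le_norm_sub_add _ _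
        have k2 : ‖b * (s : ℂ) ^ 3 / ε‖ ≤ M * |s| ^ 3 / ε := by
          simp only [norm_div, norm_mul, norm_pow, Complex.norm_real, Real.norm_eq_abs,
            abs_of_pos hε]
          gcongr
        have k3 : M * s ^ 4 + M * |s| ^ 3 ≤ a₀ / 4 * s ^ 2 := by
          have j1 : s ^ 4 ≤ r ^ 2 * s ^ 2 := by
            have : s ^ 2 ≤ r ^ 2 := sq_le_sq' (by linarith [hs.1]) hs.2
            nlinarith [sq_nonneg s]
          have j2 : |s| ^ 3 ≤ r * s ^ 2 := by
            rw [← sq_abs s, pow_succ, mul_comm]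
            gcongr
          nlinarith [sq_nonneg s]
        calc ‖v‖ ≤ (M * s ^ 4 + M * |s| ^ 3) / ε := by rw [add_div]; linarith
          _ ≤ (a₀ / 4 * s ^ 2) / ε := by gcongr
          _ = _ := by ring
      have h3 := norm_exp_mul_sub_expansion_le hM hr.le hε hs' hb hg₀ hg₁ h1 (hGe s hs') h2
      rw [← hC₁] at h3
      have e1 : F₁ s - F₂ s - F₃ s = (exp v * G s - g₀ - (g₁ * s + g₀ * b * s ^ 3 / ε)) *
          (Real.exp (-(a / (2 * ε)) * s ^ 2) : ℝ) := by
        simp only [F₁, F₂, F₃, indicator_of_mem hs, hsplit]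
        ring
      rw [e1, norm_mul, Complex.norm_real, Real.norm_eq_abs, abs_of_pos (Real.exp_pos _)]
      have e2 : Real.exp (-(a₀ / 4 * (s ^ 2 / ε))) =
          Real.exp (a₀ / 4 * (s ^ 2 / ε)) * Real.exp (-(a₀ / 2 * (s ^ 2 / ε))) := by
        rw [← Real.exp_add]; congr 1; ring
      calc _ ≤ C₁ * (s ^ 2 + s ^ 4 / ε + s ^ 6 / ε ^ 2) * Real.exp (a₀ / 4 * (s ^ 2 / ε)) *
            Real.exp (-(a₀ / 2 * (s ^ 2 / ε))) := by gcongr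
        _ = C₁ * ((s ^ 2 + s ^ 4 / ε + s ^ 6 / ε ^ 2) * Real.exp (-(a₀ / 4 * (s ^ 2 / ε)))) := by
          rw [e2]; ring
        _ ≤ _ := by gcongr; linarith
    · have hs' : r ≤ |s| := by
        by_contra hlt
        push Not at hlt
        exact hs ⟨(abs_lt.mp hlt).1, (abs_lt.mp hlt).2.le⟩
      have e1 : F₁ s - F₂ s - F₃ s = -(g₀ + g₁ * s + g₀ * b * s ^ 3 / ε) *
          (Real.exp (-(a / (2 * ε)) * s ^ 2) : ℝ) := by
        simp only [F₁, F₂, F₃, indicator_of_notMem hs]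
        ring
      have hexp2 : Real.exp (-(a / (2 * ε)) * s ^ 2) ≤ Real.exp (-(a₀ / 4 * (s ^ 2 / ε))) := by
        refine hexp.trans (Real.exp_le_exp.mpr ?_)
        have : 0 ≤ a₀ / 4 * (s ^ 2 / ε) := by positivity
        linarith
      have k1 : ‖g₀ + g₁ * s + g₀ * b * s ^ 3 / ε‖ ≤ M + M * |s| + M ^ 2 * |s| ^ 3 / ε := by
        refine norm_add₃_le.trans ?_
        simp only [norm_div, norm_mul, norm_pow, Complex.norm_real, Real.norm_eq_abs,
            abs_of_pos hε]
        rw [sq M]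
        gcongr
      have k2 := tail_coeff_le hM hr hε hs'
      rw [← hC₂] at k2
      rw [e1, norm_mul, norm_neg, Complex.norm_real, Real.norm_eq_abs, abs_of_pos (Real.exp_pos _)]
      calc _ ≤ (C₂ * (s ^ 2 + s ^ 4 / ε + s ^ 6 / ε ^ 2)) *
            Real.exp (-(a₀ / 4 * (s ^ 2 / ε))) := by gcongr; exact k1.trans k2
        _ = C₂ * ((s ^ 2 + s ^ 4 / ε + s ^ 6 / ε ^ 2) *
            Real.exp (-(a₀ / 4 * (s ^ 2 / ε)))) := by ring
        _ ≤ _ := by gcongr; linarith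
  have hF₃c : Continuous F₃ := by fun_prop
  have hbd : Integrable fun s : ℝ => (C₁ + C₂) * (K * ε * Real.exp (-(a₀ / (8 * ε)) * s ^ 2)) :=
    ((integrable_exp_neg_mul_sq (b := a₀ / (8 * ε)) (by positivity)).const_mul _).const_mul _
  have hD : Integrable fun s => F₁ s - F₂ s - F₃ s :=
    hbd.mono' ((hF₁.sub hF₂).aestronglyMeasurable.sub hF₃c.aestronglyMeasurable)
      (Eventually.of_forall hpt)
  -- No separate moment integrals are needed: F₃ is a combination of F₁, F₂ and the dominated
  -- difference.
  have hF₃ : Integrable F₃ := by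
    have := (hF₁.sub hF₂).sub hD
    refine this.congr (Eventually.of_forall fun s => ?_)
    simp
  have i₁ : ∫ s in (-r)..r, exp (q s / ε) * G s = ∫ s, F₁ s := by
    rw [intervalIntegral.integral_of_le (by linarith), integral_indicator measurableSet_Ioc]
  have i₂ : ∫ s, F₂ s = g₀ * (√(2 * Real.pi * ε / a) : ℝ) := by
    simp only [F₂]
    rw [integral_const_mul, integral_complex_ofReal, integral_gaussian,
      show Real.pi / (a / (2 * ε)) = 2 * Real.pi * ε / a by field_simp]
  -- Oddness of F₃ is what makes the relative error O(ε) and not O(√ε).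
  have i₃ : ∫ s, F₃ s = 0 := by
    have h := integral_neg_eq_self F₃ volume
    have h2 : (fun s => F₃ (-s)) = fun s => -F₃ s := by
      funext s
      simp only [F₃]
      push_cast
      ring_nf
    rw [h2, integral_neg] at h
    linear_combination (-1 / 2 : ℂ) * h
  rw [i₁, ← i₂]
  have : (∫ s, F₁ s) - ∫ s, F₂ s = ∫ s, (F₁ s - F₂ s - F₃ s) := by
    have e := integral_sub (hF₁.sub hF₂) hF₃
    simp only [Pi.sub_apply] at e
    rw [e, i₃, sub_zero, integral_sub hF₁ hF₂]
  rw [this]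
  refine (norm_integral_le_of_norm_le hbd (Eventually.of_forall hpt)).trans (le_of_eq ?_)
  rw [integral_const_mul, integral_const_mul, integral_gaussian]
  have : Real.pi / (a₀ / (8 * ε)) = 8 * Real.pi / a₀ * ε := by field_simp
  rw [this, Real.sqrt_mul (by positivity)]
  ring

/-! ### Holomorphic Taylor bounds and the contribution of one saddle -/

/-- A bounded holomorphic function divided by the distance to the centre, with a uniform bound. -/
theorem exists_slope_of_bounded {f : ℂ → ℂ} {c : ℂ} {R M : ℝ} (hR : 0 < R)
    (hf : DifferentiableOn ℂ f (Metric.ball c R)) (hM : ∀ z ∈ Metric.ball c R, ‖f z‖ ≤ M) :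
    ∃ g : ℂ → ℂ, DifferentiableOn ℂ g (Metric.ball c R) ∧
      (∀ z ∈ Metric.ball c R, ‖g z‖ ≤ (2 * M + 1) / R) ∧ g c = deriv f c ∧
      ∀ z, f z = f c + (z - c) * g z := by
  have hc : c ∈ Metric.ball c R := Metric.mem_ball_self hR
  refine ⟨dslope f c, (differentiableOn_dslope (Metric.ball_mem_nhds c hR)).mpr hf, ?_,
    dslope_same f c, fun z => ?_⟩
  · intro z hz
    -- This is the Schwarz lemma for f - f c, which is at most 2M in modulus. The extra 1 is slack.
    refine norm_dslope_le_div_of_mapsTo_ball hf (fun w hw => ?_) hz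
    rw [Metric.mem_closedBall, dist_eq_norm]
    linarith [norm_sub_le (f w) (f c), hM w hw, hM c hc]
  · have := sub_smul_dslope f c z
    rw [smul_eq_mul] at this
    rw [this]; ring

/-- Fourth-order Taylor estimate of a primitive at a critical point, uniform in the data. -/
theorem exists_taylor_bound {ρ M : ℝ} (hρ : 0 < ρ) (hM : 0 ≤ M) :
    ∃ M₃ : ℝ, 0 ≤ M₃ ∧ ∀ (x : ℂ) (k φ : ℂ → ℂ), DifferentiableOn ℂ k (Metric.ball x ρ) →
      (∀ z ∈ Metric.ball x ρ, ‖k z‖ ≤ M) → k x = 0 →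
      (∀ z ∈ Metric.ball x ρ, HasDerivAt φ (k z) z) →
      ∃ β : ℂ, ‖β‖ ≤ M₃ ∧ ∀ z ∈ Metric.ball x ρ,
        ‖φ z - φ x - deriv k x / 2 * (z - x) ^ 2 - β * (z - x) ^ 3‖ ≤ M₃ * ‖z - x‖ ^ 4 := by
  -- Three divided differences at the same centre, with no loss of radius, give k(z) = k'(x)(z - x)
  -- + g₂(x)(z - x)² + g₃(z)(z - x)³ with |g₃| ≤ M₃. Integration then gives the cubic coefficient
  -- g₂(x)/3.
  set M₁ := (2 * M + 1) / ρ with hM₁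
  set M₂ := (2 * M₁ + 1) / ρ with hM₂
  set M₃ := (2 * M₂ + 1) / ρ with hM₃
  have h₁ : 0 ≤ M₁ := by positivity
  have h₂ : 0 ≤ M₂ := by positivity
  have h₃ : 0 ≤ M₃ := by positivity
  refine ⟨M₂ + M₃, by positivity, fun x k φ hk hkM hkx hφ => ?_⟩
  obtain ⟨g₁, d₁, b₁, v₁, e₁⟩ := exists_slope_of_bounded hρ hk hkM
  obtain ⟨g₂, d₂, b₂, -, e₂⟩ := exists_slope_of_bounded hρ d₁ b₁
  obtain ⟨g₃, d₃, b₃, -, e₃⟩ := exists_slope_of_bounded hρ d₂ b₂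
  have hx : x ∈ Metric.ball x ρ := Metric.mem_ball_self hρ
  refine ⟨g₂ x / 3, ?_, ?_⟩
  · rw [norm_div]
    have : ‖(3 : ℂ)‖ = 3 := by norm_num
    rw [this]
    have := b₂ x hx
    have := norm_nonneg (g₂ x)
    linarith
  intro z hz
  -- The derivative of E is exactly (w - x)³ g₃(w), so the mean value inequality on the disc of
  -- radius |z - x| yields fourth order.
  let E : ℂ → ℂ := fun w => φ w - φ x - deriv k x / 2 * (w - x) ^ 2 - g₂ x / 3 * (w - x) ^ 3
  have hz' : ‖z - x‖ < ρ := by simpa [dist_eq_norm] using hz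
  have hE : ∀ w ∈ Metric.closedBall x ‖z - x‖,
      HasDerivWithinAt E ((w - x) ^ 3 * g₃ w) (Metric.closedBall x ‖z - x‖) w := by
    intro w hw
    have hw' : w ∈ Metric.ball x ρ := Metric.closedBall_subset_ball hz' hw
    have hd := (((hφ w hw').sub_const (φ x)).sub
      ((((hasDerivAt_id w).sub_const x).pow 2).const_mul (deriv k x / 2))).sub
      ((((hasDerivAt_id w).sub_const x).pow 3).const_mul (g₂ x / 3))
    refine (hd.congr_deriv ?_).hasDerivWithinAt
    have := e₁ w
    rw [hkx, e₂ w, e₃ w, v₁] at this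
    rw [this]
    simp
    ring
  have hb : ∀ w ∈ Metric.closedBall x ‖z - x‖, ‖(w - x) ^ 3 * g₃ w‖ ≤ ‖z - x‖ ^ 3 * M₃ := by
    intro w hw
    have hw' : w ∈ Metric.ball x ρ := Metric.closedBall_subset_ball hz' hw
    rw [norm_mul, norm_pow]
    have : ‖w - x‖ ≤ ‖z - x‖ := by simpa [dist_eq_norm] using hw
    have := b₃ w hw'
    gcongr
  have h := (convex_closedBall x ‖z - x‖).norm_image_sub_le_of_norm_hasDerivWithin_le hE hb
    (Metric.mem_closedBall_self (norm_nonneg _)) (show z ∈ Metric.closedBall x ‖z - x‖ by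
      simp [dist_eq_norm])
  have hEx : E x = 0 := by simp [E]
  rw [hEx, sub_zero] at h
  calc _ ≤ ‖z - x‖ ^ 3 * M₃ * ‖z - x‖ := h
    _ = M₃ * ‖z - x‖ ^ 4 := by ring
    _ ≤ _ := by gcongr; linarith

/-- From e^t ≥ t²/2 and ε² ≤ ε^{3/2}. It puts exponentially small contributions into the format of
the Laplace remainder. -/
theorem exp_neg_div_le {c ε : ℝ} (hc : 0 < c) (hε : 0 < ε) (hε1 : ε ≤ 1) :
    Real.exp (-c / ε) ≤ 2 / c ^ 2 * (ε * √ε) := by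
  have h := Real.pow_div_factorial_le_exp (c / ε) (by positivity) 2
  have hsq : ε ≤ √ε := Real.le_sqrt_of_sq_le (by nlinarith)
  rw [neg_div, Real.exp_neg]
  calc (Real.exp (c / ε))⁻¹ ≤ ((c / ε) ^ 2 / (2 : ℕ).factorial)⁻¹ := by gcongr
    _ = 2 / c ^ 2 * (ε * ε) := by
      norm_num [Nat.factorial]
      field_simp
    _ ≤ _ := by gcongr

/-- Near the ends of a straight path of steepest descent the level is well below that of the
saddle. -/
theorem re_le_of_near_steep {M₃ M' Mv a₀ a δ σ : ℝ} {x z v κ β φz φx : ℂ} (hδ : 0 < δ)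
    (hMv : 0 < Mv) (ha₀ : 0 < a₀) (ha : a₀ ≤ a) (hM₃ : 0 ≤ M₃) (t1 : M₃ * Mv ^ 3 ≤ M')
    (t2 : M₃ * Mv ^ 4 ≤ M') (hδa : M' * δ + M' * δ ^ 2 ≤ a₀ / 32) (hvM : ‖v‖ ≤ Mv)
    (hv : -I * κ * v ^ 2 = -a) (hβ : ‖β‖ ≤ M₃) (hσ : |σ| = 1)
    (hz : ‖z - (x + σ * δ * v)‖ ≤ δ * ‖v‖ / 4) (hzx : ‖z - x‖ ≤ 5 / 4 * (δ * ‖v‖))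
    (hTz : ‖φz - φx - κ / 2 * (z - x) ^ 2 - β * (z - x) ^ 3‖ ≤ M₃ * ‖z - x‖ ^ 4) :
    (-I * (φz - φx)).re ≤ -(a₀ / 8 * δ ^ 2) := by
  have ha' : 0 < a := ha₀.trans_le ha
  have hδv : δ * ‖v‖ ≤ δ * Mv := by gcongr
  have hσ2 : (σ : ℂ) ^ 2 = 1 := by
    rw [← ofReal_pow, ← sq_abs, hσ]; simp
  have hv0 : v ≠ 0 := by
    rintro rfl
    have : (a : ℂ) = 0 := by simpa using hv.symm
    exact ha'.ne' (by exact_mod_cast this)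
  -- In this relative coordinate Re (1 + η)² ≥ (3/4)² - (1/4)² = 1/2, so at least half of the
  -- quadratic drop survives.
  obtain ⟨η, hη⟩ : ∃ η : ℂ, z - x = σ * δ * v * (1 + η) ∧ ‖η‖ ≤ 1 / 4 := by
    have hσ0 : (σ : ℂ) ≠ 0 := by
      intro h; rw [h] at hσ2; norm_num at hσ2
    have hδ0 : (δ : ℂ) ≠ 0 := by exact_mod_cast hδ.ne'
    refine ⟨(z - (x + σ * δ * v)) / (σ * δ * v), by field_simp; ring, ?_⟩
    rw [norm_div]
    have h2 : ‖(σ : ℂ) * δ * v‖ = δ * ‖v‖ := by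
      simp [hσ, abs_of_pos hδ]
    rw [h2, div_le_iff₀ (by positivity)]
    linarith
  have hre : 1 / 2 ≤ ((1 + η) ^ 2).re := by
    have h1 := abs_le.mp ((Complex.abs_re_le_norm η).trans hη.2)
    have h2 := abs_le.mp ((Complex.abs_im_le_norm η).trans hη.2)
    simp only [sq, mul_re, add_re, one_re, add_im, one_im, zero_add]
    nlinarith
  set E := φz - φx - κ / 2 * (z - x) ^ 2 - β * (z - x) ^ 3 with hE
  have e1 : -I * (φz - φx) = ((-(a / 2 * δ ^ 2) : ℝ) : ℂ) * (1 + η) ^ 2 +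
      -I * (β * (z - x) ^ 3 + E) := by
    have : (a : ℂ) = I * κ * v ^ 2 := by linear_combination hv
    have h3 : (z - x) ^ 2 = δ ^ 2 * v ^ 2 * (1 + η) ^ 2 := by
      rw [hη.1]; linear_combination (δ ^ 2 * v ^ 2 * (1 + η) ^ 2 : ℂ) * hσ2
    push_cast
    rw [hE, this]
    linear_combination (I * κ / 2 : ℂ) * h3 * (-1)
  rw [e1, add_re, re_ofReal_mul]
  have h2 : (-I * (β * (z - x) ^ 3 + E)).re ≤ M₃ * ‖z - x‖ ^ 3 + M₃ * ‖z - x‖ ^ 4 := by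
    refine (Complex.re_le_norm _).trans ?_
    rw [norm_mul, norm_neg, norm_I, one_mul]
    refine (norm_add_le _ _).trans (add_le_add ?_ hTz)
    rw [norm_mul, norm_pow]
    gcongr
  have hzx' : ‖z - x‖ ≤ 5 / 4 * (δ * Mv) := by linarith
  have h3 : M₃ * ‖z - x‖ ^ 3 + M₃ * ‖z - x‖ ^ 4 ≤
      M₃ * (5 / 4 * (δ * Mv)) ^ 3 + M₃ * (5 / 4 * (δ * Mv)) ^ 4 := by gcongr
  -- Both (5/4)³ and (5/4)⁴ are below 4. With `hδa` the higher terms then use at most a₀δ²/8 of the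
  -- quadratic drop a₀δ²/4.
  have h4 : M₃ * (5 / 4 * (δ * Mv)) ^ 3 + M₃ * (5 / 4 * (δ * Mv)) ^ 4 ≤
      4 * (M' * δ + M' * δ ^ 2) * δ ^ 2 := by
    have u1 : M₃ * Mv ^ 3 * δ ^ 3 ≤ M' * δ ^ 3 := by gcongr
    have u2 : M₃ * Mv ^ 4 * δ ^ 4 ≤ M' * δ ^ 4 := by gcongr
    have u3 : 0 ≤ M₃ * Mv ^ 3 * δ ^ 3 := by positivity
    have u4 : 0 ≤ M₃ * Mv ^ 4 * δ ^ 4 := by positivity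
    nlinarith
  have h5 : 4 * (M' * δ + M' * δ ^ 2) * δ ^ 2 ≤ a₀ / 8 * δ ^ 2 := by
    gcongr; linarith
  have h6 : a₀ / 2 * δ ^ 2 * (1 / 2) ≤ a / 2 * δ ^ 2 * ((1 + η) ^ 2).re := by gcongr
  linarith

/-- Contribution of a saddle point to an integral between endpoints `y₋`, `y₊` of a steep path,
expressed through a primitive of the integrand; uniform in the data. -/
theorem exists_saddle_bound {ρ M Mv a₀ : ℝ} (hρ : 0 < ρ) (hM : 0 ≤ M) (hMv : 0 < Mv)
    (ha₀ : 0 < a₀) :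
    ∃ δ₀ > 0, ∀ δ : ℝ, 0 < δ → δ ≤ δ₀ → ∃ C : ℝ, ∀ (x v zp yP yM : ℂ) (k φ Φ : ℂ → ℂ) (a ε : ℝ),
      DifferentiableOn ℂ k (Metric.ball x ρ) → (∀ z ∈ Metric.ball x ρ, ‖k z‖ ≤ M) → k x = 0 →
      (∀ z ∈ Metric.ball x ρ, HasDerivAt φ (k z) z) →
      -I * deriv k x * v ^ 2 = -a → a₀ ≤ a → ‖v‖ ≤ Mv → 2 * ρ ≤ ‖x - zp‖ →
      ‖yP - (x + δ * v)‖ ≤ δ * ‖v‖ / 4 → ‖yM - (x - δ * v)‖ ≤ δ * ‖v‖ / 4 →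
      0 < ε → ε ≤ 1 →
      (∀ z ∈ Metric.ball x ρ, HasDerivAt Φ (exp (-I * φ z / ε) / (z - zp)) z) →
      ‖Φ yP - Φ yM - exp (-I * φ x / ε) * (v / (x - zp) * (√(2 * Real.pi * ε / a) : ℝ))‖ ≤
        C * (ε * √ε) * Real.exp ((-I * φ x).re / ε) := by
  obtain ⟨M₃, hM₃, taylor⟩ := exists_taylor_bound hρ hM
  -- One constant for all the data of the Laplace bound, in this order: cubic coefficient and
  -- quartic remainder of the phase, then value, slope and quadratic remainder of v/(x + sv - z_p).
  set M' := M₃ * Mv ^ 3 + M₃ * Mv ^ 4 + Mv / (2 * ρ) + Mv ^ 2 / (4 * ρ ^ 2) + Mv ^ 3 / (4 * ρ ^ 3)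
    with hM'
  have t1 : 0 ≤ M₃ * Mv ^ 3 := by positivity
  have t2 : 0 ≤ M₃ * Mv ^ 4 := by positivity
  have t3 : 0 ≤ Mv / (2 * ρ) := by positivity
  have t4 : 0 ≤ Mv ^ 2 / (4 * ρ ^ 2) := by positivity
  have t5 : 0 ≤ Mv ^ 3 / (4 * ρ ^ 3) := by positivity
  have hM'0 : 0 ≤ M' := by positivity
  -- The first bound gives δ² ≤ δ, the second keeps all points within 5/4 · δ Mv of x inside the
  -- disc, and the third makes M'δ + M'δ² ≤ a₀/32.
  refine ⟨min 1 (min (ρ / (2 * Mv)) (a₀ / (64 * (M' + 1)))), by positivity, fun δ hδ hδ₀ => ?_⟩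
  have hδ1 : δ ≤ 1 := hδ₀.trans (min_le_left _ _)
  have hδρ : 2 * (δ * Mv) ≤ ρ := by
    have := hδ₀.trans ((min_le_right _ _).trans (min_le_left _ _))
    rw [le_div_iff₀ (by positivity)] at this
    linarith
  have hδa : M' * δ + M' * δ ^ 2 ≤ a₀ / 32 := by
    have := hδ₀.trans ((min_le_right _ _).trans (min_le_right _ _))
    rw [le_div_iff₀ (by positivity)] at this
    nlinarith
  have t1' : M₃ * Mv ^ 3 ≤ M' := by linarith
  have t2' : M₃ * Mv ^ 4 ≤ M' := by linarith
  obtain ⟨C₀, hC₀⟩ := exists_laplace_bound (M := M') ha₀ hM'0 hδ (by linarith)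
  refine ⟨C₀ + 2 * (1 / ρ * (2 / (a₀ / 8 * δ ^ 2) ^ 2) * (δ * Mv / 4)), ?_⟩
  intro x v zp yP yM k φ Φ a ε hk hkM hkx hφ hv ha hvM hzp hyP hyM hε hε1 hΦ
  obtain ⟨β, hβ, hT⟩ := taylor x k φ hk hkM hkx hφ
  have ha' : 0 < a := ha₀.trans_le ha
  have hball : ∀ w : ℂ, ‖w‖ ≤ 5 / 4 * (δ * Mv) → x + w ∈ Metric.ball x ρ := by
    intro w hw
    rw [Metric.mem_ball, dist_eq_norm, add_sub_cancel_left]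
    nlinarith [mul_pos hδ hMv]
  have hne : ∀ z ∈ Metric.ball x ρ, ρ ≤ ‖z - zp‖ := by
    intro z hz
    have h1 : ‖z - x‖ < ρ := by simpa [dist_eq_norm] using hz
    have h2 := norm_sub_le_norm_sub_add_norm_sub x z zp
    rw [norm_sub_rev x z] at h2
    linarith
  -- the straight path
  have hstraight : ‖(Φ (x + δ * v) - Φ (x - δ * v)) -
      exp (-I * φ x / ε) * (v / (x - zp) * (√(2 * Real.pi * ε / a) : ℝ))‖ ≤
        C₀ * (ε * √ε) * Real.exp ((-I * φ x).re / ε) := by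
    have hsv : ∀ s : ℝ, |s| ≤ δ → x + s * v ∈ Metric.ball x ρ := by
      intro s hs
      apply hball
      rw [norm_mul, Complex.norm_real, Real.norm_eq_abs]
      have : |s| * ‖v‖ ≤ δ * Mv := by gcongr
      nlinarith [mul_pos hδ hMv]
    have hmem : ∀ s ∈ Icc (-δ) δ, |s| ≤ δ := fun s hs => abs_le.mpr hs
    let q : ℝ → ℂ := fun s => -I * (φ (x + s * v) - φ x)
    let G : ℝ → ℂ := fun s => v / (x + s * v - zp)
    have hpath : ∀ s : ℝ, HasDerivAt (fun s : ℝ => x + (s : ℂ) * v) v s := fun s => by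
      simpa using ((hasDerivAt_id s).ofReal_comp.mul_const v).const_add x
    have hqc : ContinuousOn q (Icc (-δ) δ) := by
      intro s hs
      have h1 : ContinuousAt (fun s : ℝ => φ (x + s * v)) s :=
        ContinuousAt.comp (f := fun s : ℝ => x + (s : ℂ) * v)
          (hφ _ (hsv s (hmem s hs))).continuousAt (hpath s).continuousAt
      exact ((h1.sub continuousAt_const).const_mul _).continuousWithinAt
    have hGc : ContinuousOn G (Icc (-δ) δ) := by
      refine ContinuousOn.div (by fun_prop) (by fun_prop) fun s hs => ?_
      have := hne _ (hsv s (hmem s hs))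
      exact norm_pos_iff.mp (hρ.trans_le this)
    have hD : x - zp ≠ 0 := norm_pos_iff.mp (by linarith)
    have hL := hC₀ a ha (-I * β * v ^ 3) (v / (x - zp)) (-v ^ 2 / (x - zp) ^ 2) q G
      (by
        simp only [norm_mul, norm_neg, norm_I, one_mul, norm_pow]
        calc ‖β‖ * ‖v‖ ^ 3 ≤ M₃ * Mv ^ 3 := by gcongr
          _ ≤ M' := by linarith)
      (by
        rw [norm_div]
        calc ‖v‖ / ‖x - zp‖ ≤ Mv / (2 * ρ) := by gcongr
          _ ≤ M' := by linarith)
      (by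
        rw [norm_div, norm_neg, norm_pow, norm_pow]
        calc ‖v‖ ^ 2 / ‖x - zp‖ ^ 2 ≤ Mv ^ 2 / (2 * ρ) ^ 2 := by gcongr
          _ = Mv ^ 2 / (4 * ρ ^ 2) := by ring
          _ ≤ M' := by linarith)
      hqc hGc
      (by
        intro s hs
        have h := hT _ (hsv s hs)
        have e : q s + a / 2 * s ^ 2 - -I * β * v ^ 3 * s ^ 3 =
            -I * (φ (x + s * v) - φ x - deriv k x / 2 * (x + s * v - x) ^ 2 -
              β * (x + s * v - x) ^ 3) := by
          have : (a : ℂ) = I * deriv k x * v ^ 2 := by linear_combination hv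
          simp only [q, this]
          ring
        rw [e, norm_mul, norm_neg, norm_I, one_mul]
        refine h.trans ?_
        rw [add_sub_cancel_left, norm_mul, Complex.norm_real, Real.norm_eq_abs, mul_pow,
          show |s| ^ 4 = s ^ 4 by rw [show (4 : ℕ) = 2 * 2 from rfl, pow_mul, pow_mul, sq_abs]]
        calc M₃ * (s ^ 4 * ‖v‖ ^ 4) ≤ M₃ * (s ^ 4 * Mv ^ 4) := by gcongr
          _ = M₃ * Mv ^ 4 * s ^ 4 := by ring
          _ ≤ M' * s ^ 4 := by gcongr)
      (by
        intro s hs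
        have h1 := hne _ (hsv s hs)
        have hD1 : x + s * v - zp ≠ 0 := norm_pos_iff.mp (hρ.trans_le h1)
        have e : G s - v / (x - zp) - -v ^ 2 / (x - zp) ^ 2 * s =
            v ^ 3 * s ^ 2 / ((x - zp) ^ 2 * (x + s * v - zp)) := by
          have hsplit : x + s * v - zp = x - zp + s * v := by ring
          simp only [G]
          rw [hsplit] at hD1 ⊢
          generalize x - zp = D at hD hD1
          obtain ⟨B, hB⟩ : ∃ B, B = D + s * v := ⟨_, rfl⟩
          rw [← hB] at hD1 ⊢
          field_simp
          rw [hB]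
          ring
        rw [e, norm_div, norm_mul, norm_mul, norm_pow, norm_pow, norm_pow, Complex.norm_real,
          Real.norm_eq_abs, sq_abs]
        calc ‖v‖ ^ 3 * s ^ 2 / (‖x - zp‖ ^ 2 * ‖x + s * v - zp‖)
            ≤ Mv ^ 3 * s ^ 2 / ((2 * ρ) ^ 2 * ρ) := by gcongr
          _ = Mv ^ 3 / (4 * ρ ^ 3) * s ^ 2 := by field_simp; norm_num
          _ ≤ M' * s ^ 2 := by gcongr; linarith)
      ε hε
    have hderiv : ∀ s ∈ uIcc (-δ) δ, HasDerivAt (fun s : ℝ => Φ (x + s * v))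
        (exp (-I * φ x / ε) * (exp (q s / ε) * G s)) s := by
      intro s hs
      rw [uIcc_of_le (by linarith)] at hs
      have h1 := (hΦ _ (hsv s (hmem s hs))).comp_of_eq s (hpath s) rfl
      refine h1.congr_deriv ?_
      have : -I * φ (x + s * v) / ε = -I * φ x / ε + q s / ε := by
        simp only [q]; ring
      rw [this, Complex.exp_add]
      simp only [G]
      ring
    have hint := intervalIntegral.integral_eq_sub_of_hasDerivAt hderiv
      (ContinuousOn.intervalIntegrable (by
        rw [uIcc_of_le (by linarith)]
        fun_prop))
    rw [intervalIntegral.integral_const_mul] at hint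
    have hneg : x + ((-δ : ℝ) : ℂ) * v = x - δ * v := by push_cast; ring
    rw [hneg] at hint
    rw [← hint, ← mul_sub, norm_mul, Complex.norm_exp, mul_comm]
    have hre : (-I * φ x / ε).re = (-I * φ x).re / ε := by rw [Complex.div_ofReal_re]
    rw [hre]
    gcongr
  -- the connecting segments
  have hconn : ∀ (σ : ℝ) (y : ℂ), |σ| = 1 → ‖y - (x + σ * δ * v)‖ ≤ δ * ‖v‖ / 4 →
      ‖Φ y - Φ (x + σ * δ * v)‖ ≤ 1 / ρ * (2 / (a₀ / 8 * δ ^ 2) ^ 2) * (δ * Mv / 4) * (ε * √ε) *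
        Real.exp ((-I * φ x).re / ε) := by
    intro σ y hσ hy
    have hin : ∀ z ∈ Metric.closedBall (x + σ * δ * v) (δ * ‖v‖ / 4), z ∈ Metric.ball x ρ ∧
        ‖exp (-I * φ z / ε) / (z - zp)‖ ≤
          1 / ρ * (Real.exp (-(a₀ / 8 * δ ^ 2) / ε) * Real.exp ((-I * φ x).re / ε)) := by
      intro z hz
      rw [Metric.mem_closedBall, dist_eq_norm] at hz
      have hzx : ‖z - x‖ ≤ 5 / 4 * (δ * ‖v‖) := by
        have h1 : ‖z - x‖ ≤ ‖z - (x + σ * δ * v)‖ + ‖σ * δ * v‖ := by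
          have := norm_add_le (z - (x + σ * δ * v)) (σ * δ * v)
          rwa [show z - (x + σ * δ * v) + σ * δ * v = z - x by ring] at this
        have h2 : ‖(σ : ℂ) * δ * v‖ = δ * ‖v‖ := by
          simp [hσ, abs_of_pos hδ]
        linarith
      have hδv : δ * ‖v‖ ≤ δ * Mv := by gcongr
      have hzb : z ∈ Metric.ball x ρ := by
        have := hball (z - x) (by linarith)
        rwa [add_sub_cancel] at this
      refine ⟨hzb, ?_⟩
      have hmain := re_le_of_near_steep hδ hMv ha₀ ha hM₃ t1' t2' hδa hvM hv hβ hσ hz hzx (hT z hzb)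
      rw [norm_div, Complex.norm_exp]
      have hre2 : (-I * φ z / ε).re ≤ -(a₀ / 8 * δ ^ 2) / ε + (-I * φ x).re / ε := by
        rw [Complex.div_ofReal_re, ← add_div]
        have : (-I * φ z).re = (-I * (φ z - φ x)).re + (-I * φ x).re := by
          rw [← add_re]; congr 1; ring
        rw [this]
        gcongr
      calc _ ≤ Real.exp (-(a₀ / 8 * δ ^ 2) / ε + (-I * φ x).re / ε) / ρ := by
            have := hne z hzb
            gcongr
        _ = _ := by rw [Real.exp_add]; ring
    have hr0 : 0 ≤ δ * ‖v‖ / 4 := by positivity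
    have h :=
      (convex_closedBall (x + σ * δ * v) (δ * ‖v‖ / 4)).norm_image_sub_le_of_norm_hasDerivWithin_le
      (fun z hz => (hΦ z (hin z hz).1).hasDerivWithinAt) (fun z hz => (hin z hz).2)
      (Metric.mem_closedBall_self hr0) (show y ∈ _ by
        rw [Metric.mem_closedBall, dist_eq_norm]; exact hy)
    refine h.trans ?_
    have he := exp_neg_div_le (c := a₀ / 8 * δ ^ 2) (by positivity) hε hε1
    calc _ ≤ 1 / ρ * (2 / (a₀ / 8 * δ ^ 2) ^ 2 * (ε * √ε) * Real.exp ((-I * φ x).re / ε)) *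
          (δ * Mv / 4) := by
          refine mul_le_mul ?_ (hy.trans (by gcongr)) (norm_nonneg _) (by positivity)
          gcongr
      _ = _ := by ring
  have hP := hconn 1 yP (by simp) (by simpa using hyP)
  have hMi := hconn (-1) yM (by simp) (by simpa [← sub_eq_add_neg] using hyM)
  simp only [ofReal_one, one_mul, ofReal_neg, neg_mul, ← sub_eq_add_neg] at hP hMi
  -- Only endpoint values of the primitive enter. The curved arc may therefore be replaced by the
  -- straight steep segment and two short connections at a strictly lower level.
  have hsum : Φ yP - Φ yM - exp (-I * φ x / ε) * (v / (x - zp) * (√(2 * Real.pi * ε / a) : ℝ)) =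
      ((Φ (x + δ * v) - Φ (x - δ * v)) -
        exp (-I * φ x / ε) * (v / (x - zp) * (√(2 * Real.pi * ε / a) : ℝ))) +
      (Φ yP - Φ (x + δ * v)) - (Φ yM - Φ (x - δ * v)) := by ring
  rw [hsum]
  refine (norm_sub_le _ _).trans ((add_le_add_left (norm_add_le _ _) _).trans ?_)
  have := add_le_add (add_le_add hstraight hP) hMi
  refine this.trans (le_of_eq ?_)
  ring

/-! ### Local analysis along a contour -/

/-- A continuous logarithm of a differentiable function is differentiable. -/
theorem hasDerivAt_of_exp_eq {L g : ℝ → ℂ} {g' : ℂ} {t : ℝ} (hL : ContinuousAt L t)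
    (hexp : ∀ s, exp (L s) = g s) (hg : HasDerivAt g g' t) : HasDerivAt L (g' / g t) t := by
  have hgt : g t ≠ 0 := hexp t ▸ exp_ne_zero _
  have h1 : HasDerivAt (fun s => g s / g t) (g' / g t) t := hg.div_const _
  have h2 : HasDerivAt (fun s => L t + log (g s / g t)) (g' / g t) t := by
    have h := (h1.clog_real (by simp [div_self hgt])).const_add (L t)
    simpa [div_self hgt] using h
  refine h2.congr_of_eventuallyEq ?_
  -- As 1 < π, the difference L s - L t stays in the principal strip and the principal logarithm of
  -- g s / g t recovers it.
  have hnear : ∀ᶠ s in 𝓝 t, ‖L s - L t‖ < 1 := by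
    have : Tendsto (fun s => ‖L s - L t‖) (𝓝 t) (𝓝 0) := by
      have h : ContinuousAt (fun s => ‖L s - L t‖) t := (hL.sub continuousAt_const).norm
      simpa [ContinuousAt] using h
    exact this.eventually (gt_mem_nhds one_pos)
  filter_upwards [hnear] with s hs
  have him : |(L s - L t).im| < 1 := (abs_im_le_norm _).trans_lt hs
  have hpi := Real.pi_gt_three
  rw [← hexp s, ← hexp t, ← Complex.exp_sub, Complex.log_exp (by linarith [(abs_lt.mp him).1])
    (by linarith [(abs_lt.mp him).2])]
  ring

theorem exists_pos_forall_le_of_isCompact {X : Type*} [TopologicalSpace X] {K : Set X}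
    (hK : IsCompact K) {f : X → ℝ} (hf : ContinuousOn f K) (hpos : ∀ x ∈ K, 0 < f x) :
    ∃ m > 0, ∀ x ∈ K, m ≤ f x := by
  rcases K.eq_empty_or_nonempty with rfl | hne
  · exact ⟨1, one_pos, by simp⟩
  · obtain ⟨x, hx, hmin⟩ := hK.exists_isMinOn hne hf
    exact ⟨f x, hpos x hx, fun y hy => hmin hy⟩

theorem exists_pos_forall_norm_le_of_isCompact {X E : Type*} [TopologicalSpace X]
    [SeminormedAddCommGroup E] {K : Set X} (hK : IsCompact K) {f : X → E}
    (hf : ContinuousOn f K) : ∃ M > 0, ∀ x ∈ K, ‖f x‖ ≤ M := by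
  obtain ⟨M, hM⟩ := hK.exists_bound_of_continuousOn hf
  exact ⟨max M 1, by positivity, fun x hx => (hM x hx).trans (le_max_left _ _)⟩

namespace RationalPotential

variable {n : ℕ} (V : RationalPotential n)

/-- The set of points that are not poles of `u`. -/
def regular : Set ℂ := {x | ∀ p, x ≠ V.z p ∧ x ≠ conj (V.z p)}

theorem isOpen_regular : IsOpen V.regular := by
  have : V.regular = ⋂ p, ({V.z p}ᶜ ∩ {conj (V.z p)}ᶜ) := by
    ext x; simp [regular]
  rw [this]
  exact isOpen_iInter_of_finite fun p => isOpen_compl_singleton.inter isOpen_compl_singleton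

theorem differentiableOn_u : DifferentiableOn ℂ V.u V.regular := by
  intro x hx
  refine DifferentiableAt.differentiableWithinAt ?_
  unfold u
  refine DifferentiableAt.fun_sum fun p _ => ?_
  have h1 := sub_ne_zero.mpr (hx p).1
  have h2 := sub_ne_zero.mpr (hx p).2
  have d1 : DifferentiableAt ℂ (fun y => V.c p / (y - V.z p)) x :=
    (differentiableAt_const _).div (by fun_prop) h1
  have d2 : DifferentiableAt ℂ (fun y => conj (V.c p) / (y - conj (V.z p))) x :=
    (differentiableAt_const _).div (by fun_prop) h2
  exact d1.add d2

theorem continuousOn_deriv_u : ContinuousOn (deriv V.u) V.regular :=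
  (V.differentiableOn_u.deriv V.isOpen_regular).continuousOn

theorem norm_u_le {ρ : ℝ} {z : ℂ} (hρ : 0 < ρ)
    (hz : ∀ p, ρ ≤ ‖z - V.z p‖ ∧ ρ ≤ ‖z - conj (V.z p)‖) :
    ‖V.u z‖ ≤ ∑ p, 2 * ‖V.c p‖ / ρ := by
  refine (norm_sum_le _ _).trans (Finset.sum_le_sum fun p _ => ?_)
  refine (norm_add_le _ _).trans ?_
  rw [norm_div, norm_div, RCLike.norm_conj]
  have h1 : ‖V.c p‖ / ‖z - V.z p‖ ≤ ‖V.c p‖ / ρ := by gcongr; exact (hz p).1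
  have h2 : ‖V.c p‖ / ‖z - conj (V.z p)‖ ≤ ‖V.c p‖ / ρ := by gcongr; exact (hz p).2
  calc _ ≤ ‖V.c p‖ / ρ + ‖V.c p‖ / ρ := add_le_add h1 h2
    _ = _ := by ring

end RationalPotential

namespace Contour

variable {n : ℕ} {V : RationalPotential n} {J : Set ℝ} (W : Contour V J)

/-- An exponential never vanishes, so the existence of the logarithms already keeps the contour off
the poles. -/
theorem γ_mem_regular {l : ℝ} (hl : l ∈ J) (t : ℝ) : W.γ l t ∈ V.regular := by
  intro p
  constructor
  · intro h
    have := W.exp_logZ p l hl t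
    rw [h, sub_self, mul_zero] at this
    exact exp_ne_zero _ this
  · intro h
    have := W.exp_logZc p l hl t
    rw [h, sub_self, mul_zero] at this
    exact exp_ne_zero _ this

theorem continuous_slice {X : Type*} [TopologicalSpace X] {F : ℝ → ℝ → X}
    (hF : ContinuousOn (fun q : ℝ × ℝ => F q.1 q.2) (J ×ˢ univ)) {l : ℝ} (hl : l ∈ J) :
    Continuous (F l) := by
  have : ContinuousOn ((fun q : ℝ × ℝ => F q.1 q.2) ∘ fun t => (l, t)) univ :=
    hF.comp (by fun_prop) (fun t _ => ⟨hl, mem_univ t⟩)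
  exact continuousOn_univ.mp this

theorem continuousOn_slice {X : Type*} [TopologicalSpace X] {F : ℝ → ℝ → X}
    (hF : ContinuousOn (fun q : ℝ × ℝ => F q.1 q.2) (J ×ˢ univ)) (t : ℝ) :
    ContinuousOn (fun l => F l t) J :=
  hF.comp (f := fun l : ℝ => (l, t)) (by fun_prop) (fun l hl => ⟨hl, mem_univ t⟩)

theorem continuousOn_H : ContinuousOn (fun q : ℝ × ℝ => W.H q.1 q.2) (J ×ˢ univ) := by
  unfold H
  refine ContinuousOn.add ?_ (continuousOn_finsetSum _ fun p _ => ?_)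
  · exact ContinuousOn.mul (by fun_prop) W.continuousOn
  · exact ((((W.continuousOn_logZ p).add continuousOn_const).const_smul (V.c p))).add
      (((W.continuousOn_logZc p).sub continuousOn_const).const_smul (conj (V.c p)))

theorem continuousOn_R : ContinuousOn (fun q : ℝ × ℝ => W.R q.1 q.2) (J ×ˢ univ) :=
  Complex.continuous_re.comp_continuousOn (continuousOn_const.mul W.continuousOn_H)

/-- The logarithms are only assumed continuous, but `hasDerivAt_of_exp_eq` makes them
differentiable. The factors ±i and the constants ±πi/2 drop out, so every branch has the same
derivative. -/
theorem hasDerivAt_H {l : ℝ} (hl : l ∈ J) (t : ℝ) :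
    HasDerivAt (W.H l) ((l + V.u (W.γ l t)) * deriv (W.γ l) t) t := by
  have hγ := (W.differentiable l hl t).hasDerivAt
  have hreg := W.γ_mem_regular hl t
  have h1 : ∀ p, HasDerivAt (W.logZ p l) (deriv (W.γ l) t / (W.γ l t - V.z p)) t := by
    intro p
    have h := hasDerivAt_of_exp_eq (continuous_slice (W.continuousOn_logZ p) hl).continuousAt
      (W.exp_logZ p l hl) ((hγ.sub_const (V.z p)).const_mul I)
    rwa [mul_div_mul_left _ _ I_ne_zero] at h
  have h2 : ∀ p, HasDerivAt (W.logZc p l) (deriv (W.γ l) t / (W.γ l t - conj (V.z p))) t := by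
    intro p
    have h := hasDerivAt_of_exp_eq (continuous_slice (W.continuousOn_logZc p) hl).continuousAt
      (W.exp_logZc p l hl) ((hγ.sub_const (conj (V.z p))).const_mul (-I))
    rwa [mul_div_mul_left _ _ (neg_ne_zero.mpr I_ne_zero)] at h
  have h3 := (hγ.const_mul (l : ℂ)).add (HasDerivAt.fun_sum (u := Finset.univ) fun p _ =>
    (((h1 p).add_const (Real.pi * I / 2)).const_mul (V.c p)).add
      (((h2 p).sub_const (Real.pi * I / 2)).const_mul (conj (V.c p))))
  refine h3.congr_deriv ?_
  rw [add_mul, RationalPotential.u, Finset.sum_mul]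
  congr 1
  refine Finset.sum_congr rfl fun p _ => ?_
  ring

theorem continuous_integrand {l : ℝ} (hl : l ∈ J) (ε : ℝ) (p : Fin (n + 1)) :
    Continuous (W.integrand ε l p) := by
  have h1 := continuous_slice W.continuousOn_H hl
  have h2 := continuous_slice W.continuousOn hl
  have h3 := continuous_slice (F := fun l => deriv (W.γ l)) W.continuousOn_deriv hl
  unfold integrand
  refine Continuous.mul (Continuous.div (by fun_prop) (by fun_prop) fun t => ?_) h3
  exact sub_ne_zero.mpr (W.γ_mem_regular hl t p).1

/-- The saddle factor at the parameter `t₀`. -/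
def saddleAt (t₀ ε l : ℝ) : ℂ :=
  deriv (W.γ l) t₀ / ‖deriv (W.γ l) t₀‖ * exp (-I * W.H l t₀ / ε) / √‖deriv V.u (W.γ l t₀)‖

/-- The contour passes at parameter `t₀` over a critical point in a direction of steepest
descent. -/
def IsSteepAt (t₀ l : ℝ) : Prop :=
  (l : ℂ) + V.u (W.γ l t₀) = 0 ∧
    (-I * deriv V.u (W.γ l t₀) * deriv (W.γ l) t₀ ^ 2).re < 0 ∧
    (-I * deriv V.u (W.γ l t₀) * deriv (W.γ l) t₀ ^ 2).im = 0

variable {W}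

theorem IsSteepAt.deriv_ne_zero {t₀ l : ℝ} (h : W.IsSteepAt t₀ l) : deriv (W.γ l) t₀ ≠ 0 := by
  intro h0
  simpa [h0] using h.2.1

theorem IsSteepAt.deriv_u_ne_zero {t₀ l : ℝ} (h : W.IsSteepAt t₀ l) :
    deriv V.u (W.γ l t₀) ≠ 0 := by
  intro h0
  simpa [h0] using h.2.1

/-- A negative real number is minus its modulus. This identifies the Gaussian coefficient a of the
saddle bound as |u'| |γ'|². -/
theorem IsSteepAt.eq {t₀ l : ℝ} (h : W.IsSteepAt t₀ l) :
    -I * deriv V.u (W.γ l t₀) * deriv (W.γ l) t₀ ^ 2 =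
      -((‖deriv V.u (W.γ l t₀)‖ * ‖deriv (W.γ l) t₀‖ ^ 2 : ℝ) : ℂ) := by
  set w := -I * deriv V.u (W.γ l t₀) * deriv (W.γ l) t₀ ^ 2 with hw
  have h1 : ‖w‖ = ‖deriv V.u (W.γ l t₀)‖ * ‖deriv (W.γ l) t₀‖ ^ 2 := by
    simp [hw]
  have h2 : ‖w‖ = -w.re := by
    rw [← abs_of_neg h.2.1]
    exact ((abs_re_eq_norm (z := w)).mpr h.2.2).symm
  rw [← h1, h2]
  apply Complex.ext
  · simp
  · rw [hw, h.2.2]; simp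

variable (W)

/-- Uniform first-order control of a contour near the parameter `t₀`. -/
theorem eventually_norm_sub_tangent_le {K : Set ℝ} (hKJ : K ⊆ J) (hK : IsCompact K) (t₀ : ℝ)
    (hne : ∀ l ∈ K, deriv (W.γ l) t₀ ≠ 0) :
    ∃ δ₀ > 0, ∀ l ∈ K, ∀ s : ℝ, |s| ≤ δ₀ →
      ‖W.γ l (t₀ + s) - W.γ l t₀ - s * deriv (W.γ l) t₀‖ ≤ |s| * ‖deriv (W.γ l) t₀‖ / 4 := by
  have hv : ContinuousOn (fun l => deriv (W.γ l) t₀) K :=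
    (continuousOn_slice (F := fun l => deriv (W.γ l)) W.continuousOn_deriv t₀).mono hKJ
  obtain ⟨v₀, hv₀, hv₀K⟩ := exists_pos_forall_le_of_isCompact hK hv.norm
    (fun l hl => norm_pos_iff.mpr (hne l hl))
  have hcomp : IsCompact (K ×ˢ Icc (t₀ - 1) (t₀ + 1)) := hK.prod isCompact_Icc
  -- With tolerance a quarter of the least speed on K, the mean value inequality gives the factor
  -- 1/4 that `exists_saddle_bound` asks of the endpoints of the arc.
  have huc := hcomp.uniformContinuousOn_of_continuous
    (W.continuousOn_deriv.mono (prod_mono hKJ (subset_univ _)))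
  rw [Metric.uniformContinuousOn_iff] at huc
  obtain ⟨δ, hδ, hδK⟩ := huc (v₀ / 4) (by positivity)
  refine ⟨min 1 (δ / 2), by positivity, fun l hl s hs => ?_⟩
  set d := min 1 (δ / 2)
  have hd1 : d ≤ 1 := min_le_left _ _
  have hdδ : d ≤ δ / 2 := min_le_right _ _
  have hder : ∀ t ∈ Icc (-|s|) |s|, HasDerivWithinAt
      (fun t : ℝ => W.γ l (t₀ + t) - W.γ l t₀ - t * deriv (W.γ l) t₀)
      (deriv (W.γ l) (t₀ + t) - deriv (W.γ l) t₀) (Icc (-|s|) |s|) t := by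
    intro t _
    have h1 : HasDerivAt (fun t : ℝ => W.γ l (t₀ + t)) (deriv (W.γ l) (t₀ + t)) t :=
      (W.differentiable l (hKJ hl) (t₀ + t)).hasDerivAt.comp_const_add t₀ t
    have h2 : HasDerivAt (fun t : ℝ => (t : ℂ) * deriv (W.γ l) t₀) (deriv (W.γ l) t₀) t := by
      simpa using (hasDerivAt_id t).ofReal_comp.mul_const (deriv (W.γ l) t₀)
    exact ((h1.sub_const _).sub h2).hasDerivWithinAt
  have hbd : ∀ t ∈ Icc (-|s|) |s|, ‖deriv (W.γ l) (t₀ + t) - deriv (W.γ l) t₀‖ ≤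
      ‖deriv (W.γ l) t₀‖ / 4 := by
    intro t ht
    have hts : |t| ≤ d := (abs_le.mpr ht).trans hs
    have htb := abs_le.mp hts
    have h := hδK (l, t₀ + t) ⟨hl, by constructor <;> simp <;> linarith⟩ (l, t₀)
      ⟨hl, by constructor <;> simp⟩ (by
        rw [Prod.dist_eq]
        simp only [dist_self, Real.dist_eq, add_sub_cancel_left]
        rw [max_eq_right (abs_nonneg _)]
        linarith)
    rw [dist_eq_norm] at h
    have := hv₀K l hl
    exact h.le.trans (by linarith)
  have h := (convex_Icc (-|s|) |s|).norm_image_sub_le_of_norm_hasDerivWithin_le hder hbd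
    (x := 0) (y := s) ⟨by simp, by simp⟩ ⟨neg_abs_le s, le_abs_self s⟩
  simp only [ofReal_zero, zero_mul, add_zero, sub_self, sub_zero, Real.norm_eq_abs] at h
  exact h.trans (le_of_eq (by ring))

/-- The integral over a short arc through a critical point, in terms of a primitive. -/
theorem exists_primitives {l t₀ ρ : ℝ} (hl : l ∈ J) (hρ : 0 < ρ)
    (hfar : ∀ p, 2 * ρ ≤ ‖W.γ l t₀ - V.z p‖ ∧ 2 * ρ ≤ ‖W.γ l t₀ - conj (V.z p)‖)
    {δ : ℝ} (hδ : 0 < δ)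
    (hin : ∀ t ∈ Icc (t₀ - δ) (t₀ + δ), W.γ l t ∈ Metric.ball (W.γ l t₀) ρ)
    (ε : ℝ) (p : Fin (n + 1)) :
    ∃ φ Φ : ℂ → ℂ, φ (W.γ l t₀) = W.H l t₀ ∧
      (∀ z ∈ Metric.ball (W.γ l t₀) ρ, HasDerivAt φ (l + V.u z) z) ∧
      (∀ z ∈ Metric.ball (W.γ l t₀) ρ, HasDerivAt Φ (exp (-I * φ z / ε) / (z - V.z p)) z) ∧
      ∫ t in (t₀ - δ)..(t₀ + δ), W.integrand ε l p t =
        Φ (W.γ l (t₀ + δ)) - Φ (W.γ l (t₀ - δ)) := by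
  have hreg : Metric.ball (W.γ l t₀) ρ ⊆ V.regular := by
    intro z hz q
    have hz' : ‖W.γ l t₀ - z‖ < ρ := by rw [norm_sub_rev]; simpa [dist_eq_norm] using hz
    constructor
    · rintro rfl
      linarith [(hfar q).1]
    · rintro rfl
      linarith [(hfar q).2]
  obtain ⟨φ, hφ₀, hφ⟩ :=
    ((V.differentiableOn_u.mono hreg).const_add (l : ℂ)).isExactOn_ball.with_val_at
    (W.γ l t₀) (W.H l t₀)
  have hφd : DifferentiableOn ℂ φ (Metric.ball (W.γ l t₀) ρ) := fun z hz =>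
    (hφ z hz).differentiableAt.differentiableWithinAt
  have hΦd : DifferentiableOn ℂ (fun z => exp (-I * φ z / ε) / (z - V.z p))
      (Metric.ball (W.γ l t₀) ρ) := by
    refine DifferentiableOn.div (by fun_prop) (by fun_prop) fun z hz => ?_
    exact sub_ne_zero.mpr (hreg hz p).1
  obtain ⟨Φ, hΦ⟩ := hΦd.isExactOn_ball
  refine ⟨φ, Φ, hφ₀, hφ, hΦ, ?_⟩
  have hγ : ∀ t, HasDerivAt (W.γ l) (deriv (W.γ l) t) t := fun t =>
    (W.differentiable l hl t).hasDerivAt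
  -- Both sides have the same derivative and agree at t₀. Hence φ extends the branch carried by the
  -- contour, which need not be the principal one.
  have hHφ : ∀ t ∈ Icc (t₀ - δ) (t₀ + δ), W.H l t = φ (W.γ l t) := by
    have hd : ∀ t ∈ Icc (t₀ - δ) (t₀ + δ), HasDerivWithinAt (fun t => W.H l t - φ (W.γ l t)) 0
        (Icc (t₀ - δ) (t₀ + δ)) t := by
      intro t ht
      have h := (W.hasDerivAt_H hl t).sub ((hφ _ (hin t ht)).comp_of_eq t (hγ t) rfl)
      rw [sub_self] at h
      exact h.hasDerivWithinAt
    intro t ht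
    have h := (convex_Icc (t₀ - δ) (t₀ + δ)).norm_image_sub_le_of_norm_hasDerivWithin_le hd
      (C := 0) (fun _ _ => by simp) (x := t₀) ⟨by linarith, by linarith⟩ ht
    rw [hφ₀, zero_mul, sub_self, sub_zero, norm_le_zero_iff, sub_eq_zero] at h
    exact h
  refine intervalIntegral.integral_eq_sub_of_hasDerivAt (f := fun t => Φ (W.γ l t)) (fun t ht => ?_)
    (W.continuous_integrand hl ε p).continuousOn.intervalIntegrable
  rw [uIcc_of_le (by linarith)] at ht
  have h := (hΦ _ (hin t ht)).comp_of_eq t (hγ t) rfl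
  dsimp only at h
  rw [← hHφ t ht] at h
  exact h

/-- Contribution of a short arc over a saddle point, uniformly on compact sets. -/
theorem eventually_exists_saddle_arc_bound {K : Set ℝ} (hKJ : K ⊆ J) (hK : IsCompact K) (t₀ : ℝ)
    (hst : ∀ l ∈ K, W.IsSteepAt t₀ l) :
    ∀ᶠ δ in 𝓝[>] (0 : ℝ), ∃ C : ℝ, ∀ l ∈ K, ∀ ε : ℝ, 0 < ε → ε ≤ 1 → ∀ p,
      ‖(∫ t in (t₀ - δ)..(t₀ + δ), W.integrand ε l p t) -
        (√(2 * Real.pi * ε) : ℝ) * (W.saddleAt t₀ ε l / (W.γ l t₀ - V.z p))‖ ≤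
          C * (ε * √ε) * Real.exp (W.R l t₀ / ε) := by
  have hγc : ContinuousOn (fun l => W.γ l t₀) K := (continuousOn_slice W.continuousOn t₀).mono hKJ
  have hvc : ContinuousOn (fun l => deriv (W.γ l) t₀) K :=
    (continuousOn_slice (F := fun l => deriv (W.γ l)) W.continuousOn_deriv t₀).mono hKJ
  have huc : ContinuousOn (fun l => deriv V.u (W.γ l t₀)) K :=
    V.continuousOn_deriv_u.comp hγc fun l hl => W.γ_mem_regular (hKJ hl) t₀
  obtain ⟨δ₁, hδ₁, htan⟩ := W.eventually_norm_sub_tangent_le hKJ hK t₀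
    fun l hl => (hst l hl).deriv_ne_zero
  obtain ⟨ρ, hρ, hfar⟩ : ∃ ρ > 0, ∀ l ∈ K, ∀ p, 2 * ρ ≤ ‖W.γ l t₀ - V.z p‖ ∧
      2 * ρ ≤ ‖W.γ l t₀ - conj (V.z p)‖ := by
    have h : ∀ p, ∃ m > 0, ∀ l ∈ K, m ≤ min ‖W.γ l t₀ - V.z p‖ ‖W.γ l t₀ - conj (V.z p)‖ := by
      intro p
      refine exists_pos_forall_le_of_isCompact hK (by fun_prop) fun l hl => ?_
      have := W.γ_mem_regular (hKJ hl) t₀ p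
      exact lt_min (norm_pos_iff.mpr (sub_ne_zero.mpr this.1))
        (norm_pos_iff.mpr (sub_ne_zero.mpr this.2))
    choose m hm hmK using h
    refine ⟨Finset.univ.inf' Finset.univ_nonempty m / 2, ?_, fun l hl p => ?_⟩
    · have : 0 < Finset.univ.inf' Finset.univ_nonempty m :=
        (Finset.lt_inf'_iff _).mpr fun p _ => hm p
      positivity
    · have h1 := (Finset.inf'_le m (Finset.mem_univ p)).trans (hmK p l hl)
      rw [le_min_iff] at h1
      rw [mul_div_cancel₀ _ two_ne_zero]
      exact h1
  obtain ⟨Mv, hMv, hMvK⟩ := exists_pos_forall_norm_le_of_isCompact hK hvc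
  obtain ⟨Ml, hMl, hMlK⟩ := exists_pos_forall_norm_le_of_isCompact hK
    (f := fun l : ℝ => (l : ℂ)) (by fun_prop)
  obtain ⟨a₀, ha₀, ha₀K⟩ := exists_pos_forall_le_of_isCompact hK
    (f := fun l => ‖deriv V.u (W.γ l t₀)‖ * ‖deriv (W.γ l) t₀‖ ^ 2) (by fun_prop)
    fun l hl => mul_pos (norm_pos_iff.mpr (hst l hl).deriv_u_ne_zero)
      (pow_pos (norm_pos_iff.mpr (hst l hl).deriv_ne_zero) 2)
  have hM0 : 0 ≤ Ml + ∑ p, 2 * ‖V.c p‖ / ρ := by positivity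
  obtain ⟨δ₂, hδ₂, hsaddle⟩ := exists_saddle_bound hρ hM0 hMv ha₀
  have hev : Ioc (0 : ℝ) (min (min δ₁ δ₂) (ρ / (2 * Mv))) ∈ 𝓝[>] (0 : ℝ) :=
    Ioc_mem_nhdsGT (by positivity)
  filter_upwards [hev] with δ hδ
  have hδ0 := hδ.1
  have hδa : δ ≤ δ₁ := hδ.2.trans ((min_le_left _ _).trans (min_le_left _ _))
  have hδb : δ ≤ δ₂ := hδ.2.trans ((min_le_left _ _).trans (min_le_right _ _))
  have hδc : 2 * (δ * Mv) ≤ ρ := by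
    have := hδ.2.trans (min_le_right _ _)
    rw [le_div_iff₀ (by positivity)] at this
    linarith
  obtain ⟨C, hC⟩ := hsaddle δ hδ0 hδb
  refine ⟨C, fun l hl ε hε hε1 p => ?_⟩
  have hin : ∀ t ∈ Icc (t₀ - δ) (t₀ + δ), W.γ l t ∈ Metric.ball (W.γ l t₀) ρ := by
    intro t ht
    have hs : |t - t₀| ≤ δ := abs_le.mpr ⟨by linarith [ht.1], by linarith [ht.2]⟩
    have h := htan l hl (t - t₀) (hs.trans hδa)
    rw [add_sub_cancel] at h
    rw [Metric.mem_ball, dist_eq_norm]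
    have h1 := norm_le_norm_sub_add (W.γ l t - W.γ l t₀) (((t - t₀ : ℝ) : ℂ) * deriv (W.γ l) t₀)
    rw [norm_mul, Complex.norm_real, Real.norm_eq_abs] at h1
    have h2 : |t - t₀| * ‖deriv (W.γ l) t₀‖ ≤ δ * Mv :=
      mul_le_mul hs (hMvK l hl) (norm_nonneg _) hδ0.le
    nlinarith [mul_pos hδ0 hMv]
  obtain ⟨φ, Φ, hφ₀, hφ, hΦ, hint⟩ := W.exists_primitives (hKJ hl) hρ (hfar l hl) hδ0 hin ε p
  have hreg : Metric.ball (W.γ l t₀) ρ ⊆ V.regular := by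
    intro z hz q
    have hz' : ‖W.γ l t₀ - z‖ < ρ := by rw [norm_sub_rev]; simpa [dist_eq_norm] using hz
    constructor
    · rintro rfl
      linarith [(hfar l hl q).1]
    · rintro rfl
      linarith [(hfar l hl q).2]
  have hk : deriv (fun z => (l : ℂ) + V.u z) (W.γ l t₀) = deriv V.u (W.γ l t₀) := by
    simp
  have hP := htan l hl δ (by rwa [abs_of_pos hδ0])
  have hMi := htan l hl (-δ) (by rwa [abs_neg, abs_of_pos hδ0])
  rw [abs_of_pos hδ0, sub_sub] at hP
  rw [abs_neg, abs_of_pos hδ0, ← sub_eq_add_neg, sub_sub, ofReal_neg, neg_mul,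
    ← sub_eq_add_neg] at hMi
  have h := hC (W.γ l t₀) (deriv (W.γ l) t₀) (V.z p) (W.γ l (t₀ + δ)) (W.γ l (t₀ - δ))
    (fun z => l + V.u z) φ Φ (‖deriv V.u (W.γ l t₀)‖ * ‖deriv (W.γ l) t₀‖ ^ 2) ε
    ((V.differentiableOn_u.mono hreg).const_add _)
    (fun z hz => by
      refine (norm_add_le _ _).trans (add_le_add (hMlK l hl) (V.norm_u_le hρ fun q => ?_))
      have hz' : ‖W.γ l t₀ - z‖ < ρ := by rw [norm_sub_rev]; simpa [dist_eq_norm] using hz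
      have h1 := norm_sub_le_norm_sub_add_norm_sub (W.γ l t₀) z (V.z q)
      have h2 := norm_sub_le_norm_sub_add_norm_sub (W.γ l t₀) z (conj (V.z q))
      have h3 := hfar l hl q
      constructor <;> linarith)
    (hst l hl).1 hφ (by rw [hk]; exact (hst l hl).eq) (ha₀K l hl) (hMvK l hl) (hfar l hl p).1
    hP hMi hε hε1 hΦ
  rw [hint]
  rw [hφ₀] at h
  convert h using 3
  swap
  · rfl
  -- With a = |u'| |γ'|², the factor γ' √(2πε/a) equals √(2πε) (γ'/|γ'|)/√|u'|: the speed of the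
  -- parametrization cancels.
  rw [saddleAt, Real.sqrt_div (by positivity), Real.sqrt_mul (norm_nonneg _),
    Real.sqrt_sq (norm_nonneg _)]
  push_cast
  have h1 : ((√‖deriv V.u (W.γ l t₀)‖ : ℝ) : ℂ) ≠ 0 := by
    have := norm_pos_iff.mpr (hst l hl).deriv_u_ne_zero
    exact_mod_cast (Real.sqrt_pos.mpr this).ne'
  have h2 : ((‖deriv (W.γ l) t₀‖ : ℝ) : ℂ) ≠ 0 := by
    exact_mod_cast (norm_pos_iff.mpr (hst l hl).deriv_ne_zero).ne'
  have h3 := sub_ne_zero.mpr (W.γ_mem_regular (hKJ hl) t₀ p).1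
  field_simp

end Contour

/-! ### Steepest descent along a whole contour -/

namespace Contour

variable {n : ℕ} {V : RationalPotential n} {J : Set ℝ} (W : Contour V J)

/-- Away from the parameters at which the level is attained, the level along the contour stays
below it by a gap, uniformly on compact sets. -/
theorem exists_gap {K : Set ℝ} (hKJ : K ⊆ J) (hK : IsCompact K) (hends : W.EndsInValleys)
    {U : Set ℝ} (hU : IsOpen U) {R₀ : ℝ → ℝ} (hR₀ : ContinuousOn R₀ K)
    (hlt : ∀ l ∈ K, ∀ t ∉ U, W.R l t < R₀ l) :
    ∃ c > 0, ∀ l ∈ K, ∀ t ∉ U, W.R l t ≤ R₀ l - c := by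
  obtain ⟨B, hB, hBK⟩ := exists_pos_forall_norm_le_of_isCompact hK hR₀
  -- Since R₀ ≥ -B on K, the gap is at least 1 beyond T. The remaining parameters outside U form a
  -- compact set.
  obtain ⟨T, hT⟩ := (hends K hKJ hK).1 (-B - 1)
  have hcomp : IsCompact (K ×ˢ (Icc (-T) T \ U)) := hK.prod (isCompact_Icc.diff hU)
  obtain ⟨m, hm, hmK⟩ := exists_pos_forall_le_of_isCompact hcomp
    (f := fun q => R₀ q.1 - W.R q.1 q.2)
    ((hR₀.comp continuousOn_fst fun q hq => hq.1).sub
      (W.continuousOn_R.mono (prod_mono hKJ (subset_univ _))))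
    (fun q hq => sub_pos.mpr (hlt q.1 hq.1 q.2 hq.2.2))
  refine ⟨min 1 m, by positivity, fun l hl t ht => ?_⟩
  by_cases htT : T ≤ |t|
  · have h1 := hT l hl t htT
    have h2 := abs_le.mp (hBK l hl)
    linarith [min_le_left 1 m]
  · push Not at htT
    have h := hmK (l, t) ⟨hl, ⟨(abs_lt.mp htT).1.le, (abs_lt.mp htT).2.le⟩, ht⟩
    have := min_le_right 1 m
    dsimp only at h
    linarith

theorem norm_integrand_eq (ε l : ℝ) (p : Fin (n + 1)) (t : ℝ) :
    ‖W.integrand ε l p t‖ =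
      Real.exp (W.R l t / ε) * (‖W.γ l t - V.z p‖⁻¹ * ‖deriv (W.γ l) t‖) := by
  rw [integrand, norm_mul, norm_div, Complex.norm_exp, Complex.div_ofReal_re, R]
  ring

/-- Passing from ε₁ to ε multiplies the modulus by exp(R(1/ε - 1/ε₁)), and 1/ε - 1/ε₁ ≥ 0. One
dominating function at ε₁ therefore serves for all smaller ε. -/
theorem norm_integrand_le {ε ε₁ l r : ℝ} (p : Fin (n + 1)) {t : ℝ} (hε : 0 < ε) (hε₁ : ε ≤ ε₁)
    (hr : W.R l t ≤ r) :
    ‖W.integrand ε l p t‖ ≤ ‖W.integrand ε₁ l p t‖ * Real.exp (r / ε - r / ε₁) := by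
  rw [norm_integrand_eq, norm_integrand_eq, mul_right_comm, ← Real.exp_add]
  gcongr
  have h1 : 0 ≤ 1 / ε - 1 / ε₁ := sub_nonneg.mpr (one_div_le_one_div_of_le hε hε₁)
  have h2 : W.R l t * (1 / ε - 1 / ε₁) ≤ r * (1 / ε - 1 / ε₁) := by gcongr
  calc W.R l t / ε = W.R l t / ε₁ + W.R l t * (1 / ε - 1 / ε₁) := by ring
    _ ≤ W.R l t / ε₁ + r * (1 / ε - 1 / ε₁) := by gcongr
    _ = _ := by ring

/-- The integrals converge for small `ε`, and the part of a contour below a level contributes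
exponentially less than that level. -/
theorem exists_tail_bound {K : Set ℝ} (hKJ : K ⊆ J) (hK : IsCompact K) (hends : W.EndsInValleys)
    {S : Set ℝ} (hS : MeasurableSet S) {R₀ : ℝ → ℝ} (hR₀ : ContinuousOn R₀ K) {c : ℝ}
    (hle : ∀ l ∈ K, ∀ t, W.R l t ≤ R₀ l) (hlt : ∀ l ∈ K, ∀ t ∈ S, W.R l t ≤ R₀ l - c) :
    ∃ C : ℝ, 0 ≤ C ∧ ∃ ε₁ > 0, ∀ l ∈ K, ∀ ε : ℝ, 0 < ε → ε ≤ ε₁ → ∀ p,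
      Integrable (W.integrand ε l p) ∧
      ‖∫ t in S, W.integrand ε l p t‖ ≤ C * Real.exp (-c / ε) * Real.exp (R₀ l / ε) := by
  obtain ⟨B, hB, hBK⟩ := exists_pos_forall_norm_le_of_isCompact hK hR₀
  obtain ⟨ε₁, hε₁, g, hg, hgK⟩ := (hends K hKJ hK).2
  refine ⟨Real.exp ((B + c) / ε₁) * ∫ t, |g t|, by positivity, ε₁, hε₁, fun l hl ε hε hle₁ p => ?_⟩
  have hint : ∀ r : ℝ, Integrable fun t => |g t| * Real.exp (r / ε - r / ε₁) := fun r =>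
    hg.abs.mul_const _
  have hgl : ∀ t, ‖W.integrand ε₁ l p t‖ ≤ |g t| := fun t => (hgK l hl p t).trans (le_abs_self _)
  have hbound : ∀ r t, W.R l t ≤ r →
      ‖W.integrand ε l p t‖ ≤ |g t| * Real.exp (r / ε - r / ε₁) := fun r t h =>
    (W.norm_integrand_le p hε hle₁ h).trans (mul_le_mul_of_nonneg_right (hgl t) (Real.exp_pos _).le)
  refine ⟨(hint (R₀ l)).mono' (W.continuous_integrand (hKJ hl) ε p).aestronglyMeasurable
    (Eventually.of_forall fun t => hbound _ t (hle l hl t)), ?_⟩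
  have h1 : ‖∫ t in S, W.integrand ε l p t‖ ≤
      ∫ t in S, |g t| * Real.exp ((R₀ l - c) / ε - (R₀ l - c) / ε₁) :=
    norm_integral_le_of_norm_le (hint _).integrableOn
      ((ae_restrict_iff' hS).mpr (Eventually.of_forall fun t ht => hbound _ t (hlt l hl t ht)))
  refine h1.trans ((setIntegral_le_integral (hint _)
    (Eventually.of_forall fun t => by positivity)).trans ?_)
  rw [integral_mul_const]
  have h2 : (R₀ l - c) / ε - (R₀ l - c) / ε₁ ≤ (B + c) / ε₁ + (-c / ε + R₀ l / ε) := by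
    have h3 := (abs_le.mp (hBK l hl)).1
    have h4 : -(R₀ l - c) / ε₁ ≤ (B + c) / ε₁ := by gcongr; linarith
    calc _ = -(R₀ l - c) / ε₁ + (-c / ε + R₀ l / ε) := by ring
      _ ≤ _ := by gcongr
  have h0 : 0 ≤ ∫ t, |g t| := by positivity
  calc (∫ t, |g t|) * Real.exp ((R₀ l - c) / ε - (R₀ l - c) / ε₁)
      ≤ (∫ t, |g t|) * Real.exp ((B + c) / ε₁ + (-c / ε + R₀ l / ε)) := by gcongr
    _ = _ := by rw [Real.exp_add, Real.exp_add]; ring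

/-- The steepest descent asymptotics of the integral over a contour whose maximal level is
attained exactly at finitely many saddle points, uniformly on compact sets. -/
theorem exists_integral_bound {K : Set ℝ} (hKJ : K ⊆ J) (hK : IsCompact K)
    (hends : W.EndsInValleys) (S : Finset ℝ) {R₀ : ℝ → ℝ} (hR₀ : ContinuousOn R₀ K)
    (hst : ∀ t ∈ S, ∀ l ∈ K, W.IsSteepAt t l) (heq : ∀ t ∈ S, ∀ l ∈ K, W.R l t = R₀ l)
    (hlt : ∀ l ∈ K, ∀ t ∉ S, W.R l t < R₀ l) :
    ∃ C : ℝ, ∃ ε₀ > 0, ∀ l ∈ K, ∀ ε : ℝ, 0 < ε → ε ≤ ε₀ → ∀ p,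
      ‖W.integral ε l p - (√(2 * Real.pi * ε) : ℝ) *
        ∑ t ∈ S, W.saddleAt t ε l / (W.γ l t - V.z p)‖ ≤ C * (ε * √ε) * Real.exp (R₀ l / ε) := by
  -- The statement holds for all small δ, so that a single δ serves every saddle and also separates
  -- the arcs.
  have hev1 : ∀ᶠ δ in 𝓝[>] (0 : ℝ), ∀ t₀ ∈ S, ∃ C : ℝ, ∀ l ∈ K, ∀ ε : ℝ, 0 < ε → ε ≤ 1 → ∀ p,
      ‖(∫ t in (t₀ - δ)..(t₀ + δ), W.integrand ε l p t) -
        (√(2 * Real.pi * ε) : ℝ) * (W.saddleAt t₀ ε l / (W.γ l t₀ - V.z p))‖ ≤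
          C * (ε * √ε) * Real.exp (R₀ l / ε) := by
    rw [Finset.eventually_all]
    intro t₀ ht₀
    filter_upwards [W.eventually_exists_saddle_arc_bound hKJ hK t₀ (hst t₀ ht₀)] with δ hδ
    obtain ⟨C, hC⟩ := hδ
    refine ⟨C, fun l hl ε hε hε1 p => ?_⟩
    rw [← heq t₀ ht₀ l hl]
    exact hC l hl ε hε hε1 p
  have hev2 : ∀ᶠ δ in 𝓝[>] (0 : ℝ), ∀ s ∈ S, ∀ t ∈ S, s < t → s + δ ≤ t - δ := by
    rw [Finset.eventually_all]
    intro s _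
    rw [Finset.eventually_all]
    intro t _
    by_cases hst : s < t
    · have : Ioc (0 : ℝ) ((t - s) / 2) ∈ 𝓝[>] (0 : ℝ) := Ioc_mem_nhdsGT (by linarith)
      filter_upwards [this] with δ hδ _
      linarith [hδ.2]
    · exact Eventually.of_forall fun δ h => absurd h hst
  obtain ⟨δ, ⟨hloc, hdisj⟩, hδ⟩ := ((hev1.and hev2).and self_mem_nhdsWithin).exists
  choose! Cl hCl using hloc
  have hopen : IsOpen (⋃ t ∈ S, Ioo (t - δ) (t + δ)) :=
    isOpen_biUnion fun _ _ => isOpen_Ioo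
  obtain ⟨c, hc, hgap⟩ := W.exists_gap hKJ hK hends hopen hR₀ (fun l hl t ht => hlt l hl t fun hS =>
    ht (mem_biUnion hS ⟨by linarith, by linarith⟩))
  -- Half-open arcs match interval integrals and remain disjoint when they touch. The gap was taken
  -- outside the open arcs, which covers the complement of A.
  set A := ⋃ t ∈ S, Ioc (t - δ) (t + δ) with hA
  have hAm : MeasurableSet A := Finset.measurableSet_biUnion _ fun _ _ => measurableSet_Ioc
  have hle : ∀ l ∈ K, ∀ t, W.R l t ≤ R₀ l := by
    intro l hl t
    by_cases ht : t ∈ S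
    · exact (heq t ht l hl).le
    · exact (hlt l hl t ht).le
  obtain ⟨C', hC'0, ε₁, hε₁, htail⟩ := W.exists_tail_bound hKJ hK hends hAm.compl hR₀ hle
    (c := c) (fun l hl t ht => hgap l hl t fun h => ht (by
      refine (biUnion_mono (subset_refl _) fun _ _ => Ioo_subset_Ioc_self) h))
  refine ⟨∑ t ∈ S, Cl t + C' * (2 / c ^ 2), min ε₁ 1, by positivity, fun l hl ε hε hle' p => ?_⟩
  have hε1 : ε ≤ 1 := hle'.trans (min_le_right _ _)
  obtain ⟨hint, htl⟩ := htail l hl ε hε (hle'.trans (min_le_left _ _)) p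
  have hpd : (S : Set ℝ).PairwiseDisjoint fun t => Ioc (t - δ) (t + δ) := by
    intro s hs t ht hne
    rw [Function.onFun, Set.disjoint_left]
    intro x hx hx'
    rcases lt_or_gt_of_ne hne with h | h
    · linarith [hdisj s hs t ht h, hx.2, hx'.1]
    · linarith [hdisj t ht s hs h, hx.1, hx'.2]
  have hsplit : W.integral ε l p = ∑ t₀ ∈ S, (∫ t in (t₀ - δ)..(t₀ + δ), W.integrand ε l p t) +
      ∫ t in Aᶜ, W.integrand ε l p t := by
    rw [integral, ← integral_add_compl hAm hint, hA, integral_biUnion_finset S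
      (fun _ _ => measurableSet_Ioc) hpd (fun _ _ => hint.integrableOn)]
    congr 1
    refine Finset.sum_congr rfl fun t _ => ?_
    rw [intervalIntegral.integral_of_le (by linarith)]
  have e1 : W.integral ε l p - (√(2 * Real.pi * ε) : ℝ) *
      ∑ t ∈ S, W.saddleAt t ε l / (W.γ l t - V.z p) =
      ∑ t₀ ∈ S, ((∫ t in (t₀ - δ)..(t₀ + δ), W.integrand ε l p t) -
        (√(2 * Real.pi * ε) : ℝ) * (W.saddleAt t₀ ε l / (W.γ l t₀ - V.z p))) +
      ∫ t in Aᶜ, W.integrand ε l p t := by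
    rw [hsplit, Finset.sum_sub_distrib, Finset.mul_sum]
    ring
  rw [e1]
  refine (norm_add_le _ _).trans ?_
  have h1 : ‖∑ t₀ ∈ S, ((∫ t in (t₀ - δ)..(t₀ + δ), W.integrand ε l p t) -
        (√(2 * Real.pi * ε) : ℝ) * (W.saddleAt t₀ ε l / (W.γ l t₀ - V.z p)))‖ ≤
      ∑ t₀ ∈ S, Cl t₀ * (ε * √ε) * Real.exp (R₀ l / ε) :=
    (norm_sum_le _ _).trans (Finset.sum_le_sum fun t ht => hCl t ht l hl ε hε hε1 p)
  have h2 : C' * Real.exp (-c / ε) * Real.exp (R₀ l / ε) ≤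
      C' * (2 / c ^ 2 * (ε * √ε)) * Real.exp (R₀ l / ε) := by
    have := exp_neg_div_le hc hε hε1
    gcongr
  calc _ ≤ ∑ t₀ ∈ S, Cl t₀ * (ε * √ε) * Real.exp (R₀ l / ε) +
        C' * (2 / c ^ 2 * (ε * √ε)) * Real.exp (R₀ l / ε) := add_le_add h1 (htl.trans h2)
    _ = _ := by rw [← Finset.sum_mul, ← Finset.sum_mul]; ring

end Contour

/-! ### Perturbation of determinants and Cauchy determinants -/

/-- The determinant is Lipschitz on bounded sets of matrices. -/
theorem exists_det_sub_bound (m : ℕ) (B C : ℝ) :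
    ∃ C' : ℝ, ∀ (M N : Matrix (Fin m) (Fin m) ℂ) (ε : ℝ), 0 < ε → ε ≤ 1 →
      (∀ i j, ‖N i j‖ ≤ B) → (∀ i j, ‖M i j - N i j‖ ≤ C * ε) → ‖M.det - N.det‖ ≤ C' * ε := by
  let f : MultilinearMap ℂ (fun _ : Fin m => Fin m → ℂ) ℂ :=
    (Matrix.detRowAlternating (n := Fin m) (R := ℂ)).toMultilinearMap
  have hf : Continuous f := Continuous.matrix_det continuous_id
  obtain ⟨D, hD, hDf⟩ := MultilinearMap.exists_bound_of_continuous f hf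
  refine ⟨D * m * (|B| + |C|) ^ (m - 1) * |C|, fun M N ε hε hε1 hN hMN => ?_⟩
  let M' : Fin m → Fin m → ℂ := fun i j => M i j
  let N' : Fin m → Fin m → ℂ := fun i j => N i j
  have h := f.norm_image_sub_le_of_bound hD.le hDf M' N'
  have hCε : C * ε ≤ |C| * ε := by gcongr; exact le_abs_self C
  have hN' : ‖N'‖ ≤ |B| + |C| := by
    refine (pi_norm_le_iff_of_nonneg (by positivity)).mpr fun i =>
      (pi_norm_le_iff_of_nonneg (by positivity)).mpr fun j => ?_
    exact (hN i j).trans ((le_abs_self B).trans (by linarith [abs_nonneg C]))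
  have hM' : ‖M'‖ ≤ |B| + |C| := by
    refine (pi_norm_le_iff_of_nonneg (by positivity)).mpr fun i =>
      (pi_norm_le_iff_of_nonneg (by positivity)).mpr fun j => ?_
    have h1 := norm_le_norm_sub_add (M i j) (N i j)
    have h2 : |C| * ε ≤ |C| := mul_le_of_le_one_right (abs_nonneg C) hε1
    linarith [hN i j, hMN i j, le_abs_self B]
  have hS : ‖M' - N'‖ ≤ |C| * ε := by
    refine (pi_norm_le_iff_of_nonneg (by positivity)).mpr fun i =>
      (pi_norm_le_iff_of_nonneg (by positivity)).mpr fun j => ?_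
    exact (hMN i j).trans hCε
  calc ‖M.det - N.det‖ ≤ D * Fintype.card (Fin m) *
        max ‖M'‖ ‖N'‖ ^ (Fintype.card (Fin m) - 1) *
        ‖M' - N'‖ := h
    _ ≤ D * m * (|B| + |C|) ^ (m - 1) * (|C| * ε) := by
      rw [Fintype.card_fin]
      gcongr
      exact max_le hM' hN'
    _ = _ := by ring

theorem prod_Ioi_eq_prod_Iio {m : ℕ} {M : Type*} [CommMonoid M] (f : Fin m → Fin m → M) :
    ∏ i, ∏ j ∈ Finset.Ioi i, f i j = ∏ j, ∏ i ∈ Finset.Iio j, f i j :=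
  Finset.prod_comm' fun i j => by simp

/-- The determinant of a Cauchy matrix. -/
theorem det_cauchy {m : ℕ} (x z : Fin m → ℂ) (hz : Function.Injective z)
    (hxz : ∀ i j, x i ≠ z j) :
    (Matrix.of fun i j => 1 / (x i - z j)).det =
      (∏ j, ∏ i ∈ Finset.Iio j, (x j - x i)) * (∏ j, ∏ i ∈ Finset.Iio j, (z i - z j)) /
        ∏ i, ∏ j, (x i - z j) := by
  -- L j is the numerator of 1/(X - z_j) over the common denominator ∏(X - z_k). Hence the
  -- Vandermonde matrix of x times the coefficient matrix A is the Cauchy matrix with row i scaled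
  -- by ∏_k (x_i - z_k).
  let L : Fin m → Polynomial ℂ := fun j =>
    ∏ k ∈ Finset.univ.erase j, (Polynomial.X - Polynomial.C (z k))
  let A : Matrix (Fin m) (Fin m) ℂ := Matrix.of fun k j => (L j).coeff k
  have hdeg : ∀ j, (L j).natDegree < m := by
    intro j
    have h1 : (L j).natDegree ≤ ∑ k ∈ Finset.univ.erase j,
        (Polynomial.X - Polynomial.C (z k)).natDegree := Polynomial.natDegree_prod_le _ _
    have h2 := Finset.card_erase_lt_of_mem (Finset.mem_univ j)
    simp only [Polynomial.natDegree_X_sub_C, Finset.sum_const, smul_eq_mul, mul_one] at h1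
    rw [Finset.card_univ, Fintype.card_fin] at h2
    omega
  have heval : ∀ (y : Fin m → ℂ) i j, (Matrix.vandermonde y * A) i j = (L j).eval (y i) := by
    intro y i j
    rw [Polynomial.eval_eq_sum_range' (hdeg j), Finset.sum_range, Matrix.mul_apply]
    refine Finset.sum_congr rfl fun k _ => ?_
    simp [Matrix.vandermonde_apply, A, mul_comm]
  have hLeval : ∀ j (w : ℂ), (L j).eval w = ∏ k ∈ Finset.univ.erase j, (w - z k) := by
    intro j w
    simp [L, Polynomial.eval_prod]
  have hz0 : (∏ j, ∏ i ∈ Finset.Iio j, (z j - z i)) ≠ 0 :=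
    Finset.prod_ne_zero_iff.mpr fun j _ => Finset.prod_ne_zero_iff.mpr fun i hi =>
      sub_ne_zero.mpr fun h => (Finset.mem_Iio.mp hi).ne (hz h).symm
  -- At the nodes z the product with A is diagonal, and cancelling the nonzero Vandermonde
  -- determinant of z leaves det A.
  have hdetA : A.det = ∏ j, ∏ i ∈ Finset.Iio j, (z i - z j) := by
    have h1 : Matrix.vandermonde z * A =
        Matrix.diagonal fun j => ∏ k ∈ Finset.univ.erase j, (z j - z k) := by
      ext i j
      rw [heval, hLeval, Matrix.diagonal_apply]
      split_ifs with hij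
      · rw [hij]
      · exact Finset.prod_eq_zero (Finset.mem_erase.mpr ⟨hij, Finset.mem_univ i⟩) (sub_self _)
    have h2 := congrArg Matrix.det h1
    rw [Matrix.det_mul, Matrix.det_vandermonde, Matrix.det_diagonal,
      prod_Ioi_eq_prod_Iio (fun i j => z j - z i)] at h2
    have h3 : ∏ j, ∏ k ∈ Finset.univ.erase j, (z j - z k) =
        (∏ j, ∏ i ∈ Finset.Iio j, (z j - z i)) * ∏ j, ∏ i ∈ Finset.Iio j, (z i - z j) := by
      rw [← prod_Ioi_eq_prod_Iio (fun i j => z i - z j), ← Finset.prod_mul_distrib]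
      refine Finset.prod_congr rfl fun j _ => ?_
      rw [← Finset.prod_union (by
        rw [Finset.disjoint_left]
        intro i h1 h2
        exact absurd (Finset.mem_Iio.mp h1) (not_lt.mpr (Finset.mem_Ioi.mp h2).le))]
      refine Finset.prod_congr ?_ fun _ _ => rfl
      ext i
      simp [lt_or_lt_iff_ne]
    rw [h3] at h2
    exact mul_left_cancel₀ hz0 h2
  have hxz0 : (∏ i, ∏ j, (x i - z j)) ≠ 0 :=
    Finset.prod_ne_zero_iff.mpr fun i _ => Finset.prod_ne_zero_iff.mpr fun j _ =>
      sub_ne_zero.mpr (hxz i j)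
  have hx : Matrix.vandermonde x * A =
      Matrix.of fun i j => (∏ k, (x i - z k)) * (Matrix.of fun i j => 1 / (x i - z j)) i j := by
    ext i j
    rw [heval, hLeval, Matrix.of_apply, Matrix.of_apply,
      ← Finset.mul_prod_erase Finset.univ _ (Finset.mem_univ j)]
    have := sub_ne_zero.mpr (hxz i j)
    field_simp
  have h := congrArg Matrix.det hx
  rw [Matrix.det_mul, Matrix.det_vandermonde, hdetA, Matrix.det_mul_column,
    prod_Ioi_eq_prod_Iio (fun i j => x j - x i)] at h
  rw [eq_div_iff hxz0, mul_comm, ← h]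

theorem det_cauchy_ne_zero {m : ℕ} {x z : Fin m → ℂ} (hx : Function.Injective x)
    (hz : Function.Injective z) (hxz : ∀ i j, x i ≠ z j) :
    (Matrix.of fun i j => 1 / (x i - z j)).det ≠ 0 := by
  rw [det_cauchy x z hz hxz]
  refine div_ne_zero (mul_ne_zero ?_ ?_) ?_
  · exact Finset.prod_ne_zero_iff.mpr fun j _ => Finset.prod_ne_zero_iff.mpr fun i hi =>
      sub_ne_zero.mpr fun h => (Finset.mem_Iio.mp hi).ne (hx h).symm
  · exact Finset.prod_ne_zero_iff.mpr fun j _ => Finset.prod_ne_zero_iff.mpr fun i hi =>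
      sub_ne_zero.mpr fun h => (Finset.mem_Iio.mp hi).ne (hz h)
  · exact Finset.prod_ne_zero_iff.mpr fun i _ => Finset.prod_ne_zero_iff.mpr fun j _ =>
      sub_ne_zero.mpr (hxz i j)

/-- The determinant of a Cauchy matrix with a further node in the last row. -/
theorem det_cauchy_snoc {m : ℕ} (x : Fin m → ℂ) (a : ℂ) (z : Fin (m + 1) → ℂ)
    (hz : Function.Injective z) (hxz : ∀ i j, x i ≠ z j) (haz : ∀ j, a ≠ z j) :
    (Matrix.of fun i j => 1 / ((Fin.snoc x a : Fin (m + 1) → ℂ) i - z j)).det =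
      ((∏ j, ∏ i ∈ Finset.Iio j, (x j - x i)) * (∏ j, ∏ i ∈ Finset.Iio j, (z i - z j)) /
        ∏ i, ∏ j, (x i - z j)) * ((∏ i, (a - x i)) / ∏ j, (a - z j)) := by
  have hne : ∀ i j, (Fin.snoc x a : Fin (m + 1) → ℂ) i ≠ z j := by
    intro i j
    refine Fin.lastCases ?_ (fun i => ?_) i
    · simpa using haz j
    · simpa using hxz i j
  rw [det_cauchy _ z hz hne, Fin.prod_univ_castSucc (n := m)
    (f := fun j => ∏ i ∈ Finset.Iio j,
      ((Fin.snoc x a : Fin (m + 1) → ℂ) j - (Fin.snoc x a : Fin (m + 1) → ℂ) i)),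
    Fin.prod_univ_castSucc (n := m) (f := fun i => ∏ j, ((Fin.snoc x a : Fin (m + 1) → ℂ) i - z j))]
  simp only [Fin.snoc_castSucc, Fin.snoc_last]
  have h1 : ∀ j : Fin m, ∏ i ∈ Finset.Iio j.castSucc, (x j - (Fin.snoc x a : Fin (m + 1) → ℂ) i) =
      ∏ i ∈ Finset.Iio j, (x j - x i) := by
    intro j
    rw [← Fin.map_castSuccEmb_Iio, Finset.prod_map]
    simp
  have h2 : ∏ i ∈ Finset.Iio (Fin.last m), (a - (Fin.snoc x a : Fin (m + 1) → ℂ) i) =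
      ∏ i, (a - x i) := by
    rw [Fin.Iio_last_eq_map, Finset.prod_map]
    simp
  simp only [h1, h2]
  rw [mul_right_comm, mul_div_mul_comm]

/-- A determinant with Cauchy rows except for the row `Q`, which is a combination of two Cauchy
rows. -/
theorem det_cauchy_row {m : ℕ} (Q : Fin (m + 1)) (M : Matrix (Fin (m + 1)) (Fin (m + 1)) ℂ)
    (x : Fin m → ℂ) (z : Fin (m + 1) → ℂ) (a b α β : ℂ)
    (hz : Function.Injective z) (hxz : ∀ i j, x i ≠ z j) (haz : ∀ j, a ≠ z j) (hbz : ∀ j, b ≠ z j)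
    (hrow : ∀ j p, M (Q.succAbove j) p = 1 / (x j - z p))
    (hQ : ∀ p, M Q p = α / (a - z p) + β / (b - z p)) :
    M.det = (-1) ^ (m - (Q : ℕ)) *
      ((∏ j, ∏ i ∈ Finset.Iio j, (x j - x i)) * (∏ j, ∏ i ∈ Finset.Iio j, (z i - z j)) /
        ∏ i, ∏ j, (x i - z j)) * (α * ((∏ i, (a - x i)) / ∏ j, (a - z j)) +
          β * ((∏ i, (b - x i)) / ∏ j, (b - z j))) := by
  -- This is the cost of moving row Q to the last place. The minors along that row are unchanged, so
  -- the expansion compares with two Cauchy determinants.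
  have hsign : ∀ p : ℕ, (-1 : ℂ) ^ ((Q : ℕ) + p) = (-1) ^ (m - (Q : ℕ)) * (-1) ^ (m + p) := by
    intro p
    have hQm : (Q : ℕ) ≤ m := Nat.lt_succ_iff.mp Q.isLt
    obtain ⟨k, hk⟩ := Nat.exists_eq_add_of_le hQm
    rw [← pow_add, show m - (Q : ℕ) + (m + p) = 2 * k + (Q + p) by omega, pow_add _ (2 * k),
      pow_mul]
    norm_num
  have hexp : ∀ c : ℂ, (Matrix.of fun i j => 1 / ((Fin.snoc x c : Fin (m + 1) → ℂ) i - z j)).det =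
      ∑ p : Fin (m + 1), (-1) ^ (m + (p : ℕ)) * (1 / (c - z p)) *
        (M.submatrix Q.succAbove p.succAbove).det := by
    intro c
    rw [Matrix.det_succ_row _ (Fin.last m)]
    refine Finset.sum_congr rfl fun p _ => ?_
    simp only [Matrix.of_apply, Fin.snoc_last, Fin.val_last]
    congr 2
    ext i j
    simp [hrow]
  have ha := hexp a
  have hb := hexp b
  rw [det_cauchy_snoc x a z hz hxz haz] at ha
  rw [det_cauchy_snoc x b z hz hxz hbz] at hb
  rw [Matrix.det_succ_row _ Q, mul_assoc, mul_add, mul_left_comm _ α, mul_left_comm _ β, ha, hb,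
    mul_add, Finset.mul_sum, Finset.mul_sum, Finset.mul_sum, Finset.mul_sum,
    ← Finset.sum_add_distrib]
  refine Finset.sum_congr rfl fun p _ => ?_
  rw [hsign, hQ]
  ring

/-! ### Rows over complex critical points and the asymptotics outside the bulk -/

theorem RationalPotential.z_injective {n : ℕ} (V : RationalPotential n) :
    Function.Injective V.z := fun _ _ h => V.z_re_strictMono.injective (congrArg re h)

namespace Contour

variable {n : ℕ} {V : RationalPotential n} {J : Set ℝ} {W : Contour V J}

theorem OverComplexPoint.isSteepAt (h : W.OverComplexPoint) {l : ℝ} (hl : l ∈ J) :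
    W.IsSteepAt 0 l :=
  ⟨(h l hl).1.2.2, (h l hl).2.1, (h l hl).2.2.1⟩

theorem norm_saddleAt {t₀ ε l : ℝ} (h : W.IsSteepAt t₀ l) :
    ‖W.saddleAt t₀ ε l‖ = Real.exp (W.R l t₀ / ε) / √‖deriv V.u (W.γ l t₀)‖ := by
  have h1 := norm_pos_iff.mpr h.deriv_ne_zero
  rw [saddleAt, norm_div, norm_mul, norm_div, Complex.norm_exp, Complex.div_ofReal_re,
    Complex.norm_real, Complex.norm_real, norm_norm, div_self h1.ne', one_mul, Real.norm_eq_abs,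
    abs_of_nonneg (Real.sqrt_nonneg _), R]

theorem saddleAt_ne_zero {t₀ ε l : ℝ} (h : W.IsSteepAt t₀ l) : W.saddleAt t₀ ε l ≠ 0 := by
  have h1 := norm_pos_iff.mpr h.deriv_u_ne_zero
  rw [← norm_pos_iff, norm_saddleAt h]
  positivity

variable (W)

theorem continuousOn_deriv_u {K : Set ℝ} (hKJ : K ⊆ J) (t : ℝ) :
    ContinuousOn (fun l => deriv V.u (W.γ l t)) K :=
  V.continuousOn_deriv_u.comp ((continuousOn_slice W.continuousOn t).mono hKJ)
    fun _ hl => W.γ_mem_regular (hKJ hl) t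

theorem continuousOn_inv_sub {K : Set ℝ} (hKJ : K ⊆ J) (t : ℝ) (p : Fin (n + 1)) :
    ContinuousOn (fun l => 1 / (W.γ l t - V.z p)) K :=
  ContinuousOn.div continuousOn_const
    (((continuousOn_slice W.continuousOn t).mono hKJ).sub continuousOn_const)
    fun _ hl => sub_ne_zero.mpr (W.γ_mem_regular (hKJ hl) t p).1

variable {W}

/-- A row over one complex critical point, divided by its leading factor. -/
theorem OverComplexPoint.exists_row_bound (hW : W.OverComplexPoint) (hends : W.EndsInValleys)
    {K : Set ℝ} (hKJ : K ⊆ J) (hK : IsCompact K) :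
    ∃ C : ℝ, ∃ ε₀ > 0, ∀ l ∈ K, ∀ ε : ℝ, 0 < ε → ε ≤ ε₀ → ∀ p,
      ‖W.integral ε l p / ((√(2 * Real.pi * ε) : ℝ) * W.saddleFactor ε l) -
        1 / (W.γ l 0 - V.z p)‖ ≤ C * ε := by
  obtain ⟨C, ε₀, hε₀, hC⟩ := W.exists_integral_bound hKJ hK hends {0} (R₀ := fun l => W.R l 0)
    ((continuousOn_slice W.continuousOn_R 0).mono hKJ)
    (by
      intro t ht l hl
      rw [Finset.mem_singleton.mp ht]
      exact hW.isSteepAt (hKJ hl))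
    (by
      intro t ht l _
      rw [Finset.mem_singleton.mp ht])
    (fun l hl t ht => (hW l (hKJ hl)).2.2.2 t (by simpa using ht))
  obtain ⟨D, hD, hDK⟩ := exists_pos_forall_norm_le_of_isCompact hK (W.continuousOn_deriv_u hKJ 0)
  refine ⟨|C| * √D, ε₀, hε₀, fun l hl ε hε hle p => ?_⟩
  have h := hC l hl ε hε hle p
  rw [Finset.sum_singleton] at h
  have hst := hW.isSteepAt (hKJ hl)
  have hs0 : (√(2 * Real.pi * ε) : ℝ) ≠ 0 := by positivity
  have hs0' : ((√(2 * Real.pi * ε) : ℝ) : ℂ) ≠ 0 := by exact_mod_cast hs0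
  have hF := saddleAt_ne_zero (ε := ε) hst
  have hF' : W.saddleFactor ε l = W.saddleAt 0 ε l := rfl
  have hnum : W.integral ε l p / ((√(2 * Real.pi * ε) : ℝ) * W.saddleFactor ε l) -
      1 / (W.γ l 0 - V.z p) = (W.integral ε l p - (√(2 * Real.pi * ε) : ℝ) *
        (W.saddleAt 0 ε l / (W.γ l 0 - V.z p))) /
          ((√(2 * Real.pi * ε) : ℝ) * W.saddleAt 0 ε l) := by
    rw [hF']
    have := sub_ne_zero.mpr (W.γ_mem_regular (hKJ hl) 0 p).1
    field_simp
  rw [hnum, norm_div, norm_mul, norm_saddleAt hst, Complex.norm_real, Real.norm_eq_abs,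
    abs_of_nonneg (Real.sqrt_nonneg _)]
  have hu := norm_pos_iff.mpr hst.deriv_u_ne_zero
  rw [div_le_iff₀ (by positivity)]
  refine h.trans ?_
  have h1 : √ε ≤ √(2 * Real.pi * ε) := by
    apply Real.sqrt_le_sqrt
    nlinarith [Real.pi_gt_three]
  have h2 : √‖deriv V.u (W.γ l 0)‖ ≤ √D := Real.sqrt_le_sqrt (hDK l hl)
  have h3 : 1 ≤ √D / √‖deriv V.u (W.γ l 0)‖ := (one_le_div (by positivity)).mpr h2
  calc C * (ε * √ε) * Real.exp (W.R l 0 / ε)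
      ≤ |C| * (ε * √(2 * Real.pi * ε)) * Real.exp (W.R l 0 / ε) * 1 := by
        rw [mul_one]
        gcongr
        exact le_abs_self C
    _ ≤ |C| * (ε * √(2 * Real.pi * ε)) * Real.exp (W.R l 0 / ε) *
        (√D / √‖deriv V.u (W.γ l 0)‖) := by gcongr
    _ = _ := by ring

end Contour

theorem rpow_half_eq_sqrt_pow {x : ℝ} (hx : 0 ≤ x) (n : ℕ) :
    x ^ (((n : ℝ) + 1) / 2) = √x ^ (n + 1) := by
  rw [Real.sqrt_eq_rpow, ← Real.rpow_natCast, ← Real.rpow_mul hx]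
  congr 1
  push_cast
  ring

section Suitable

variable {n : ℕ} {V : RationalPotential n} {J : Set ℝ}
  {N : ℝ → ℝ → Matrix (Fin (n + 1)) (Fin (n + 1)) ℂ} {W : Fin (n + 1) → Contour V J}

/-- The modified Evans function after division of each row by a scale. -/
theorem evans_eq_prod_mul_det {ε l : ℝ}
    (h : ∀ m p, (N ε l * V.A ε l) m p = (W m).integral ε l p) (s : Fin (n + 1) → ℂ)
    (hs : ∀ m, s m ≠ 0) :
    evans V N ε l = (∏ m, s m) * (Matrix.of fun m p => (W m).integral ε l p / s m).det := by
  rw [← Matrix.det_mul_column, evans]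
  congr 1
  ext m p
  rw [h, Matrix.of_apply, Matrix.of_apply, mul_div_cancel₀ _ (hs m)]

theorem leadingU_ne_zero (hS : IsSuitableOutside N W) {l : ℝ} (hl : l ∈ J) {ε : ℝ} (hε : 0 < ε) :
    leadingU W ε l ≠ 0 := by
  rw [leadingU]
  refine mul_ne_zero (mul_ne_zero ?_ ?_) ?_
  · exact_mod_cast (Real.rpow_pos_of_pos (by positivity) _).ne'
  · exact Finset.prod_ne_zero_iff.mpr fun m _ =>
      Contour.saddleAt_ne_zero ((hS.overPoint m).isSteepAt hl)
  · exact det_cauchy_ne_zero (hS.injective l hl) V.z_injective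
      fun m p => ((W m).γ_mem_regular hl 0 p).1

/-- Asymptotics of the modified Evans function outside the bulk. -/
theorem evans_asymptotics_outside (hS : IsSuitableOutside N W) {K : Set ℝ} (hKJ : K ⊆ J)
    (hK : IsCompact K) :
    ∃ C : ℝ, ∃ ε₀ > 0, ∀ l ∈ K, ∀ ε, 0 < ε → ε < ε₀ →
      ∃ e : ℂ, ‖e‖ ≤ C * ε ∧ evans V N ε l = leadingU W ε l * (1 + e) := by
  obtain ⟨ε₁, hε₁, hmod⟩ := hS.modification K hKJ hK
  choose C ε₂ hε₂ hrow using fun m => (hS.overPoint m).exists_row_bound (hS.ends m) hKJ hK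
  choose B hB hBK using fun m => fun p =>
    exists_pos_forall_norm_le_of_isCompact hK ((W m).continuousOn_inv_sub hKJ 0 p)
  obtain ⟨C', hC'⟩ := exists_det_sub_bound (n + 1) (∑ m, ∑ p, B m p) (∑ m, |C m|)
  obtain ⟨d, hd, hdK⟩ := exists_pos_forall_le_of_isCompact hK
    (f := fun l => ‖(Matrix.of fun m p => 1 / ((W m).γ l 0 - V.z p)).det‖)
    (by
      refine ContinuousOn.norm ?_
      simp only [Matrix.det_apply]
      refine continuousOn_finsetSum _ fun σ _ => ContinuousOn.const_smul
        (continuousOn_finsetProd _ fun i _ => ?_) _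
      exact (W (σ i)).continuousOn_inv_sub hKJ 0 i)
    (fun l hl => norm_pos_iff.mpr (det_cauchy_ne_zero (hS.injective l (hKJ hl)) V.z_injective
      fun m p => ((W m).γ_mem_regular (hKJ hl) 0 p).1))
  set ε₃ := Finset.univ.inf' Finset.univ_nonempty ε₂
  have hε₃ : 0 < ε₃ := (Finset.lt_inf'_iff _).mpr fun m _ => hε₂ m
  refine ⟨|C'| / d, min (min ε₁ ε₃) 1, by positivity, fun l hl ε hε hlt => ?_⟩
  have hl1 : ε ≤ ε₁ := hlt.le.trans ((min_le_left _ _).trans (min_le_left _ _))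
  have hl3 : ε ≤ ε₃ := hlt.le.trans ((min_le_left _ _).trans (min_le_right _ _))
  have hl4 : ε ≤ 1 := hlt.le.trans (min_le_right _ _)
  set Bm : Matrix (Fin (n + 1)) (Fin (n + 1)) ℂ :=
    Matrix.of fun m p => 1 / ((W m).γ l 0 - V.z p) with hBm
  have hs0 : ((√(2 * Real.pi * ε) : ℝ) : ℂ) ≠ 0 := by
    have : √(2 * Real.pi * ε) ≠ 0 := by positivity
    exact_mod_cast this
  set s : Fin (n + 1) → ℂ := fun m => (√(2 * Real.pi * ε) : ℝ) * (W m).saddleFactor ε l with hs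
  have hsm : ∀ m, s m ≠ 0 := fun m =>
    mul_ne_zero hs0 (Contour.saddleAt_ne_zero ((hS.overPoint m).isSteepAt (hKJ hl)))
  have hev := evans_eq_prod_mul_det (hmod l hl ε hε hl1).2 s hsm
  set M : Matrix (Fin (n + 1)) (Fin (n + 1)) ℂ :=
    Matrix.of fun m p => (W m).integral ε l p / s m with hM
  have hdet : ‖M.det - Bm.det‖ ≤ C' * ε := by
    refine hC' M Bm ε hε hl4 (fun m p => ?_) (fun m p => ?_)
    · refine (hBK m p l hl).trans ?_
      exact (Finset.single_le_sum (f := B m) (fun q _ => (hB m q).le) (Finset.mem_univ p)).trans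
        (Finset.single_le_sum (f := fun m => ∑ p, B m p)
          (fun m _ => Finset.sum_nonneg fun q _ => (hB m q).le) (Finset.mem_univ m))
    · refine (hrow m l hl ε hε (hl3.trans (Finset.inf'_le _ (Finset.mem_univ m))) p).trans ?_
      gcongr
      exact (le_abs_self _).trans
        (Finset.single_le_sum (f := fun m => |C m|) (fun q _ => abs_nonneg _) (Finset.mem_univ m))
  have hdl := hdK l hl
  have hB0 : Bm.det ≠ 0 := norm_pos_iff.mp (hd.trans_le hdl)
  -- A relative error is available here because the limiting Cauchy determinant is at least d in
  -- modulus on K.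
  refine ⟨(M.det - Bm.det) / Bm.det, ?_, ?_⟩
  · rw [norm_div, div_le_iff₀ (hd.trans_le hdl)]
    calc ‖M.det - Bm.det‖ ≤ |C'| * ε := hdet.trans (by gcongr; exact le_abs_self _)
      _ = |C'| / d * ε * d := by field_simp
      _ ≤ |C'| / d * ε * ‖Bm.det‖ := by gcongr
  · rw [hev, leadingU, rpow_half_eq_sqrt_pow (by positivity), hs, Finset.prod_mul_distrib,
      Finset.prod_const, Finset.card_univ, Fintype.card_fin, ofReal_pow, ← hBm]
    field_simp
    ring

end Suitable

/-! ### Level sets of the potential and the phase integral -/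

namespace RationalPotential

variable {n : ℕ} (V : RationalPotential n)

theorem ofReal_mem_regular (x : ℝ) : (x : ℂ) ∈ V.regular := by
  intro p
  have := V.z_im_pos p
  constructor
  · intro h
    rw [← h, ofReal_im] at this
    exact lt_irrefl _ this
  · intro h
    have h2 := congrArg im h
    rw [ofReal_im, conj_im] at h2
    linarith

theorem continuous_u0 : Continuous V.u0 := by
  have h : ContinuousOn V.u V.regular := V.differentiableOn_u.continuousOn
  have h2 : Continuous fun x : ℝ => V.u x :=
    continuousOn_univ.mp (h.comp (by fun_prop) fun x _ => V.ofReal_mem_regular x)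
  exact Complex.continuous_re.comp h2

theorem tendsto_u_cobounded : Tendsto V.u (Bornology.cobounded ℂ) (𝓝 0) := by
  have h : ∀ c w : ℂ, Tendsto (fun x => c / (x - w)) (Bornology.cobounded ℂ) (𝓝 0) := by
    intro c w
    have := (tendsto_inv₀_cobounded.comp (tendsto_sub_const_cobounded w)).const_mul c
    simpa [div_eq_mul_inv] using this
  have := tendsto_finsetSum Finset.univ fun p (_ : p ∈ Finset.univ) =>
    (h (V.c p) (V.z p)).add (h (conj (V.c p)) (conj (V.z p)))
  simp only [add_zero, Finset.sum_const_zero] at this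
  exact this

theorem tendsto_u0_atTop : Tendsto V.u0 atTop (𝓝 0) := by
  have h := (V.tendsto_u_cobounded.comp (RCLike.tendsto_ofReal_atTop_cobounded ℂ))
  exact (Complex.continuous_re.tendsto 0).comp h

theorem tendsto_u0_atBot : Tendsto V.u0 atBot (𝓝 0) := by
  have h := (V.tendsto_u_cobounded.comp (RCLike.tendsto_ofReal_atBot_cobounded ℂ))
  exact (Complex.continuous_re.tendsto 0).comp h

end RationalPotential

/-- The Klaus–Shaw condition concerns open half-lines, and continuity adds the peak. An intermediate
point restores the strictness lost in the limit. -/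
theorem strictMonoOn_Iic_of_Iio {g : ℝ → ℝ} {c : ℝ} (hg : Continuous g)
    (h : StrictMonoOn g (Iio c)) : StrictMonoOn g (Iic c) := by
  have hle : ∀ w < c, g w ≤ g c := by
    intro w hw
    refine ge_of_tendsto (hg.continuousAt.tendsto.mono_left nhdsWithin_le_nhds :
      Tendsto g (𝓝[<] c) (𝓝 (g c))) ?_
    filter_upwards [Ioo_mem_nhdsLT hw] with v hv
    exact (h hw hv.2 hv.1).le
  intro x _ y hy hxy
  rcases (mem_Iic.mp hy).lt_or_eq with hyc | rfl
  · exact h (hxy.trans hyc) hyc hxy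
  · obtain ⟨w, hxw, hwy⟩ := exists_between hxy
    exact (h hxy hwy hxw).trans_le (hle w hwy)

theorem strictAntiOn_Ici_of_Ioi {g : ℝ → ℝ} {c : ℝ} (hg : Continuous g)
    (h : StrictAntiOn g (Ioi c)) : StrictAntiOn g (Ici c) := by
  have h1 : StrictMonoOn (fun x => g (-x)) (Iio (-c)) := fun x hx y hy hxy =>
    h (lt_neg_of_lt_neg (mem_Iio.mp hy) : c < -y) (lt_neg_of_lt_neg (mem_Iio.mp hx) : c < -x)
      (neg_lt_neg hxy)
  have h2 := strictMonoOn_Iic_of_Iio (hg.comp continuous_neg) h1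
  intro x hx y hy hxy
  have := h2 (show -y ≤ -c from neg_le_neg (mem_Ici.mp hy))
    (show -x ≤ -c from neg_le_neg (mem_Ici.mp hx)) (neg_lt_neg hxy)
  simpa using this

/-- A function that increases up to a point and decreases afterwards, with limits `0`, has
intervals as superlevel sets. -/
theorem exists_superlevel_eq_Ioo {g : ℝ → ℝ} {c s : ℝ} (hg : Continuous g)
    (hmono : StrictMonoOn g (Iic c)) (hanti : StrictAntiOn g (Ici c))
    (hbot : Tendsto g atBot (𝓝 0)) (htop : Tendsto g atTop (𝓝 0)) (hs : 0 < s) (hsc : s < g c) :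
    ∃ a b, a < b ∧ {x | g x = s} = {a, b} ∧ {x | s < g x} = Ioo a b := by
  obtain ⟨y, hy, hyc⟩ := ((hbot.eventually (gt_mem_nhds hs)).and (eventually_le_atBot c)).exists
  obtain ⟨w, hw, hcw⟩ := ((htop.eventually (gt_mem_nhds hs)).and (eventually_ge_atTop c)).exists
  obtain ⟨a, ha, hga⟩ := intermediate_value_Icc hyc hg.continuousOn ⟨hy.le, hsc.le⟩
  obtain ⟨b, hb, hgb⟩ := intermediate_value_Icc' hcw hg.continuousOn ⟨hw.le, hsc.le⟩
  have hac : a < c := lt_of_le_of_ne ha.2 fun h => by rw [h] at hga; exact hsc.ne' hga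
  have hcb : c < b := lt_of_le_of_ne hb.1 fun h => by rw [← h] at hgb; exact hsc.ne' hgb
  have key : ∀ x, (x < a → g x < s) ∧ (a < x → x < b → s < g x) ∧ (b < x → g x < s) := by
    intro x
    refine ⟨fun h => ?_, fun h1 h2 => ?_, fun h => ?_⟩
    · rw [← hga]; exact hmono (h.trans hac).le hac.le h
    · rcases le_total x c with h | h
      · rw [← hga]; exact hmono hac.le h h1
      · rw [← hgb]; exact hanti h hcb.le h2
    · rw [← hgb]; exact hanti hcb.le (hcb.trans h).le h
  refine ⟨a, b, hac.trans hcb, ?_, ?_⟩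
  · ext x
    obtain ⟨k1, k2, k3⟩ := key x
    simp only [mem_ofPred_eq, mem_insert_iff, mem_singleton_iff]
    constructor
    · intro hx
      rcases lt_trichotomy x a with h | h | h
      · exact absurd hx (k1 h).ne
      · exact Or.inl h
      · rcases lt_trichotomy x b with h' | h' | h'
        · exact absurd hx (k2 h h').ne'
        · exact Or.inr h'
        · exact absurd hx (k3 h').ne
    · rintro (rfl | rfl)
      · exact hga
      · exact hgb
  · ext x
    obtain ⟨k1, k2, k3⟩ := key x
    simp only [mem_ofPred_eq, mem_Ioo]
    constructor
    · intro hx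
      constructor
      · by_contra hn
        rcases (not_lt.mp hn).lt_or_eq with h | h
        · exact lt_asymm hx (k1 h)
        · rw [h, hga] at hx; exact lt_irrefl _ hx
      · by_contra hn
        rcases (not_lt.mp hn).lt_or_eq with h | h
        · exact lt_asymm hx (k3 h)
        · rw [← h, hgb] at hx; exact lt_irrefl _ hx
    · exact fun h => k2 h.1 h.2

namespace RationalPotential

variable {n : ℕ} {V : RationalPotential n}

/-- A positive Klaus–Shaw potential increases up to its maximum point and decreases afterwards. -/
theorem IsPositiveKlausShaw.exists_max (hV : V.IsPositiveKlausShaw) :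
    ∃ c, StrictMonoOn V.u0 (Iic c) ∧ StrictAntiOn V.u0 (Ici c) := by
  obtain ⟨⟨c, hl, hr⟩, hpos⟩ := hV
  refine ⟨c, strictMonoOn_Iic_of_Iio V.continuous_u0 ?_,
    strictAntiOn_Ici_of_Ioi V.continuous_u0 ?_⟩
  -- If u₀ decreased on the left half-line, its value at c - 1 would be at most its limit 0 at -∞,
  -- against positivity.
  · refine hl.resolve_right fun h => ?_
    have h1 : V.u0 (c - 1) ≤ 0 := by
      refine ge_of_tendsto V.tendsto_u0_atBot ?_
      filter_upwards [eventually_lt_atBot (c - 1)] with y hy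
      exact (h (show y < c by linarith) (show c - 1 < c by linarith) hy).le
    exact (hpos _).not_ge h1
  · refine hr.resolve_left fun h => ?_
    have h1 : V.u0 (c + 1) ≤ 0 := by
      refine ge_of_tendsto V.tendsto_u0_atTop ?_
      filter_upwards [eventually_gt_atTop (c + 1)] with y hy
      exact (h (show c < c + 1 by linarith) (show c < y by linarith) hy).le
    exact (hpos _).not_ge h1

theorem IsPositiveKlausShaw.exists_le_iSup (hV : V.IsPositiveKlausShaw) :
    ∃ c, StrictMonoOn V.u0 (Iic c) ∧ StrictAntiOn V.u0 (Ici c) ∧ (⨆ x, V.u0 x) = V.u0 c ∧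
      ∀ x, V.u0 x ≤ V.u0 c := by
  obtain ⟨c, h1, h2⟩ := hV.exists_max
  have hle : ∀ x, V.u0 x ≤ V.u0 c := by
    intro x
    rcases le_total x c with h | h
    · exact h1.monotoneOn h (le_refl c) h
    · exact h2.antitoneOn (le_refl c) h h
  exact ⟨c, h1, h2, le_antisymm (ciSup_le hle)
    (le_ciSup ⟨V.u0 c, by rintro _ ⟨x, rfl⟩; exact hle x⟩ c), hle⟩

theorem IsPositiveKlausShaw.neg_of_mem_bulk (hV : V.IsPositiveKlausShaw) {l : ℝ}
    (hl : l ∈ V.bulk) : l < 0 := by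
  have h : 0 ≤ ⨅ x, V.u0 x := Real.iInf_nonneg fun x => (hV.2 x).le
  linarith [hl.2]

/-- Unimodality and the limits 0 at ±∞ leave exactly two points at each height strictly between 0
and the maximum. They are the infimum and supremum that define x_±. -/
theorem IsPositiveKlausShaw.level_sets (hV : V.IsPositiveKlausShaw) {l : ℝ}
    (hl : -(⨆ x, V.u0 x) < l) (hl0 : l < 0) :
    V.xMinus l < V.xPlus l ∧ {x | V.u0 x = -l} = {V.xMinus l, V.xPlus l} ∧
      {x | -l < V.u0 x} = Ioo (V.xMinus l) (V.xPlus l) := by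
  obtain ⟨c, h1, h2, h3, -⟩ := hV.exists_le_iSup
  rw [h3] at hl
  obtain ⟨a, b, hab, he, hs⟩ := exists_superlevel_eq_Ioo V.continuous_u0 h1 h2
    V.tendsto_u0_atBot V.tendsto_u0_atTop (s := -l) (by linarith) (by linarith)
  have ea : V.xMinus l = a := by
    rw [xMinus, he]; exact ((isLeast_pair).csInf_eq).trans (min_eq_left hab.le)
  have eb : V.xPlus l = b := by
    rw [xPlus, he]; exact ((isGreatest_pair).csSup_eq).trans (max_eq_right hab.le)
  rw [ea, eb]
  exact ⟨hab, he, hs⟩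

/-- For real x both logarithms have arguments with real part Im z_p > 0, away from the principal
cut. -/
theorem hasDerivAt_f (V : RationalPotential n) (x : ℝ) : HasDerivAt V.f (V.u x) x := by
  unfold f u
  refine HasDerivAt.fun_sum fun p _ => ?_
  have hz := V.z_im_pos p
  have hlin : ∀ κ w : ℂ, HasDerivAt (fun y : ℂ => κ * (y - w)) κ x := fun κ w => by
    simpa using ((hasDerivAt_id (x : ℂ)).sub_const w).const_mul κ
  have h1 := ((((hlin I (V.z p)).clog (Or.inl (by simpa using hz))).add_const
    (Real.pi * I / 2)).const_mul (V.c p)).add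
    ((((hlin (-I) (conj (V.z p))).clog (Or.inl (by simpa using hz))).sub_const
    (Real.pi * I / 2)).const_mul (conj (V.c p)))
  refine h1.congr_deriv ?_
  have e1 := sub_ne_zero.mpr (V.ofReal_mem_regular x p).1
  have e2 := sub_ne_zero.mpr (V.ofReal_mem_regular x p).2
  have hI := I_ne_zero
  field_simp

theorem hasDerivAt_h (V : RationalPotential n) (l x : ℝ) :
    HasDerivAt (fun y : ℝ => V.h l y) ((l + V.u0 x : ℝ) : ℂ) x := by
  have h := (((hasDerivAt_id (x : ℂ)).const_mul (l : ℂ)).add (V.hasDerivAt_f x)).comp_ofReal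
  refine h.congr_deriv ?_
  rw [V.u_ofReal]
  push_cast
  ring

/-- `h` is real on the real axis. -/
theorem h_ofReal_im (V : RationalPotential n) (l x : ℝ) : (V.h l x).im = 0 := by
  rw [← conj_eq_iff_im]
  simp only [h, f, map_add, map_mul, map_sum, conj_ofReal]
  congr 1
  refine Finset.sum_congr rfl fun p _ => ?_
  have hz := V.z_im_pos p
  have harg : ∀ w : ℂ, 0 < w.re → w.arg ≠ Real.pi := fun w hw h => by
    rw [arg_eq_pi_iff] at h
    linarith [h.1]
  have h1 : conj (log (I * (x - V.z p))) = log (-I * (x - conj (V.z p))) := by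
    rw [← log_conj _ (harg _ (by simpa using hz))]
    simp
  have h2 : conj (log (-I * (x - conj (V.z p)))) = log (I * (x - V.z p)) := by
    rw [← h1, conj_conj]
  simp only [map_sub, map_div₀, map_mul, conj_ofReal, conj_I, conj_conj, map_ofNat, h1, h2]
  ring

/-- The difference of the values of `h` at the real critical points as an integral over the
spectral parameter. -/
theorem IsPositiveKlausShaw.h_sub_h (hV : V.IsPositiveKlausShaw) {l : ℝ}
    (hl : -(⨆ x, V.u0 x) < l) (hl0 : l < 0) :
    V.h l (V.xPlus l) - V.h l (V.xMinus l) =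
      ((∫ s in (-(⨆ x, V.u0 x))..l, (V.xPlus s - V.xMinus s) : ℝ) : ℂ) := by
  obtain ⟨hab, -, hs⟩ := hV.level_sets hl hl0
  obtain ⟨c, -, -, hsup, hmax⟩ := hV.exists_le_iSup
  set m := ⨆ x, V.u0 x with hm
  have hint : ∫ x in (V.xMinus l)..(V.xPlus l), ((l + V.u0 x : ℝ) : ℂ) =
      V.h l (V.xPlus l) - V.h l (V.xMinus l) := by
    have hc := V.continuous_u0
    exact intervalIntegral.integral_eq_sub_of_hasDerivAt (fun x _ => V.hasDerivAt_h l x)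
      (Continuous.intervalIntegrable (by fun_prop) _ _)
  rw [← hint, intervalIntegral.integral_ofReal]
  congr 1
  let F : ℝ → ℝ := indicator (Ioo (V.xMinus l) (V.xPlus l)) fun x => l + V.u0 x
  have hpos : ∀ x ∈ Ioo (V.xMinus l) (V.xPlus l), 0 < l + V.u0 x := by
    intro x hx
    rw [← hs] at hx
    have : -l < V.u0 x := hx
    linarith
  have hF0 : ∀ x, 0 ≤ F x := fun x => indicator_nonneg (fun x hx => (hpos x hx).le) x
  have hFint : Integrable F := by
    have hc := V.continuous_u0
    have : ContinuousOn (fun x => l + V.u0 x) (Icc (V.xMinus l) (V.xPlus l)) := by fun_prop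
    exact (this.integrableOn_Icc.mono_set Ioo_subset_Icc_self).integrable_indicator
      measurableSet_Ioo
  have e1 : ∫ x in (V.xMinus l)..(V.xPlus l), (l + V.u0 x) = ∫ x, F x := by
    rw [intervalIntegral.integral_of_le hab.le, integral_Ioc_eq_integral_Ioo,
      integral_indicator measurableSet_Ioo]
  have hset : ∀ t > 0, {x | t < F x} = {x | -(l - t) < V.u0 x} := by
    intro t ht
    ext x
    simp only [mem_ofPred_eq, F]
    by_cases hx : x ∈ Ioo (V.xMinus l) (V.xPlus l)
    · rw [indicator_of_mem hx]
      constructor <;> intro h <;> linarith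
    · rw [indicator_of_notMem hx]
      rw [← hs] at hx
      have : ¬ -l < V.u0 x := hx
      constructor <;> intro h
      · linarith
      · exact absurd (by linarith) this
  -- Layer cake: the area under the positive part of l + u₀ is the integral over t of the lengths of
  -- {u₀ > t - l}. These are intervals of length x_+ - x_- at l - t, and the substitution s = l - t
  -- finishes.
  rw [e1, hFint.integral_eq_integral_meas_lt (Eventually.of_forall hF0)]
  have hzero : ∀ t ∈ Ioi (0 : ℝ) \ Ioo 0 (l + m), volume.real {x | t < F x} = 0 := by
    intro t ht
    have ht0 : 0 < t := ht.1
    have htm : l + m ≤ t := by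
      by_contra hn
      exact ht.2 ⟨ht0, not_le.mp hn⟩
    have : {x | t < F x} = ∅ := by
      rw [hset t ht0]
      ext x
      simp only [mem_ofPred_eq, mem_empty_iff_false, iff_false, not_lt]
      linarith [hmax x]
    rw [this, measureReal_empty]
  rw [setIntegral_eq_of_subset_of_forall_sdiff_eq_zero measurableSet_Ioi
    (fun t ht => ht.1 : Ioo 0 (l + m) ⊆ Ioi 0) hzero]
  have hval : ∀ t ∈ Ioo 0 (l + m), volume.real {x | t < F x} =
      V.xPlus (l - t) - V.xMinus (l - t) := by
    intro t ht
    obtain ⟨hab', -, hs'⟩ := hV.level_sets (l := l - t) (by linarith [ht.2]) (by linarith [ht.1])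
    rw [hset t ht.1, hs', Real.volume_real_Ioo_of_le hab'.le]
  rw [setIntegral_congr_fun measurableSet_Ioo hval, ← integral_Ioc_eq_integral_Ioo,
    ← intervalIntegral.integral_of_le (by linarith),
    intervalIntegral.integral_comp_sub_left (fun s => V.xPlus s - V.xMinus s) l]
  congr 1
  · ring
  · ring

end RationalPotential

/-! ### Factorization of λ + u₀ and the derivative at the real critical points -/

open Polynomial in
/-- A polynomial with as many distinct roots as its degree is determined by the roots and the
leading coefficient. -/
theorem eq_C_mul_prod_X_sub_C_of_roots {ι : Type*} [Fintype ι] {root : ι → ℂ}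
    (hroot : Function.Injective root) {pole : ι → ℂ} {P R : ℂ[X]} {a : ℂ}
    (hP : P = C a * ∏ i, (X - C (pole i)) + R) (hR : R ∈ degreeLT ℂ (Fintype.card ι))
    (heval : ∀ i, P.eval (root i) = 0) : P = C a * ∏ i, (X - C (root i)) := by
  refine Polynomial.eq_of_degree_sub_lt_of_eval_index_eq (s := Finset.univ) (v := root)
    hroot.injOn ?_ (fun i _ => ?_)
  · rw [Finset.card_univ, ← mem_degreeLT, hP]
    have e : C a * ∏ i, (X - C (pole i)) + R - C a * ∏ i, (X - C (root i)) =
        a • (∏ i, (X - C (pole i)) - ∏ i, (X - C (root i))) + R := by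
      rw [smul_eq_C_mul]; ring
    rw [e]
    refine Submodule.add_mem _ (Submodule.smul_mem _ _ ?_) hR
    rw [mem_degreeLT]
    have hm1 : (∏ i, (X - C (pole i))).Monic := monic_prod_X_sub_C pole _
    have hm2 : (∏ i, (X - C (root i))).Monic := monic_prod_X_sub_C root _
    have hd1 : (∏ i, (X - C (pole i))).degree = ((Fintype.card ι : ℕ) : WithBot ℕ) := by
      rw [degree_eq_natDegree hm1.ne_zero, natDegree_finsetProd_X_sub_C_eq_card, Finset.card_univ]
    have hd2 : (∏ i, (X - C (root i))).degree = ((Fintype.card ι : ℕ) : WithBot ℕ) := by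
      rw [degree_eq_natDegree hm2.ne_zero, natDegree_finsetProd_X_sub_C_eq_card, Finset.card_univ]
    rw [← hd1]
    exact degree_sub_lt_left (hd1.trans hd2.symm) hm1.ne_zero
      (hm1.leadingCoeff.trans hm2.leadingCoeff.symm)
  · rw [heval, eval_mul, eval_prod, Finset.prod_eq_zero (Finset.mem_univ i) (by simp), mul_zero]

namespace RationalPotential

variable {n : ℕ} (V : RationalPotential n)

theorem u_conj (x : ℂ) : V.u (conj x) = conj (V.u x) := by
  simp only [u, map_sum, map_add, map_div₀, map_sub, conj_conj]
  exact Finset.sum_congr rfl fun p _ => add_comm _ _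

open Polynomial in
/-- The numerator of `a + u`. -/
def numerator (a : ℂ) : ℂ[X] :=
  C a * ∏ i : Fin (n + 1) ⊕ Fin (n + 1), (X - C (Sum.elim V.z (fun p => conj (V.z p)) i)) +
    ∑ p, (C (V.c p) * (X - C (conj (V.z p))) + C (conj (V.c p)) * (X - C (V.z p))) *
      ∏ q ∈ Finset.univ.erase p, ((X - C (V.z q)) * (X - C (conj (V.z q))))

open Polynomial in
theorem eval_numerator (a : ℂ) {y : ℂ} (hy : y ∈ V.regular) :
    (V.numerator a).eval y = (a + V.u y) * ∏ p, ((y - V.z p) * (y - conj (V.z p))) := by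
  simp only [numerator, eval_add, eval_mul, eval_C, eval_prod, eval_sub, eval_X, eval_finsetSum,
    Fintype.prod_sum_type, Sum.elim_inl, Sum.elim_inr]
  rw [add_mul, Finset.prod_mul_distrib, u, ← Finset.prod_mul_distrib, Finset.sum_mul]
  congr 1
  refine Finset.sum_congr rfl fun p _ => ?_
  rw [← Finset.mul_prod_erase Finset.univ _ (Finset.mem_univ p)]
  have h1 := sub_ne_zero.mpr (hy p).1
  have h2 := sub_ne_zero.mpr (hy p).2
  field_simp

open Polynomial in
-- Each summand loses the two linear factors of one pole and gains a factor of degree at most 1, so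
-- its degree is at most 2n + 1. The coefficient of degree 2(n + 1) in the numerator is thus a.
theorem numerator_remainder_mem :
    ∑ p, (C (V.c p) * (X - C (conj (V.z p))) + C (conj (V.c p)) * (X - C (V.z p))) *
      ∏ q ∈ Finset.univ.erase p, ((X - C (V.z q)) * (X - C (conj (V.z q)))) ∈
        degreeLT ℂ (2 * (n + 1)) := by
  refine Submodule.sum_mem _ fun p _ => ?_
  rw [mem_degreeLT]
  have h1 : (C (V.c p) * (X - C (conj (V.z p))) + C (conj (V.c p)) * (X - C (V.z p))).natDegree ≤
      1 := by
    refine natDegree_add_le_of_degree_le ?_ ?_ <;>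
    · refine (natDegree_C_mul_le _ _).trans ?_
      rw [natDegree_X_sub_C]
  have h2 : (∏ q ∈ Finset.univ.erase p, ((X - C (V.z q)) * (X - C (conj (V.z q))))).natDegree ≤
      n * 2 := by
    refine (natDegree_prod_le _ _).trans ((Finset.sum_le_card_nsmul _ _ 2 fun q _ => ?_).trans ?_)
    · refine natDegree_mul_le.trans ?_
      rw [natDegree_X_sub_C, natDegree_X_sub_C]
    · rw [Finset.card_erase_of_mem (Finset.mem_univ p), Finset.card_univ, Fintype.card_fin]
      simp
  refine degree_le_natDegree.trans_lt ?_
  have := natDegree_mul_le_of_le h1 h2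
  exact_mod_cast (by omega)

/-- The roots of `a + u` account for the full degree of the numerator. -/
theorem add_u_eq_of_roots {a : ℂ} {ι : Type*} [Fintype ι] (e : ι ≃ Fin (n + 1) ⊕ Fin (n + 1))
    {root : ι → ℂ} (hroot : Function.Injective root) (hreg : ∀ i, root i ∈ V.regular)
    (hzero : ∀ i, a + V.u (root i) = 0) {y : ℂ} (hy : y ∈ V.regular) :
    a + V.u y = a * (∏ i, (y - root i)) / ∏ p, ((y - V.z p) * (y - conj (V.z p))) := by
  have hcard : Fintype.card ι = 2 * (n + 1) := by
    rw [Fintype.card_congr e]; simp; ring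
  have h := eq_C_mul_prod_X_sub_C_of_roots hroot (P := V.numerator a) (a := a)
    (pole := fun i => Sum.elim V.z (fun p => conj (V.z p)) (e i))
    (by rw [numerator]; congr 2; exact (Equiv.prod_comp e _).symm)
    (by rw [hcard]; exact V.numerator_remainder_mem)
    (fun i => by rw [V.eval_numerator a (hreg i), hzero, zero_mul])
  have h2 := congrArg (Polynomial.eval y) h
  rw [V.eval_numerator a hy] at h2
  rw [eq_div_iff, h2]
  · simp [Polynomial.eval_prod]
  · exact Finset.prod_ne_zero_iff.mpr fun p _ =>
      mul_ne_zero (sub_ne_zero.mpr (hy p).1) (sub_ne_zero.mpr (hy p).2)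

theorem upperCritical_subset_regular (l : ℝ) : V.upperCritical l ⊆ V.regular := by
  intro x hx p
  refine ⟨hx.2.1 p, fun h => ?_⟩
  have h1 := hx.1
  rw [h, conj_im] at h1
  linarith [V.z_im_pos p]

theorem conj_mem_regular {x : ℂ} (hx : x ∈ V.regular) : conj x ∈ V.regular := by
  intro p
  refine ⟨fun h => (hx p).2 ?_, fun h => (hx p).1 ?_⟩
  · rw [← h, conj_conj]
  · simpa using congrArg conj h

/-- The function `∏ (x - x_j) / ∏ (x - z_p)`. -/
def ratio (xs : Fin n → ℂ) (x : ℂ) : ℂ := (∏ j, (x - xs j)) / ∏ p, (x - V.z p)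

variable {V}

/-- The zeros of `l + u`, for `l` in the bulk, if `n` complex critical points are known. -/
def criticalRoot (V : RationalPotential n) (l : ℝ) (xs : Fin n → ℂ) :
    (Fin n ⊕ Fin n) ⊕ Fin 2 → ℂ :=
  Sum.elim (Sum.elim xs fun j => conj (xs j)) ![(V.xMinus l : ℂ), (V.xPlus l : ℂ)]

theorem criticalRoot_injective {l : ℝ} (hlt : V.xMinus l < V.xPlus l) {xs : Fin n → ℂ}
    (hinj : Function.Injective xs) (him : ∀ j, 0 < (xs j).im) :
    Function.Injective (V.criticalRoot l xs) := by
  refine Function.Injective.sumElim (Function.Injective.sumElim hinj ?_ ?_) ?_ ?_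
  · intro i j h
    exact hinj (star_injective h)
  · intro i j h
    have h1 := congrArg im h
    rw [conj_im] at h1
    linarith [him i, him j]
  · have hne : (V.xMinus l : ℂ) ≠ V.xPlus l := by exact_mod_cast hlt.ne
    intro i j h
    fin_cases i <;> fin_cases j <;> simp_all
  · intro i j h
    have h1 := congrArg im h
    have h2 : (![(V.xMinus l : ℂ), (V.xPlus l : ℂ)] j).im = 0 := by
      fin_cases j <;> simp
    rw [h2] at h1
    rcases i with i | i
    · exact (him i).ne' h1
    · rw [Sum.elim_inr, conj_im] at h1
      linarith [him i]

/-- Data describing all zeros of `l + u` for `l` in the bulk. -/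
structure IsFullCritical (V : RationalPotential n) (l : ℝ) (xs : Fin n → ℂ) : Prop where
  lt : V.xMinus l < V.xPlus l
  neg : l < 0
  minus : V.u0 (V.xMinus l) = -l
  plus : V.u0 (V.xPlus l) = -l
  injective : Function.Injective xs
  mem : ∀ j, xs j ∈ V.upperCritical l

namespace IsFullCritical

variable {l : ℝ} {xs : Fin n → ℂ}

theorem add_u_eq (h : V.IsFullCritical l xs) {y : ℂ} (hy : y ∈ V.regular) :
    l + V.u y = l * (y - V.xMinus l) * (y - V.xPlus l) *
      ((∏ j, (y - xs j)) * ∏ j, (y - conj (xs j))) /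
        ((∏ p, (y - V.z p)) * ∏ p, (y - conj (V.z p))) := by
  -- The count n + n + 2 = 2(n + 1): the known zeros exhaust the degree, so all are simple and there
  -- are no others.
  have e : (Fin n ⊕ Fin n) ⊕ Fin 2 ≃ Fin (n + 1) ⊕ Fin (n + 1) :=
    Fintype.equivOfCardEq (by simp; ring)
  have hzM : (l : ℂ) + V.u (V.xMinus l) = 0 := by rw [V.u_ofReal, h.minus]; simp
  have hzP : (l : ℂ) + V.u (V.xPlus l) = 0 := by rw [V.u_ofReal, h.plus]; simp
  have hreg : ∀ i, V.criticalRoot l xs i ∈ V.regular := by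
    rintro ((j | j) | j)
    · exact V.upperCritical_subset_regular l (h.mem j)
    · exact V.conj_mem_regular (V.upperCritical_subset_regular l (h.mem j))
    · fin_cases j
      · exact V.ofReal_mem_regular _
      · exact V.ofReal_mem_regular _
  have hzero : ∀ i, (l : ℂ) + V.u (V.criticalRoot l xs i) = 0 := by
    rintro ((j | j) | j)
    · exact (h.mem j).2.2
    · have := congrArg conj (h.mem j).2.2
      rw [map_add, conj_ofReal, map_zero, ← V.u_conj] at this
      exact this
    · fin_cases j
      · exact hzM
      · exact hzP
  rw [V.add_u_eq_of_roots e (criticalRoot_injective h.lt h.injective fun j => (h.mem j).1)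
    hreg hzero hy]
  simp only [criticalRoot, Fintype.prod_sum_type, Sum.elim_inl, Sum.elim_inr, Fin.prod_univ_two,
    Matrix.cons_val_zero, Matrix.cons_val_one, Finset.prod_mul_distrib]
  congr 1
  ring

/-- In the full factorization only the factors y - x_j can vanish in the upper half-plane. Thus the
product over all upper critical points in Ψ± runs over the saddles of the rows. -/
theorem upperCritical_eq (h : V.IsFullCritical l xs) : V.upperCritical l = range xs := by
  ext y
  constructor
  · intro hy
    have hreg := V.upperCritical_subset_regular l hy
    have h1 := h.add_u_eq hreg
    rw [hy.2.2, eq_comm, div_eq_zero_iff] at h1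
    have hz1 : ∏ p, (y - V.z p) ≠ 0 :=
      Finset.prod_ne_zero_iff.mpr fun p _ => sub_ne_zero.mpr (hreg p).1
    have hz2 : ∏ p, (y - conj (V.z p)) ≠ 0 :=
      Finset.prod_ne_zero_iff.mpr fun p _ => sub_ne_zero.mpr (hreg p).2
    have hr : ∀ x : ℝ, y - x ≠ 0 := fun x hx => by
      have := congrArg im hx
      simp only [sub_im, ofReal_im, sub_zero, zero_im] at this
      exact hy.1.ne' this
    have hc : ∏ j, (y - conj (xs j)) ≠ 0 :=
      Finset.prod_ne_zero_iff.mpr fun j _ => sub_ne_zero.mpr fun hx => by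
        have h2 := hy.1
        rw [hx, conj_im] at h2
        linarith [(h.mem j).1]
    have hl : (l : ℂ) ≠ 0 := by exact_mod_cast h.neg.ne
    have h3 := h1.resolve_right (mul_ne_zero hz1 hz2)
    have h4 : ∏ j, (y - xs j) = 0 := by
      by_contra hn
      exact mul_ne_zero (mul_ne_zero (mul_ne_zero hl (hr _)) (hr _)) (mul_ne_zero hn hc) h3
    obtain ⟨j, -, hj⟩ := Finset.prod_eq_zero_iff.mp h4
    exact ⟨j, (sub_eq_zero.mp hj).symm⟩
  · rintro ⟨j, rfl⟩
    exact h.mem j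

theorem ratio_ne_zero (h : V.IsFullCritical l xs) (x : ℝ) : V.ratio xs x ≠ 0 := by
  refine div_ne_zero (Finset.prod_ne_zero_iff.mpr fun j _ => sub_ne_zero.mpr fun hx => ?_)
    (Finset.prod_ne_zero_iff.mpr fun p _ => sub_ne_zero.mpr (V.ofReal_mem_regular x p).1)
  have := (h.mem j).1
  rw [← hx, ofReal_im] at this
  exact lt_irrefl _ this

theorem PsiMinus_eq (h : V.IsFullCritical l xs) (x : ℝ) :
    V.PsiMinus l x = (x - V.xMinus l) * V.ratio xs x := by
  rw [PsiMinus, h.upperCritical_eq, finprod_mem_range h.injective, finprod_eq_prod_of_fintype,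
    ratio, mul_div_assoc]

theorem PsiPlus_eq (h : V.IsFullCritical l xs) (x : ℝ) :
    V.PsiPlus l x = (x - V.xPlus l) * conj (V.ratio xs x) := by
  rw [PsiPlus, h.upperCritical_eq, finprod_mem_range h.injective, finprod_eq_prod_of_fintype,
    ratio, mul_div_assoc]
  simp

/-- At a simple zero the derivative is the value of the cofactor. For real x the products over
conjugate points pair up to |ratio|². Here w is the other real zero. -/
theorem deriv_u_aux {x : ℝ} {w : ℂ}
    (hfac : ∀ y ∈ V.regular, l + V.u y = l * (y - x) * (y - w) *
      ((∏ j, (y - xs j)) * ∏ j, (y - conj (xs j))) /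
        ((∏ p, (y - V.z p)) * ∏ p, (y - conj (V.z p)))) :
    deriv V.u x = l * (x - w) * (‖V.ratio xs x‖ ^ 2 : ℝ) := by
  let G : ℂ → ℂ := fun y => l * (y - w) * ((∏ j, (y - xs j)) * ∏ j, (y - conj (xs j))) /
        ((∏ p, (y - V.z p)) * ∏ p, (y - conj (V.z p)))
  have hreg := V.ofReal_mem_regular x
  have hden : (∏ p, ((x : ℂ) - V.z p)) * ∏ p, ((x : ℂ) - conj (V.z p)) ≠ 0 :=
    mul_ne_zero (Finset.prod_ne_zero_iff.mpr fun p _ => sub_ne_zero.mpr (hreg p).1)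
      (Finset.prod_ne_zero_iff.mpr fun p _ => sub_ne_zero.mpr (hreg p).2)
  have hG : DifferentiableAt ℂ G x := by
    refine DifferentiableAt.div ?_ ?_ hden
    · fun_prop
    · fun_prop
  have h1 : HasDerivAt (fun y : ℂ => (y - x) * G y - l) (G x) (x : ℂ) := by
    have := ((((hasDerivAt_id (x : ℂ)).sub_const (x : ℂ)).mul hG.hasDerivAt)).sub_const (l : ℂ)
    refine this.congr_deriv ?_
    simp
  have h2 : HasDerivAt V.u (G x) (x : ℂ) := by
    refine h1.congr_of_eventuallyEq ?_
    filter_upwards [V.isOpen_regular.mem_nhds hreg] with y hy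
    rw [← add_sub_cancel_left (l : ℂ) (V.u y), hfac y hy]
    simp only [G]
    ring
  rw [h2.deriv]
  have h3 : ((‖V.ratio xs x‖ ^ 2 : ℝ) : ℂ) = V.ratio xs x * conj (V.ratio xs x) := by
    rw [mul_conj, normSq_eq_norm_sq]
  rw [h3]
  simp only [G, ratio, map_div₀, map_prod, map_sub, conj_ofReal]
  rw [div_mul_div_comm, mul_div_assoc]

theorem deriv_u_xPlus (h : V.IsFullCritical l xs) :
    deriv V.u (V.xPlus l) =
      ((l * (V.xPlus l - V.xMinus l) * ‖V.ratio xs (V.xPlus l)‖ ^ 2 : ℝ) : ℂ) := by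
  rw [deriv_u_aux (w := V.xMinus l) fun y hy => by rw [h.add_u_eq hy]; ring]
  push_cast
  ring

theorem deriv_u_xMinus (h : V.IsFullCritical l xs) :
    deriv V.u (V.xMinus l) =
      ((-l * (V.xPlus l - V.xMinus l) * ‖V.ratio xs (V.xMinus l)‖ ^ 2 : ℝ) : ℂ) := by
  rw [deriv_u_aux (w := V.xPlus l) fun y hy => h.add_u_eq hy]
  push_cast
  ring

theorem scale_pos (h : V.IsFullCritical l xs) : 0 < -l * (V.xPlus l - V.xMinus l) :=
  mul_pos (neg_pos.mpr h.neg) (sub_pos.mpr h.lt)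

theorem sqrt_norm_deriv_u_xPlus (h : V.IsFullCritical l xs) :
    √‖deriv V.u (V.xPlus l)‖ =
      √(-l * (V.xPlus l - V.xMinus l)) * ‖V.ratio xs (V.xPlus l)‖ := by
  have hs := h.scale_pos
  rw [h.deriv_u_xPlus, Complex.norm_real, Real.norm_eq_abs, ← abs_neg, ← neg_mul, ← neg_mul,
    abs_of_nonneg (by positivity), Real.sqrt_mul hs.le, Real.sqrt_sq (norm_nonneg _)]

theorem sqrt_norm_deriv_u_xMinus (h : V.IsFullCritical l xs) :
    √‖deriv V.u (V.xMinus l)‖ =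
      √(-l * (V.xPlus l - V.xMinus l)) * ‖V.ratio xs (V.xMinus l)‖ := by
  have hs := h.scale_pos
  rw [h.deriv_u_xMinus, Complex.norm_real, Real.norm_eq_abs,
    abs_of_nonneg (by positivity), Real.sqrt_mul hs.le, Real.sqrt_sq (norm_nonneg _)]

/-- The factor x_+ - x_- is positive, so Ψ⁻(x_+) and the ratio share their phase. -/
theorem ratio_xPlus_eq (h : V.IsFullCritical l xs) {ψ : ℝ} (hψ : V.IsPsiPlus l ψ) :
    V.ratio xs (V.xPlus l) =
      ‖V.ratio xs (V.xPlus l)‖ * exp (-I * ψ - I * Real.pi / 4) := by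
  have hd : 0 < V.xPlus l - V.xMinus l := sub_pos.mpr h.lt
  have hr : ((‖V.ratio xs (V.xPlus l)‖ : ℝ) : ℂ) ≠ 0 := by
    exact_mod_cast (norm_pos_iff.mpr (h.ratio_ne_zero _)).ne'
  have hd' : ((V.xPlus l - V.xMinus l : ℝ) : ℂ) ≠ 0 := by exact_mod_cast hd.ne'
  rw [IsPsiPlus, h.PsiMinus_eq, ← ofReal_sub, norm_mul, Complex.norm_real, Real.norm_eq_abs,
    abs_of_pos hd] at hψ
  rw [hψ, ofReal_mul]
  field_simp

/-- Here x_- - x_+ is negative and Ψ⁺ involves the conjugate ratio. The resulting minus sign is what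
later turns the sum of two saddles into a sine. -/
theorem ratio_xMinus_eq (h : V.IsFullCritical l xs) {ψ : ℝ} (hψ : V.IsPsiMinus l ψ) :
    V.ratio xs (V.xMinus l) =
      -(‖V.ratio xs (V.xMinus l)‖ * exp (-I * ψ + I * Real.pi / 4)) := by
  have hd : 0 < V.xPlus l - V.xMinus l := sub_pos.mpr h.lt
  have hr : ((‖V.ratio xs (V.xMinus l)‖ : ℝ) : ℂ) ≠ 0 := by
    exact_mod_cast (norm_pos_iff.mpr (h.ratio_ne_zero _)).ne'
  have hd' : ((V.xPlus l - V.xMinus l : ℝ) : ℂ) ≠ 0 := by exact_mod_cast hd.ne'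
  have hswap : (V.xMinus l : ℂ) - V.xPlus l = -((V.xPlus l - V.xMinus l : ℝ) : ℂ) := by
    push_cast; ring
  rw [IsPsiMinus, h.PsiPlus_eq, hswap, norm_mul, norm_neg, Complex.norm_real, Real.norm_eq_abs,
    abs_of_pos hd, RCLike.norm_conj] at hψ
  have hc := congrArg conj hψ
  rw [← exp_conj, map_div₀, map_mul, map_neg, conj_ofReal, conj_ofReal, conj_conj] at hc
  have harg : conj (I * ψ - I * Real.pi / 4) = -I * ψ + I * Real.pi / 4 := by
    simp only [map_sub, map_mul, map_div₀, conj_I, conj_ofReal, map_ofNat]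
    ring
  rw [harg] at hc
  rw [hc, ofReal_mul]
  field_simp

end IsFullCritical

end RationalPotential

/-! ### The row over the two real critical points and their interference -/

theorem exp_sub_exp_eq_sin (a b : ℝ) :
    exp (-I * a) - exp (-I * b) =
      -2 * I * Real.sin ((a - b) / 2) * exp (-I * (a + b) / 2) := by
  have ha : exp (-I * a) = exp (-I * (a + b) / 2) * exp (-(((a - b) / 2 : ℝ) : ℂ) * I) := by
    rw [← Complex.exp_add]; congr 1; push_cast; ring
  have hb : exp (-I * b) = exp (-I * (a + b) / 2) * exp ((((a - b) / 2 : ℝ) : ℂ) * I) := by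
    rw [← Complex.exp_add]; congr 1; push_cast; ring
  rw [ha, hb, ofReal_sin, Complex.sin]
  linear_combination (exp (-I * (a + b) / 2) *
    (exp (-(((a - b) / 2 : ℝ) : ℂ) * I) - exp ((((a - b) / 2 : ℝ) : ℂ) * I))) * I_sq

theorem exp_neg_pi_div_four_sq : exp (-I * Real.pi / 4) ^ 2 = -I := by
  rw [← Complex.exp_nat_mul]
  have : ((2 : ℕ) : ℂ) * (-I * Real.pi / 4) = -(Real.pi / 2 * I) := by push_cast; ring
  rw [this, Complex.exp_neg, Complex.exp_pi_div_two_mul_I, Complex.inv_I]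

theorem exp_pi_div_four_sq : exp (I * Real.pi / 4) ^ 2 = I := by
  rw [← Complex.exp_nat_mul]
  have : ((2 : ℕ) : ℂ) * (I * Real.pi / 4) = Real.pi / 2 * I := by push_cast; ring
  rw [this, Complex.exp_pi_div_two_mul_I]

theorem norm_exp_I_pi_div_four : ‖exp (I * Real.pi / 4)‖ = 1 := by
  rw [show I * (Real.pi : ℂ) / 4 = ((Real.pi / 4 : ℝ) : ℂ) * I by push_cast; ring,
    Complex.norm_exp_ofReal_mul_I]

theorem norm_exp_neg_I_pi_div_four : ‖exp (-I * Real.pi / 4)‖ = 1 := by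
  rw [show -I * (Real.pi : ℂ) / 4 = ((-(Real.pi / 4) : ℝ) : ℂ) * I by push_cast; ring,
    Complex.norm_exp_ofReal_mul_I]

namespace Contour

variable {n : ℕ} {V : RationalPotential n} {J : Set ℝ} {W : Contour V J}
  {l : ℝ} {xs : Fin n → ℂ}

/-- Since u₀'(x_-) > 0 and e^{-iπ/4} squares to -i, the second-order coefficient is -u₀'(x_-) r². At
x_+ both signs change. -/
theorem OverRealPoints.isSteepAt_neg_one (hW : W.OverRealPoints) (hl : l ∈ J)
    (h : V.IsFullCritical l xs) : W.IsSteepAt (-1) l := by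
  obtain ⟨hx, -, r, hr, hd⟩ := (hW l hl).1
  have hs := mul_pos h.scale_pos (pow_pos (norm_pos_iff.mpr (h.ratio_ne_zero (V.xMinus l))) 2)
  have e : -I * deriv V.u (W.γ l (-1)) * deriv (W.γ l) (-1) ^ 2 =
      ((-(-l * (V.xPlus l - V.xMinus l) * ‖V.ratio xs (V.xMinus l)‖ ^ 2 * r ^ 2) : ℝ) : ℂ) := by
    rw [hx, hd, mul_pow, exp_neg_pi_div_four_sq, h.deriv_u_xMinus]
    push_cast
    linear_combination (-l * (V.xPlus l - V.xMinus l) * ‖V.ratio xs (V.xMinus l)‖ ^ 2 * r ^ 2 : ℂ)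
      * I_sq
  refine ⟨?_, ?_, ?_⟩
  · rw [hx, V.u_ofReal, h.minus]; simp
  · rw [e, ofReal_re]
    have := mul_pos hs (pow_pos hr 2)
    linarith
  · rw [e, ofReal_im]

theorem OverRealPoints.isSteepAt_one (hW : W.OverRealPoints) (hl : l ∈ J)
    (h : V.IsFullCritical l xs) : W.IsSteepAt 1 l := by
  obtain ⟨hx, -, r, hr, hd⟩ := (hW l hl).2.1
  have hs := mul_pos h.scale_pos (pow_pos (norm_pos_iff.mpr (h.ratio_ne_zero (V.xPlus l))) 2)
  have e : -I * deriv V.u (W.γ l 1) * deriv (W.γ l) 1 ^ 2 =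
      ((-(-l * (V.xPlus l - V.xMinus l) * ‖V.ratio xs (V.xPlus l)‖ ^ 2 * r ^ 2) : ℝ) : ℂ) := by
    rw [hx, hd, mul_pow, exp_pi_div_four_sq, h.deriv_u_xPlus]
    push_cast
    linear_combination (-l * (V.xPlus l - V.xMinus l) * ‖V.ratio xs (V.xPlus l)‖ ^ 2 * r ^ 2 : ℂ)
      * I_sq
  refine ⟨?_, ?_, ?_⟩
  · rw [hx, V.u_ofReal, h.plus]; simp
  · rw [e, ofReal_re]
    have := mul_pos hs (pow_pos hr 2)
    linarith
  · rw [e, ofReal_im]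

theorem OverRealPoints.saddleAt_neg_one (hW : W.OverRealPoints) (hl : l ∈ J) (ε : ℝ) :
    W.saddleAt (-1) ε l = exp (-I * Real.pi / 4) * exp (-I * V.h l (V.xMinus l) / ε) /
      √‖deriv V.u (V.xMinus l)‖ := by
  obtain ⟨hx, hH, r, hr, hd⟩ := (hW l hl).1
  have hr' : (r : ℂ) ≠ 0 := by exact_mod_cast hr.ne'
  rw [saddleAt, hH, hx, hd, norm_mul, norm_exp_neg_I_pi_div_four, mul_one, Complex.norm_real,
    Real.norm_eq_abs, abs_of_pos hr, mul_div_cancel_left₀ _ hr']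

theorem OverRealPoints.saddleAt_one (hW : W.OverRealPoints) (hl : l ∈ J) (ε : ℝ) :
    W.saddleAt 1 ε l = exp (I * Real.pi / 4) * exp (-I * V.h l (V.xPlus l) / ε) /
      √‖deriv V.u (V.xPlus l)‖ := by
  obtain ⟨hx, hH, r, hr, hd⟩ := (hW l hl).2.1
  have hr' : (r : ℂ) ≠ 0 := by exact_mod_cast hr.ne'
  rw [saddleAt, hH, hx, hd, norm_mul, norm_exp_I_pi_div_four, mul_one, Complex.norm_real,
    Real.norm_eq_abs, abs_of_pos hr, mul_div_cancel_left₀ _ hr']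

theorem OverRealPoints.R_eq_zero (hW : W.OverRealPoints) (hl : l ∈ J) :
    W.R l (-1) = 0 ∧ W.R l 1 = 0 := by
  have h : ∀ x : ℝ, (-I * V.h l x).re = 0 := fun x => by
    simp [V.h_ofReal_im l x]
  constructor
  · rw [R, (hW l hl).1.2.1]; exact h _
  · rw [R, (hW l hl).2.1.2.1]; exact h _

/-- The row over the two real critical points, divided by `√(2πε)`. -/
theorem OverRealPoints.exists_row_bound (hW : W.OverRealPoints) (hends : W.EndsInValleys)
    {K : Set ℝ} (hKJ : K ⊆ J) (hK : IsCompact K) (hfull : ∀ l ∈ K, ∃ xs, V.IsFullCritical l xs) :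
    ∃ C : ℝ, ∃ ε₀ > 0, ∀ l ∈ K, ∀ ε : ℝ, 0 < ε → ε ≤ ε₀ → ∀ p,
      ‖W.integral ε l p / (√(2 * Real.pi * ε) : ℝ) -
        (W.saddleAt (-1) ε l / (W.γ l (-1) - V.z p) + W.saddleAt 1 ε l / (W.γ l 1 - V.z p))‖ ≤
          C * ε := by
  obtain ⟨C, ε₀, hε₀, hC⟩ := W.exists_integral_bound hKJ hK hends {-1, 1} (R₀ := fun _ => 0)
    continuousOn_const
    (by
      intro t ht l hl
      obtain ⟨xs, hxs⟩ := hfull l hl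
      rcases Finset.mem_insert.mp ht with rfl | ht
      · exact hW.isSteepAt_neg_one (hKJ hl) hxs
      · rw [Finset.mem_singleton.mp ht]
        exact hW.isSteepAt_one (hKJ hl) hxs)
    (by
      intro t ht l hl
      rcases Finset.mem_insert.mp ht with rfl | ht
      · exact (hW.R_eq_zero (hKJ hl)).1
      · rw [Finset.mem_singleton.mp ht]
        exact (hW.R_eq_zero (hKJ hl)).2)
    (by
      intro l hl t ht
      rw [Finset.mem_insert, Finset.mem_singleton, not_or] at ht
      exact (hW l (hKJ hl)).2.2 t ht.1 ht.2)
  refine ⟨|C|, ε₀, hε₀, fun l hl ε hε hle p => ?_⟩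
  have h := hC l hl ε hε hle p
  rw [Finset.sum_pair (by norm_num), zero_div, Real.exp_zero, mul_one] at h
  have hpos : 0 < √(2 * Real.pi * ε) := by positivity
  have hs0 : ((√(2 * Real.pi * ε) : ℝ) : ℂ) ≠ 0 := by exact_mod_cast hpos.ne'
  have e : ∀ S : ℂ, W.integral ε l p / (√(2 * Real.pi * ε) : ℝ) - S =
      (W.integral ε l p - (√(2 * Real.pi * ε) : ℝ) * S) / (√(2 * Real.pi * ε) : ℝ) := fun S => by
    field_simp
  rw [e, norm_div, Complex.norm_real, Real.norm_eq_abs, abs_of_pos hpos, div_le_iff₀ hpos]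
  refine h.trans ?_
  have h1 : √ε ≤ √(2 * Real.pi * ε) := by
    apply Real.sqrt_le_sqrt
    nlinarith [Real.pi_gt_three]
  calc C * (ε * √ε) ≤ |C| * (ε * √(2 * Real.pi * ε)) := by
        gcongr
        exact le_abs_self C
    _ = _ := by ring

end Contour

namespace RationalPotential

variable {n : ℕ} {V : RationalPotential n} {l : ℝ} {xs : Fin n → ℂ}

/-- The interference of the contributions of the two real critical points. -/
theorem IsFullCritical.interference (h : V.IsFullCritical l xs) (hV : V.IsPositiveKlausShaw)
    (hl : l ∈ V.bulk) {psiP psiM : ℝ} (hP : V.IsPsiPlus l psiP) (hM : V.IsPsiMinus l psiM)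
    {ε : ℝ} (hε : 0 < ε) :
    exp (-I * Real.pi / 4) * exp (-I * V.h l (V.xMinus l) / ε) / √‖deriv V.u (V.xMinus l)‖ *
        V.ratio xs (V.xMinus l) +
      exp (I * Real.pi / 4) * exp (-I * V.h l (V.xPlus l) / ε) / √‖deriv V.u (V.xPlus l)‖ *
        V.ratio xs (V.xPlus l) =
      -2 * I / √(-l * (V.xPlus l - V.xMinus l)) *
        exp (-I * (V.h l (V.xPlus l) + V.h l (V.xMinus l)) / (2 * ε)) *
        exp (-I * (psiP + psiM) / 2) * (Real.sin (Real.pi * V.T ε l psiP psiM) : ℝ) := by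
  have hrP : ((‖V.ratio xs (V.xPlus l)‖ : ℝ) : ℂ) ≠ 0 := by
    exact_mod_cast (norm_pos_iff.mpr (h.ratio_ne_zero _)).ne'
  have hrM : ((‖V.ratio xs (V.xMinus l)‖ : ℝ) : ℂ) ≠ 0 := by
    exact_mod_cast (norm_pos_iff.mpr (h.ratio_ne_zero _)).ne'
  have hsc : ((√(-l * (V.xPlus l - V.xMinus l)) : ℝ) : ℂ) ≠ 0 := by
    exact_mod_cast (Real.sqrt_pos.mpr h.scale_pos).ne'
  have hε' : (ε : ℂ) ≠ 0 := by exact_mod_cast hε.ne'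
  have hreal : ∀ x : ℝ, V.h l x = ((V.h l x).re : ℂ) := fun x =>
    Complex.ext (by simp) (by simp [V.h_ofReal_im l x])
  have hT : Real.pi * V.T ε l psiP psiM =
      (((V.h l (V.xPlus l)).re / ε + psiP) - ((V.h l (V.xMinus l)).re / ε + psiM)) / 2 := by
    have hd := congrArg re (hV.h_sub_h hl.1 h.neg)
    rw [sub_re, ofReal_re] at hd
    rw [T, ← hd]
    field_simp
    ring
  set hp := (V.h l (V.xPlus l)).re with hhp
  set hm := (V.h l (V.xMinus l)).re with hhm
  rw [hT, hreal (V.xPlus l), hreal (V.xMinus l), ← hhp, ← hhm, h.sqrt_norm_deriv_u_xPlus,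
    h.sqrt_norm_deriv_u_xMinus, h.ratio_xPlus_eq hP, h.ratio_xMinus_eq hM]
  have hnP : ‖(‖V.ratio xs (V.xPlus l)‖ : ℂ) * exp (-I * psiP - I * Real.pi / 4)‖ =
      ‖V.ratio xs (V.xPlus l)‖ := by rw [← h.ratio_xPlus_eq hP]
  have hnM : ‖-((‖V.ratio xs (V.xMinus l)‖ : ℂ) * exp (-I * psiM + I * Real.pi / 4))‖ =
      ‖V.ratio xs (V.xMinus l)‖ := by rw [← h.ratio_xMinus_eq hM]
  rw [hnP, hnM]
  have key := exp_sub_exp_eq_sin (hp / ε + psiP) (hm / ε + psiM)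
  have eP : exp (-I * ((hp / ε + psiP : ℝ) : ℂ)) = exp (I * Real.pi / 4) * exp (-I * hp / ε) *
      exp (-I * psiP - I * Real.pi / 4) := by
    rw [← Complex.exp_add, ← Complex.exp_add]; congr 1; push_cast; ring
  have eM : exp (-I * ((hm / ε + psiM : ℝ) : ℂ)) = exp (-I * Real.pi / 4) * exp (-I * hm / ε) *
      exp (-I * psiM + I * Real.pi / 4) := by
    rw [← Complex.exp_add, ← Complex.exp_add]; congr 1; push_cast; ring
  have eS : exp (-I * (((hp / ε + psiP : ℝ) : ℂ) + ((hm / ε + psiM : ℝ) : ℂ)) / 2) =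
      exp (-I * (hp + hm) / (2 * ε)) * exp (-I * (psiP + psiM) / 2) := by
    rw [← Complex.exp_add]; congr 1; push_cast; field_simp; ring
  rw [eP, eM, eS] at key
  rw [ofReal_mul, ofReal_mul]
  -- The moduli of the ratios cancel against those in √|u'|, and the angles ±π/4 of the directions
  -- cancel against those in the definition of ψ_±.
  calc _ = (exp (I * Real.pi / 4) * exp (-I * hp / ε) * exp (-I * psiP - I * Real.pi / 4) -
        exp (-I * Real.pi / 4) * exp (-I * hm / ε) * exp (-I * psiM + I * Real.pi / 4)) /
          √(-l * (V.xPlus l - V.xMinus l)) := by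
        field_simp
        ring
    _ = _ := by rw [key]; ring

end RationalPotential

/-! ### Asymptotics in the bulk -/

section Suitable

variable {n : ℕ} {V : RationalPotential n} {J : Set ℝ}
  {N : ℝ → ℝ → Matrix (Fin (n + 1)) (Fin (n + 1)) ℂ} {W : Fin (n + 1) → Contour V J}
  {Q : Fin (n + 1)}

theorem IsSuitableBulk.isFullCritical (hS : IsSuitableBulk N W Q) (hV : V.IsPositiveKlausShaw)
    (hJ : J ⊆ V.bulk) {l : ℝ} (hl : l ∈ J) :
    V.IsFullCritical l fun j => (W (Q.succAbove j)).γ l 0 := by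
  have hl0 := hV.neg_of_mem_bulk (hJ hl)
  obtain ⟨hlt, he, -⟩ := hV.level_sets (hJ hl).1 hl0
  refine ⟨hlt, hl0, ?_, ?_, hS.injective l hl,
    fun j => (hS.overPoint _ (Q.succAbove_ne j) l hl).1⟩
  · exact he.superset (mem_insert _ _)
  · exact he.superset (mem_insert_of_mem _ rfl)

theorem cauchyFactor_ne_zero (hS : IsSuitableBulk N W Q) {l : ℝ} (hl : l ∈ J) :
    cauchyFactor W Q l ≠ 0 := by
  refine div_ne_zero (mul_ne_zero ?_ ?_) ?_
  · exact Finset.prod_ne_zero_iff.mpr fun j _ => Finset.prod_ne_zero_iff.mpr fun i hi =>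
      sub_ne_zero.mpr fun h => (Finset.mem_Iio.mp hi).ne (hS.injective l hl h).symm
  · exact Finset.prod_ne_zero_iff.mpr fun j _ => Finset.prod_ne_zero_iff.mpr fun i hi =>
      sub_ne_zero.mpr fun h => (Finset.mem_Iio.mp hi).ne (V.z_injective h)
  · exact Finset.prod_ne_zero_iff.mpr fun j _ => Finset.prod_ne_zero_iff.mpr fun p _ =>
      sub_ne_zero.mpr ((W _).γ_mem_regular hl 0 p).1

theorem continuousOn_cauchyFactor : ContinuousOn (cauchyFactor W Q) J := by
  have hγ : ∀ j, ContinuousOn (fun l => (W (Q.succAbove j)).γ l 0) J := fun j =>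
    Contour.continuousOn_slice (W _).continuousOn 0
  unfold cauchyFactor
  refine ContinuousOn.div (ContinuousOn.mul ?_ continuousOn_const) ?_ fun l hl => ?_
  · exact continuousOn_finsetProd _ fun j _ => continuousOn_finsetProd _ fun i _ =>
      (hγ j).sub (hγ i)
  · exact continuousOn_finsetProd _ fun j _ => continuousOn_finsetProd _ fun p _ =>
      (hγ j).sub continuousOn_const
  · exact Finset.prod_ne_zero_iff.mpr fun j _ => Finset.prod_ne_zero_iff.mpr fun p _ =>
      sub_ne_zero.mpr ((W _).γ_mem_regular hl 0 p).1

theorem leadingV_ne_zero (hS : IsSuitableBulk N W Q) (hV : V.IsPositiveKlausShaw)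
    (hJ : J ⊆ V.bulk) {l : ℝ} (hl : l ∈ J) {ε : ℝ} (hε : 0 < ε) (psiP psiM : ℝ) :
    leadingV W Q ε l psiP psiM ≠ 0 := by
  have h := hS.isFullCritical hV hJ hl
  have h1 : (((2 * Real.pi * ε) ^ (((n : ℝ) + 1) / 2) : ℝ) : ℂ) ≠ 0 := by
    exact_mod_cast (Real.rpow_pos_of_pos (by positivity) _).ne'
  have h2 : ((√(-l * (V.xPlus l - V.xMinus l)) : ℝ) : ℂ) ≠ 0 := by
    exact_mod_cast (Real.sqrt_pos.mpr h.scale_pos).ne'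
  have h3 : ∏ j : Fin n, (W (Q.succAbove j)).saddleFactor ε l ≠ 0 :=
    Finset.prod_ne_zero_iff.mpr fun j _ =>
      Contour.saddleAt_ne_zero ((hS.overPoint _ (Q.succAbove_ne j)).isSteepAt hl)
  have h4 := cauchyFactor_ne_zero hS hl
  have h5 : (-2 * I * (-1) ^ (n - (Q : ℕ)) : ℂ) ≠ 0 :=
    mul_ne_zero (mul_ne_zero (by norm_num) I_ne_zero) (pow_ne_zero _ (by norm_num))
  exact mul_ne_zero (mul_ne_zero (mul_ne_zero (div_ne_zero (mul_ne_zero (mul_ne_zero h5 h1) h4) h2)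
    h3) (exp_ne_zero _)) (exp_ne_zero _)

/-- At level zero the saddle coefficient has modulus 1/√|u'|, whatever ε is. The limiting row Q
oscillates with ε but stays bounded, as the Lipschitz estimate for the determinant requires. -/
theorem exists_row_entry_bound (hS : IsSuitableBulk N W Q) (hV : V.IsPositiveKlausShaw)
    (hJ : J ⊆ V.bulk) {K : Set ℝ} (hKJ : K ⊆ J) (hK : IsCompact K) (t : ℝ)
    (ht : t = -1 ∨ t = 1) (p : Fin (n + 1)) :
    ∃ B > 0, ∀ l ∈ K, ∀ ε : ℝ, ‖(W Q).saddleAt t ε l / ((W Q).γ l t - V.z p)‖ ≤ B := by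
  have hst : ∀ l ∈ K, (W Q).IsSteepAt t l ∧ (W Q).R l t = 0 := by
    intro l hl
    have hfull := hS.isFullCritical hV hJ (hKJ hl)
    rcases ht with rfl | rfl
    · exact ⟨hS.overReal.isSteepAt_neg_one (hKJ hl) hfull, (hS.overReal.R_eq_zero (hKJ hl)).1⟩
    · exact ⟨hS.overReal.isSteepAt_one (hKJ hl) hfull, (hS.overReal.R_eq_zero (hKJ hl)).2⟩
  have hc1 := ((W Q).continuousOn_deriv_u hKJ t).norm.sqrt
  have hc2 := (W Q).continuousOn_inv_sub hKJ t p
  obtain ⟨B, hB, hBK⟩ := exists_pos_forall_norm_le_of_isCompact hK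
    ((hc1.inv₀ fun l hl => (Real.sqrt_pos.mpr
      (norm_pos_iff.mpr (hst l hl).1.deriv_u_ne_zero)).ne').mul hc2.norm)
  refine ⟨B, hB, fun l hl ε => (le_of_eq ?_).trans ((le_abs_self _).trans (hBK l hl))⟩
  rw [div_eq_mul_one_div, norm_mul, Contour.norm_saddleAt (hst l hl).1, (hst l hl).2, zero_div,
    Real.exp_zero, one_div]
  rfl

/-- Asymptotics of the modified Evans function in the bulk. -/
theorem evans_asymptotics_bulk (hS : IsSuitableBulk N W Q) (hV : V.IsPositiveKlausShaw)
    (hJ : J ⊆ V.bulk) {psiP psiM : ℝ → ℝ} (hP : ∀ l ∈ J, V.IsPsiPlus l (psiP l))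
    (hM : ∀ l ∈ J, V.IsPsiMinus l (psiM l)) {K : Set ℝ} (hKJ : K ⊆ J) (hK : IsCompact K) :
    ∃ C : ℝ, ∃ ε₀ > 0, ∀ l ∈ K, ∀ ε, 0 < ε → ε < ε₀ →
      ∃ e : ℂ, ‖e‖ ≤ C * ε ∧ evans V N ε l = leadingV W Q ε l (psiP l) (psiM l) *
        ((Real.sin (Real.pi * V.T ε l (psiP l) (psiM l)) : ℝ) + e) := by
  obtain ⟨ε₁, hε₁, hmod⟩ := hS.modification K hKJ hK
  have hover := fun j => hS.overPoint (Q.succAbove j) (Q.succAbove_ne j)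
  choose C ε₂ hε₂ hrow using fun j =>
    (hover j).exists_row_bound (hS.ends (Q.succAbove j)) hKJ hK
  obtain ⟨CQ, ε₃, hε₃, hrowQ⟩ := hS.overReal.exists_row_bound (hS.ends Q) hKJ hK
    fun l hl => ⟨_, hS.isFullCritical hV hJ (hKJ hl)⟩
  choose B hB hBK using fun j => fun p =>
    exists_pos_forall_norm_le_of_isCompact hK ((W (Q.succAbove j)).continuousOn_inv_sub hKJ 0 p)
  choose BM hBM hBMK using exists_row_entry_bound hS hV hJ hKJ hK (-1) (Or.inl rfl)
  choose BP hBP hBPK using exists_row_entry_bound hS hV hJ hKJ hK 1 (Or.inr rfl)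
  set Bt := ∑ p, (BM p + BP p) + ∑ j, ∑ p, B j p
  set Ct := |CQ| + ∑ j, |C j|
  obtain ⟨C', hC'⟩ := exists_det_sub_bound (n + 1) Bt Ct
  obtain ⟨d, hd, hdK⟩ := exists_pos_forall_le_of_isCompact hK
    (continuousOn_cauchyFactor.mono hKJ).norm
    (fun l hl => norm_pos_iff.mpr (cauchyFactor_ne_zero hS (hKJ hl)))
  -- The contour passes through x_± and is continuous in l, so its points stand in for x_± and no
  -- separate continuity proof is needed.
  obtain ⟨E, hE, hEK⟩ := exists_pos_forall_norm_le_of_isCompact hK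
    (f := fun l => √(-l * (((W Q).γ l 1).re - ((W Q).γ l (-1)).re))) (by
      have h1 := (Contour.continuousOn_slice (W Q).continuousOn 1).mono hKJ
      have h2 := (Contour.continuousOn_slice (W Q).continuousOn (-1)).mono hKJ
      have h3 := Complex.continuous_re.comp_continuousOn h1
      have h4 := Complex.continuous_re.comp_continuousOn h2
      exact (continuousOn_id.neg.mul (h3.sub h4)).sqrt)
  -- For a single pole there are no rows other than Q, and any positive number serves.
  obtain ⟨ε₄, hε₄, hε₄j⟩ : ∃ ε₄ > 0, ∀ j, ε₄ ≤ ε₂ j := by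
    rcases isEmpty_or_nonempty (Fin n) with he | he
    · exact ⟨1, one_pos, fun j => he.elim j⟩
    · exact ⟨Finset.univ.inf' Finset.univ_nonempty ε₂, (Finset.lt_inf'_iff _).mpr fun j _ => hε₂ j,
        fun j => Finset.inf'_le _ (Finset.mem_univ j)⟩
  refine ⟨|C'| * E / (2 * d), min (min ε₁ ε₃) (min ε₄ 1), by positivity, fun l hl ε hε hlt => ?_⟩
  have hl1 : ε ≤ ε₁ := hlt.le.trans ((min_le_left _ _).trans (min_le_left _ _))
  have hl3 : ε ≤ ε₃ := hlt.le.trans ((min_le_left _ _).trans (min_le_right _ _))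
  have hl4 : ε ≤ ε₄ := hlt.le.trans ((min_le_right _ _).trans (min_le_left _ _))
  have hl5 : ε ≤ 1 := hlt.le.trans ((min_le_right _ _).trans (min_le_right _ _))
  have hlJ := hKJ hl
  have hfull := hS.isFullCritical hV hJ hlJ
  set xs : Fin n → ℂ := fun j => (W (Q.succAbove j)).γ l 0 with hxs
  have hsq0 : ((√(2 * Real.pi * ε) : ℝ) : ℂ) ≠ 0 := by
    have : √(2 * Real.pi * ε) ≠ 0 := by positivity
    exact_mod_cast this
  -- the scaled matrix and its limit
  let s : Fin (n + 1) → ℂ := Fin.insertNth (α := fun _ => ℂ) Q (√(2 * Real.pi * ε) : ℝ)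
    fun j => (√(2 * Real.pi * ε) : ℝ) * (W (Q.succAbove j)).saddleFactor ε l
  have hsQ : s Q = (√(2 * Real.pi * ε) : ℝ) := Fin.insertNth_apply_same _ _ _
  have hsj : ∀ j, s (Q.succAbove j) =
      (√(2 * Real.pi * ε) : ℝ) * (W (Q.succAbove j)).saddleFactor ε l := fun j =>
    Fin.insertNth_apply_succAbove _ _ _ _
  have hs0 : ∀ m, s m ≠ 0 := by
    rw [Fin.forall_iff_succAbove Q]
    refine ⟨by rw [hsQ]; exact hsq0, fun j => ?_⟩
    rw [hsj]
    exact mul_ne_zero hsq0 (Contour.saddleAt_ne_zero ((hover j).isSteepAt hlJ))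
  have hev := evans_eq_prod_mul_det (hmod l hl ε hε hl1).2 s hs0
  set M : Matrix (Fin (n + 1)) (Fin (n + 1)) ℂ :=
    Matrix.of fun m p => (W m).integral ε l p / s m with hM'
  let Bm : Matrix (Fin (n + 1)) (Fin (n + 1)) ℂ :=
    Matrix.of (Fin.insertNth (α := fun _ => Fin (n + 1) → ℂ) Q
      (fun p => (W Q).saddleAt (-1) ε l / ((W Q).γ l (-1) - V.z p) +
        (W Q).saddleAt 1 ε l / ((W Q).γ l 1 - V.z p)) fun j p => 1 / (xs j - V.z p))
  have hBQ : ∀ p, Bm Q p = (W Q).saddleAt (-1) ε l / ((W Q).γ l (-1) - V.z p) +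
      (W Q).saddleAt 1 ε l / ((W Q).γ l 1 - V.z p) := fun p => by
    simp only [Bm, Matrix.of_apply, Fin.insertNth_apply_same]
  have hBj : ∀ j p, Bm (Q.succAbove j) p = 1 / (xs j - V.z p) := fun j p => by
    simp only [Bm, Matrix.of_apply, Fin.insertNth_apply_succAbove]
  have hsum1 : 0 ≤ ∑ j, ∑ p, B j p :=
    Finset.sum_nonneg fun j _ => Finset.sum_nonneg fun p _ => (hB j p).le
  have hsum2 : 0 ≤ ∑ p, (BM p + BP p) :=
    Finset.sum_nonneg fun p _ => (add_pos (hBM p) (hBP p)).le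
  have hsum3 : 0 ≤ ∑ j, |C j| := Finset.sum_nonneg fun j _ => abs_nonneg _
  have hdet : ‖M.det - Bm.det‖ ≤ C' * ε := by
    refine hC' M Bm ε hε hl5 ?_ ?_
    · rw [Fin.forall_iff_succAbove Q]
      constructor
      · intro p
        rw [hBQ]
        refine (norm_add_le _ _).trans ((add_le_add (hBMK p l hl ε) (hBPK p l hl ε)).trans ?_)
        have := Finset.single_le_sum (f := fun p => BM p + BP p)
          (fun q _ => (add_pos (hBM q) (hBP q)).le) (Finset.mem_univ p)
        linarith
      · intro j p
        rw [hBj]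
        refine (hBK j p l hl).trans ?_
        have h1 := Finset.single_le_sum (f := B j) (fun q _ => (hB j q).le) (Finset.mem_univ p)
        have h2 := Finset.single_le_sum (f := fun j => ∑ p, B j p)
          (fun j _ => Finset.sum_nonneg fun q _ => (hB j q).le) (Finset.mem_univ j)
        linarith
    · rw [Fin.forall_iff_succAbove Q]
      constructor
      · intro p
        rw [hBQ, hM', Matrix.of_apply, hsQ]
        refine (hrowQ l hl ε hε hl3 p).trans ?_
        gcongr
        linarith [le_abs_self CQ]
      · intro j p
        rw [hBj, hM', Matrix.of_apply, hsj]
        refine (hrow j l hl ε hε (hl4.trans (hε₄j j)) p).trans ?_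
        gcongr
        have := Finset.single_le_sum (f := fun j => |C j|) (fun q _ => abs_nonneg _)
          (Finset.mem_univ j)
        linarith [le_abs_self (C j), abs_nonneg CQ]
  -- evaluation of the limiting determinant
  have hreg := fun t p => ((W Q).γ_mem_regular hlJ t p).1
  have hdetB : Bm.det = (-1) ^ (n - (Q : ℕ)) * cauchyFactor W Q l *
      (-2 * I / √(-l * (V.xPlus l - V.xMinus l)) *
        exp (-I * (V.h l (V.xPlus l) + V.h l (V.xMinus l)) / (2 * ε)) *
        exp (-I * (psiP l + psiM l) / 2) *
        (Real.sin (Real.pi * V.T ε l (psiP l) (psiM l)) : ℝ)) := by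
    rw [det_cauchy_row Q Bm xs V.z ((W Q).γ l (-1)) ((W Q).γ l 1) _ _ V.z_injective
      (fun j p => ((W (Q.succAbove j)).γ_mem_regular hlJ 0 p).1) (hreg (-1)) (hreg 1) hBj hBQ,
      ← hfull.interference hV (hJ hlJ) (hP l hlJ) (hM l hlJ) hε,
      hS.overReal.saddleAt_neg_one hlJ, hS.overReal.saddleAt_one hlJ, (hS.overReal l hlJ).1.1,
      (hS.overReal l hlJ).2.1.1]
    rfl
  set S : ℂ := ((Real.sin (Real.pi * V.T ε l (psiP l) (psiM l)) : ℝ) : ℂ)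
  set E1 := exp (-I * (V.h l (V.xPlus l) + V.h l (V.xMinus l)) / (2 * ε)) with hE1
  set E2 := exp (-I * (psiP l + psiM l) / 2) with hE2
  set q : ℝ := √(-l * (V.xPlus l - V.xMinus l)) with hq
  have hqpos : 0 < q := Real.sqrt_pos.mpr hfull.scale_pos
  have hq0 : (q : ℂ) ≠ 0 := by exact_mod_cast hqpos.ne'
  -- The limiting determinant without its sine. Its modulus 2|P(λ)|/q is independent of ε and
  -- bounded below on K, so dividing the error by κ is safe even where the sine vanishes.
  set κ : ℂ := (-1) ^ (n - (Q : ℕ)) * cauchyFactor W Q l * (-2 * I / q * E1 * E2) with hκ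
  have hBκ : Bm.det = κ * S := by rw [hdetB, hκ]; ring
  have hn1 : ‖E1‖ = 1 := by
    rw [hE1, Complex.norm_exp]
    have : (-I * (V.h l (V.xPlus l) + V.h l (V.xMinus l)) / (2 * ε)).re = 0 := by
      rw [show (2 * ε : ℂ) = ((2 * ε : ℝ) : ℂ) by push_cast; ring, Complex.div_ofReal_re]
      simp [V.h_ofReal_im l]
    rw [this, Real.exp_zero]
  have hn2 : ‖E2‖ = 1 := by
    rw [hE2, show -I * ((psiP l : ℂ) + psiM l) / 2 = ((-((psiP l + psiM l) / 2) : ℝ) : ℂ) * I by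
      push_cast; ring, Complex.norm_exp_ofReal_mul_I]
  have hκn : ‖κ‖ = 2 * ‖cauchyFactor W Q l‖ / q := by
    rw [hκ]
    simp only [norm_mul, norm_div, norm_pow, norm_neg, norm_one, one_pow, one_mul, hn1, hn2,
      mul_one, norm_I, Complex.norm_real, Real.norm_eq_abs, abs_of_pos hqpos]
    rw [show ‖(2 : ℂ)‖ = 2 by norm_num]
    ring
  have hqE : q ≤ E := by
    have h1 := hEK l hl
    rw [(hS.overReal l hlJ).1.1, (hS.overReal l hlJ).2.1.1, ofReal_re, ofReal_re] at h1
    exact (le_abs_self _).trans h1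
  have hκd : 2 * d / E ≤ ‖κ‖ := by
    rw [hκn]
    have := hdK l hl
    gcongr
  have hκpos : 0 < ‖κ‖ := lt_of_lt_of_le (by positivity) hκd
  have hκ0 : κ ≠ 0 := norm_pos_iff.mp hκpos
  refine ⟨(M.det - Bm.det) / κ, ?_, ?_⟩
  · rw [norm_div, div_le_iff₀ hκpos]
    calc ‖M.det - Bm.det‖ ≤ |C'| * ε := hdet.trans (by gcongr; exact le_abs_self _)
      _ = |C'| * E / (2 * d) * ε * (2 * d / E) := by field_simp
      _ ≤ |C'| * E / (2 * d) * ε * ‖κ‖ := by gcongr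
  · have hV' : leadingV W Q ε l (psiP l) (psiM l) = (∏ m, s m) * κ := by
      rw [leadingV, rpow_half_eq_sqrt_pow (by positivity), Fin.prod_univ_succAbove s Q, hsQ]
      simp only [hsj]
      rw [Finset.prod_mul_distrib, Finset.prod_const, Finset.card_univ, Fintype.card_fin,
        ofReal_pow, ← hE1, ← hE2, ← hq, hκ]
      ring
    rw [hev, hV', mul_assoc, mul_add, mul_div_cancel₀ _ hκ0, ← hBκ]
    ring

end Suitable

end BenjaminOno

end

/-- The angles may be chosen separately for each l, without continuity. Adding 2π to one of them
flips the sign of both the sine and the leading factor, so their product is unaffected. -/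
theorem mainTheorem7 {n : ℕ} (V : BenjaminOno.RationalPotential n)
    (hV : V.IsPositiveKlausShaw) (J : Set ℝ)
    (N : ℝ → ℝ → Matrix (Fin (n + 1)) (Fin (n + 1)) ℂ)
    (W : Fin (n + 1) → BenjaminOno.Contour V J) :
    (J ⊆ Set.Iio 0 \ closure V.bulk → BenjaminOno.IsSuitableOutside N W →
      (∀ l ∈ J, ∀ ε > 0, BenjaminOno.leadingU W ε l ≠ 0) ∧
      ∀ K ⊆ J, IsCompact K → ∃ C : ℝ, ∃ ε₀ > 0, ∀ l ∈ K, ∀ ε, 0 < ε → ε < ε₀ →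
        ∃ e : ℂ, ‖e‖ ≤ C * ε ∧
          BenjaminOno.evans V N ε l = BenjaminOno.leadingU W ε l * (1 + e)) ∧
    (J ⊆ V.bulk → ∀ Q : Fin (n + 1), BenjaminOno.IsSuitableBulk N W Q →
      ∀ psiP psiM : ℝ → ℝ, (∀ l ∈ J, V.IsPsiPlus l (psiP l)) →
      (∀ l ∈ J, V.IsPsiMinus l (psiM l)) →
      (∀ l ∈ J, ∀ ε > 0, BenjaminOno.leadingV W Q ε l (psiP l) (psiM l) ≠ 0) ∧
      ∀ K ⊆ J, IsCompact K → ∃ C : ℝ, ∃ ε₀ > 0, ∀ l ∈ K, ∀ ε, 0 < ε → ε < ε₀ →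
        ∃ e : ℂ, ‖e‖ ≤ C * ε ∧
          BenjaminOno.evans V N ε l = BenjaminOno.leadingV W Q ε l (psiP l) (psiM l) *
            ((Real.sin (Real.pi * V.T ε l (psiP l) (psiM l)) : ℝ) + e)) :=
  ⟨fun _ hS => ⟨fun _ hl _ hε => BenjaminOno.leadingU_ne_zero hS hl hε,
      fun _ hKJ hK => BenjaminOno.evans_asymptotics_outside hS hKJ hK⟩,
    fun hJ _ hS psiP psiM hP hM =>
      ⟨fun l hl _ hε => BenjaminOno.leadingV_ne_zero hS hV hJ hl hε (psiP l) (psiM l),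
        fun _ hKJ hK => BenjaminOno.evans_asymptotics_bulk hS hV hJ hP hM hKJ hK⟩⟩
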